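/- Let $n\ge 3$, let $\Omega\subset\mathbb R^n$ be a bounded open set (for instance a bounded domain with smooth boundary), let $R>0$ with $\overline\Omega\subset B(0,R)$, and let $M>1$ and $0<\varepsilon<1$. Then there are constants $C_*>0$ and $C>0$, depending only on $n,\Omega,R,M,\varepsilon$, such that the following holds. Let $\gamma\in C^{1,\varepsilon}(\mathbb R^n)$ be real-valued with $\|\gamma\|_{L^\infty}+\|\nabla\gamma\|_{L^\infty}+[\nabla\gamma]_{C^{\varepsilon}}\le M$, $\gamma>1/(2M)$ on $\mathbb R^n$ and $\operatorname{supp}(\gamma-1)\subset\overline{B(0,R)}$. Let $D\in L^\infty(\Omega)$ (real or complex) with $\|D\|_{L^\infty(\Omega)}\le M$, let $k\ge 1$, and let $\zeta\in\mathbb C^n$ with $\zeta\cdot\zeta=\sum_j\zeta_j^2=0$ and $|\zeta|\ge C_*k^2$. Put $\Delta_\zeta=\Delta+2\zeta\cdot\nabla$ and $p_\zeta(\xi)=-|\xi|^2+2i\zeta\cdot\xi$. For $b\in\mathbb R$ let $\dot X^b_\zeta$ be the space of tempered distributions $u$ whose Fourier transform $\hat u$ is a locally integrable function with $\|u\|_{\dot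 X^b_\zeta}=\||p_\zeta(\xi)|^b\hat u(\xi)\|_{L^2}<\infty$. Define $Q$ and $m_Q\psi$, for a function $\psi$ with locally integrable weak gradient, by $$\langle Q|\phi\rangle=\int_{\mathbb R^n}\nabla\gamma^{1/2}\cdot\nabla(\gamma^{-1/2}\phi)\,dx+\int_\Omega(k^2+D)\gamma^{-1}\phi\,dx,\qquad \langle m_Q\psi|\phi\rangle=\int_{\mathbb R^n}\nabla\gamma^{1/2}\cdot\nabla(\gamma^{-1/2}\psi\phi)\,dx+\int_\Omega(k^2+D)\gamma^{-1}\psi\phi\,dx$$ for $\phi\in C_c^\infty(\mathbb R^n)$. Then $Q\in\dot X^{-1/2}_\zeta$, and there is exactly one $\psi\in\dot X^{1/2}_\zeta$ that is a function with locally integrable weak gradient and solves $$\Delta_\zeta\psi+m_Q\psi=-Q\quad\text{in }\mathbb R^n$$ in the sense of distributions. It satisfies $$\|\psi\|_{\dot X^{1/2}_\zeta}\le C\,\|Q\|_{\dot X^{-1/2}_\zeta},$$ where $C$ does not depend on $k$ (nor on $\zeta,\gamma,D$). Moreover $v=e^{\zeta\cdot x}(1+\psi)\in H^1_{loc}(\mathbb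 R^n)$ is a weak solution of $\Delta v+Qv=0$ in $\mathbb R^n$, that is, $-\int\nabla v\cdot\nabla\phi\,dx+\langle m_Qv|\phi\rangle=0$ for all $\phi\in C_c^\infty(\mathbb R^n)$. -/

import Mathlib

open MeasureTheory
open scoped SchwartzMap FourierTransform LineDeriv Laplacian NNReal ENNReal

noncomputable section

namespace CGO

/-- Real Euclidean space `ℝⁿ`. -/
abbrev E (n : ℕ) : Type := EuclideanSpace ℝ (Fin n)

/-- The `j`-th standard basis vector of `ℝⁿ`. -/
def e {n : ℕ} (j : Fin n) : E n := EuclideanSpace.single j 1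

/-- The bilinear pairing `ζ · x = ∑ ζ_j x_j` of `ζ ∈ ℂⁿ` with `x ∈ ℝⁿ`. -/
def cdot {n : ℕ} (ζ : EuclideanSpace ℂ (Fin n)) (x : E n) : ℂ := ∑ j, ζ j * (x j : ℂ)

/-- The classical partial derivative `∂_j f (x)`. -/
def pd {n : ℕ} {G : Type*} [NormedAddCommGroup G] [NormedSpace ℝ G]
    (j : Fin n) (f : E n → G) (x : E n) : G := fderiv ℝ f x (e j)

/-- The `C^{1,ε}(ℝⁿ)` norm `sup |γ| + sup |∇γ| + [∇γ]_ε` (meaningful for `C¹` functions). -/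
def c1HolderNorm {n : ℕ} (ε : ℝ≥0) (γ : E n → ℝ) : ℝ≥0∞ :=
  (⨆ x, ‖γ x‖ₑ) + (⨆ x, ‖fderiv ℝ γ x‖ₑ) + eHolderNorm ε (fderiv ℝ γ)

/-! ### The spaces `Ẋ^b_ζ` -/

/-- The symbol `p_ζ(ξ) = -|ξ|² + 2 i ζ·ξ` of `Δ_ζ = Δ + 2 ζ·∇`. -/
def symb {n : ℕ} (ζ : EuclideanSpace ℂ (Fin n)) (ξ : E n) : ℂ :=
  -((‖ξ‖ ^ 2 : ℝ) : ℂ) + 2 * Complex.I * cdot ζ ξ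

/-- The Fourier transform of the functional `T` on Schwartz functions is the locally integrable
function `g`: `⟨T, 𝓕 φ⟩ = ∫ g φ` for every Schwartz function `φ`. Here `𝓕` is Mathlib's Fourier
transform, with kernel `exp (-2 π i x·ξ)`. -/
def HasFourierRep {n : ℕ} (T : 𝓢(E n, ℂ) → ℂ) (g : E n → ℂ) : Prop :=
  LocallyIntegrable g ∧
    ∀ φ : 𝓢(E n, ℂ), Integrable (fun ξ => g ξ * φ ξ) ∧ T (𝓕 φ) = ∫ ξ, g ξ * φ ξ

/-- The norm `‖T‖ = ‖ |p_ζ|^b T̂ ‖_{L²}` of `Ẋ^b_ζ`, with value `∞` when `T` does not belong to the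
space; the function `g = T̂` is unique up to null sets. With the kernel `exp (-2 π i x·ξ)` the
frequency variable of the operator symbol is `2 π ξ`; by a change of variables this is exactly
the norm computed with the unitary transform `(2π)^{-n/2} ∫ exp (-i x·ξ) u(x) dx`. -/
def xNorm {n : ℕ} (ζ : EuclideanSpace ℂ (Fin n)) (b : ℝ) (T : 𝓢(E n, ℂ) → ℂ) : ℝ≥0∞ :=
  ⨅ (g : E n → ℂ) (_ : HasFourierRep T g),
    eLpNorm (fun ξ => ((‖symb ζ ((2 * Real.pi) • ξ)‖ ^ b : ℝ) : ℂ) * g ξ) 2 volume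

/-- Membership in `Ẋ^b_ζ`. -/
def MemX {n : ℕ} (ζ : EuclideanSpace ℂ (Fin n)) (b : ℝ) (T : 𝓢(E n, ℂ) → ℂ) : Prop :=
  xNorm ζ b T < ∞

/-! ### Weak derivatives; test functions are the compactly supported Schwartz functions, i.e. the
elements of `C_c^∞(ℝⁿ)`. -/

/-- `w = (w_1, …, w_n)` is the weak gradient of `u`. -/
def HasWeakGradient {n : ℕ} (u : E n → ℂ) (w : Fin n → E n → ℂ) : Prop :=
  LocallyIntegrable u ∧ (∀ j, LocallyIntegrable (w j)) ∧
    ∀ φ : 𝓢(E n, ℂ), HasCompactSupport φ → ∀ j,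
      ∫ x, u x * pd j φ x = -∫ x, w j x * φ x

/-- The distribution `ψ` is the locally integrable function `u`. -/
def IsRepresentedBy {n : ℕ} (ψ : 𝓢'(E n, ℂ)) (u : E n → ℂ) : Prop :=
  LocallyIntegrable u ∧
    ∀ φ : 𝓢(E n, ℂ), HasCompactSupport φ → ψ φ = ∫ x, u x * φ x

/-- `f ∈ L²_loc(ℝⁿ)`. -/
def MemL2loc {n : ℕ} (f : E n → ℂ) : Prop :=
  ∀ K : Set (E n), IsCompact K → MemLp f 2 (volume.restrict K)

/-! ### The potential `Q = -Δ√γ/√γ + (k² + D)/γ` -/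

/-- For a function `f` with gradient `F`, the number
`∫_{ℝⁿ} ∇γ^{1/2} · ∇(γ^{-1/2} f) dx + ∫_Ω (k² + D) γ^{-1} f dx`,
where `∇(γ^{-1/2} f) = f ∇γ^{-1/2} + γ^{-1/2} F`. -/
def qPairing {n : ℕ} (Ω : Set (E n)) (γ : E n → ℝ) (D : E n → ℂ) (k : ℝ)
    (f : E n → ℂ) (F : Fin n → E n → ℂ) : ℂ :=
  (∫ x, ∑ j, ((pd j (fun y => √(γ y)) x : ℝ) : ℂ) *
      (((pd j (fun y => (√(γ y))⁻¹) x : ℝ) : ℂ) * f x + (((√(γ x))⁻¹ : ℝ) : ℂ) * F j x)) +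
    ∫ x in Ω, ((k : ℂ) ^ 2 + D x) * ((γ x : ℝ) : ℂ)⁻¹ * f x

/-- The distribution `Q`: `φ ↦ ⟨Q | φ⟩`. -/
def Q {n : ℕ} (Ω : Set (E n)) (γ : E n → ℝ) (D : E n → ℂ) (k : ℝ) (φ : 𝓢(E n, ℂ)) : ℂ :=
  qPairing Ω γ D k φ (fun j x => pd j φ x)

/-- `⟨m_Q u | φ⟩` for a function `u` with weak gradient `w`: the number `⟨Q | u φ⟩`, where
`∇(u φ) = φ w + u ∇φ`. -/
def mQ {n : ℕ} (Ω : Set (E n)) (γ : E n → ℝ) (D : E n → ℂ) (k : ℝ)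
    (u : E n → ℂ) (w : Fin n → E n → ℂ) (φ : 𝓢(E n, ℂ)) : ℂ :=
  qPairing Ω γ D k (fun x => u x * φ x) (fun j x => w j x * φ x + u x * pd j φ x)

/-- `Δ_ζ ψ = Δψ + 2 ζ·∇ψ`, for tempered distributions. -/
def lapZeta {n : ℕ} (ζ : EuclideanSpace ℂ (Fin n)) (ψ : 𝓢'(E n, ℂ)) : 𝓢'(E n, ℂ) :=
  Δ ψ + (2 : ℂ) • ∑ j, ζ j • ∂_{(e j : E n)} ψ

/-- `Δ_ζ ψ + m_Q ψ = -Q` on `ℝⁿ`, tested against `C_c^∞`. Since `m_Q ψ` involves `∇ψ`, the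
distribution `ψ` has to be a function with a (locally integrable) weak gradient, as all elements
of `Ẋ^{1/2}_ζ` are. -/
def SolvesRemainderEq {n : ℕ} (Ω : Set (E n)) (γ : E n → ℝ) (D : E n → ℂ) (k : ℝ)
    (ζ : EuclideanSpace ℂ (Fin n)) (ψ : 𝓢'(E n, ℂ)) : Prop :=
  ∃ (u : E n → ℂ) (w : Fin n → E n → ℂ), IsRepresentedBy ψ u ∧ HasWeakGradient u w ∧
    ∀ φ : 𝓢(E n, ℂ), HasCompactSupport φ →
      lapZeta ζ ψ φ + mQ Ω γ D k u w φ = -Q Ω γ D k φ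

/-- `v ∈ H¹_loc(ℝⁿ)` is a weak solution of `Δv + Q v = 0` on `ℝⁿ`:
`-∫ ∇v·∇φ + ⟨m_Q v | φ⟩ = 0` for all `φ ∈ C_c^∞`. -/
def SolvesHelmholtz {n : ℕ} (Ω : Set (E n)) (γ : E n → ℝ) (D : E n → ℂ) (k : ℝ)
    (v : E n → ℂ) : Prop :=
  ∃ w : Fin n → E n → ℂ, HasWeakGradient v w ∧ MemL2loc v ∧ (∀ j, MemL2loc (w j)) ∧
    ∀ φ : 𝓢(E n, ℂ), HasCompactSupport φ →
      -(∫ x, ∑ j, w j x * pd j φ x) + mQ Ω γ D k v w φ = 0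

end CGO

end

/-! Everything is transported to `L²` on the Fourier side. An element of the space with exponent 1/2
is determined by its profile `h ∈ L²`, its transform being `|p_ζ|^{-1/2} h`; an element with
exponent -1/2 has transform `|p_ζ|^{1/2} q`. Between profiles, `Δ_ζ` is multiplication by the
unimodular phase `p_ζ/|p_ζ|`, a unitary operator `U`. If `m_Q` becomes an operator `T` with `‖T‖ ≤
1/2`, the remainder equation reads `U h + T h = -q`. A Neumann series then gives existence,
uniqueness and `‖h‖ ≤ 2 ‖q‖`, so `C = 2` works.

The analytic input is a localised smoothing estimate: on bounded sets the `L²` norm of `u` is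
`O(|ζ|^{-1/2})` and that of `∇u` is `O(|ζ|^{1/2})` times the norm of `u`. The localiser is the
Gaussian `e^{-π|x|²}`, which is its own Fourier transform, so the operator `f ↦ |p_ζ|^{-1/2}
𝓕(e^{-π|x|²} f)` is bounded through Jensen and Tonelli (`GaussBounded.eLpNorm_le`) as soon as the
Gaussian averages of `1/|p_ζ|` are `O(1/|ζ|)` uniformly in the centre. In coordinates adapted to
`ζ`, `1/|p_ζ|` is dominated by `1/s`, with `s` comparable to `|ζ|`, times a constant plus products
of two inverse square roots in different coordinates (`ofReal_inv_normalForm_le`); these are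
integrated one coordinate at a time. The Gaussian is undone at the end, because all coefficients
have compact support.

With `A = ∇γ/(2γ)`, the potential is the first-order form `∫ a₀ f + ∫ A·∇f`, where `a₀` is bounded
by a constant times `k²`. By the smoothing estimate the first term costs `‖a₀‖_∞/|ζ|` and the second
`‖A‖_∞`, with no gain from `|ζ|` (`norm_opT_le`). The Hölder bound repairs this: `A` is uniformly
close to a mollification `S` at a scale depending only on the data, and the `S` part is integrated
by parts into the zeroth-order coefficient, where it also gains `1/|ζ|` (`opT_eq_of_smooth`). Hence
`‖T‖ ≤ 1/2` once `|ζ| ≥ C_* k²` (`exists_norm_opT_le`).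

Finally, conjugation by `e^{ζ·x}` turns `Δ` into `Δ_ζ` because `ζ·ζ = 0`, which gives the equation
for `v`. -/

noncomputable section

namespace CGO

/-! ### One-dimensional weights -/

/-- The weight `|t|^{-1/2}`, with value `∞` at the origin. -/
def invSqrt (t : ℝ) : ℝ≥0∞ := ENNReal.ofReal |t| ^ (-1 / 2 : ℝ)

/-- The normalised Gaussian `exp (-π (t - c)²)`. -/
def gauss (c t : ℝ) : ℝ≥0∞ := ENNReal.ofReal (Real.exp (-Real.pi * (t - c) ^ 2))

@[fun_prop]
lemma measurable_invSqrt : Measurable invSqrt := by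
  unfold invSqrt; fun_prop

@[fun_prop]
lemma measurable_gauss (c : ℝ) : Measurable (gauss c) := by
  unfold gauss; fun_prop

lemma invSqrt_neg (t : ℝ) : invSqrt (-t) = invSqrt t := by simp [invSqrt]

lemma invSqrt_zero : invSqrt 0 = ∞ := by
  rw [invSqrt, abs_zero, ENNReal.ofReal_zero, ENNReal.zero_rpow_of_neg (by norm_num)]

lemma invSqrt_ne_zero (t : ℝ) : invSqrt t ≠ 0 := by
  simp [invSqrt, ENNReal.rpow_eq_zero_iff]

lemma invSqrt_of_ne {t : ℝ} (ht : t ≠ 0) :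
    invSqrt t = ENNReal.ofReal (√|t|)⁻¹ := by
  have h : 0 < |t| := abs_pos.mpr ht
  rw [invSqrt, ENNReal.ofReal_rpow_of_pos h, Real.sqrt_eq_rpow, ← Real.rpow_neg h.le]
  norm_num

lemma invSqrt_le_one {t : ℝ} (ht : 1 ≤ |t|) : invSqrt t ≤ 1 := by
  rw [invSqrt_of_ne (by intro h; norm_num [h] at ht)]
  rw [ENNReal.ofReal_le_one]
  exact inv_le_one_of_one_le₀ (Real.one_le_sqrt.mpr ht)

lemma invSqrt_abs_sub_le (y b : ℝ) : invSqrt (|y| - b) ≤ invSqrt (y - b) + invSqrt (y + b) := by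
  rcases abs_cases y with ⟨h, -⟩ | ⟨h, -⟩
  · rw [h]; exact le_self_add
  · rw [h, show -y - b = -(y + b) by ring, invSqrt_neg]; exact le_add_self

lemma lintegral_gauss (c : ℝ) : ∫⁻ t, gauss c t = 1 := by
  unfold gauss
  rw [lintegral_sub_right_eq_self (fun t => ENNReal.ofReal (Real.exp (-Real.pi * t ^ 2))) c,
    ← ofReal_integral_eq_lintegral_ofReal (integrable_exp_neg_mul_sq Real.pi_pos)
      (Filter.Eventually.of_forall fun _ => (Real.exp_pos _).le), integral_gaussian]
  simp [Real.pi_ne_zero]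

/-- The integral of `|t|^{-1/2}` over `[-1, 1]`, plus one. -/
def invSqrtConst : ℝ≥0∞ := 1 + ∫⁻ t in Set.Icc (-1) 1, invSqrt t

lemma invSqrtConst_lt_top : invSqrtConst < ∞ := by
  refine ENNReal.add_lt_top.mpr ⟨ENNReal.one_lt_top, ?_⟩
  have h1 : ∫⁻ t in Set.Ioc (0 : ℝ) 1, invSqrt t < ∞ := by
    have := (intervalIntegral.intervalIntegrable_rpow' (a := 0) (b := 1) (r := -1 / 2)
      (by norm_num))
    rw [intervalIntegrable_iff_integrableOn_Ioc_of_le zero_le_one] at this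
    refine lt_of_eq_of_lt ?_ this.2
    refine setLIntegral_congr_fun measurableSet_Ioc fun t ht => ?_
    have ht0 : 0 < t := ht.1
    simp only [invSqrt]
    rw [abs_of_pos ht0, ENNReal.ofReal_rpow_of_pos ht0, Real.enorm_of_nonneg (by positivity)]
  have h2 : ∫⁻ t in Set.Ico (-1 : ℝ) 0, invSqrt t < ∞ := by
    have hmp := (Measure.measurePreserving_neg (volume : Measure ℝ)).setLIntegral_comp_preimage
      (measurableSet_Ioc (a := (0 : ℝ)) (b := 1)) measurable_invSqrt
    rw [← hmp] at h1
    simpa [invSqrt_neg] using h1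
  have h3 : ∫⁻ t in Set.Icc (-1 : ℝ) 1, invSqrt t ≤
      ∫⁻ t in Set.Ico (-1 : ℝ) 0 ∪ ({0} ∪ Set.Ioc (0 : ℝ) 1), invSqrt t := by
    apply lintegral_mono_set
    intro t ht
    rcases lt_trichotomy t 0 with h | h | h
    · exact Or.inl ⟨ht.1, h⟩
    · exact Or.inr (Or.inl h)
    · exact Or.inr (Or.inr ⟨h, ht.2⟩)
  refine h3.trans_lt ((lintegral_union_le _ _ _).trans_lt (ENNReal.add_lt_top.mpr ⟨h2, ?_⟩))
  refine (lintegral_union_le _ _ _).trans_lt (ENNReal.add_lt_top.mpr ⟨?_, h1⟩)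
  simp

lemma lintegral_gauss_mul_invSqrt_le (c b : ℝ) :
    ∫⁻ t, gauss c t * invSqrt (t - b) ≤ invSqrtConst := by
  have h1 : ∀ t, gauss c t * invSqrt (t - b) ≤
      gauss c t + (Set.Icc (-1) 1).indicator invSqrt (t - b) := by
    intro t
    by_cases h : t - b ∈ Set.Icc (-1 : ℝ) 1
    · rw [Set.indicator_of_mem h]
      refine le_trans ?_ le_add_self
      refine mul_le_of_le_one_left' ?_
      rw [gauss, ENNReal.ofReal_le_one, Real.exp_le_one_iff]
      nlinarith [Real.pi_pos, sq_nonneg (t - c), mul_nonneg Real.pi_pos.le (sq_nonneg (t - c))]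
    · refine le_trans ?_ le_self_add
      refine mul_le_of_le_one_right' (invSqrt_le_one ?_)
      rw [Set.mem_Icc, ← abs_le] at h
      exact (not_le.mp h).le
  calc _ ≤ ∫⁻ t, gauss c t + (Set.Icc (-1) 1).indicator invSqrt (t - b) := lintegral_mono h1
    _ = _ := by
      rw [lintegral_add_left (measurable_gauss c), lintegral_gauss,
        lintegral_sub_right_eq_self (fun t => (Set.Icc (-1) 1).indicator invSqrt t) b,
        lintegral_indicator measurableSet_Icc, invSqrtConst]

/-! ### Integration in one coordinate against a Gaussian on `Fin n → ℝ` -/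

/-- The Gaussian with centre `c` on `ℝⁿ`, as a product. -/
def gaussPi {n : ℕ} (c y : Fin n → ℝ) : ℝ≥0∞ := ∏ i, gauss (c i) (y i)

@[fun_prop]
lemma measurable_gaussPi {n : ℕ} (c : Fin n → ℝ) : Measurable (gaussPi c) := by
  unfold gaussPi; fun_prop

/-- Tonelli in the single coordinate `j`. The Gaussian factor in `y_j` is used up by the hypothesis
`hle`; since `H` does not see `y_j`, the factor can be put back on the right because it has integral
one. Iterating the lemma eliminates the singular coordinates one by one. -/
lemma lintegral_gaussPi_mul_le_of_update {n : ℕ} (c : Fin n → ℝ) (j : Fin n)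
    {F H : (Fin n → ℝ) → ℝ≥0∞} (hF : Measurable F) (hH : Measurable H) (C : ℝ≥0∞)
    (hHj : ∀ y t, H (Function.update y j t) = H y)
    (hle : ∀ y, ∫⁻ t, gauss (c j) t * F (Function.update y j t) ≤ C * H y) :
    ∫⁻ y, gaussPi c y * F y ≤ C * ∫⁻ y, gaussPi c y * H y := by
  have hsplit : ∀ y t, gaussPi c (Function.update y j t) =
      (∏ i ∈ Finset.univ.erase j, gauss (c i) (y i)) * gauss (c j) t := by
    intro y t
    rw [gaussPi, ← Finset.prod_erase_mul _ _ (Finset.mem_univ j)]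
    congr 1
    · refine Finset.prod_congr rfl fun i hi => ?_
      rw [Function.update_of_ne (Finset.ne_of_mem_erase hi)]
    · simp
  rw [← lintegral_const_mul _ (by fun_prop), volume_pi]
  refine lintegral_le_of_lmarginal_le {j} (by fun_prop) (by fun_prop) ?_
  rw [lmarginal_singleton, lmarginal_singleton]
  intro y
  simp only [hsplit, hHj]
  have hm : Measurable fun t => F (Function.update y j t) := by fun_prop
  calc ∫⁻ t, (∏ i ∈ Finset.univ.erase j, gauss (c i) (y i)) * gauss (c j) t *
        F (Function.update y j t)
      = (∏ i ∈ Finset.univ.erase j, gauss (c i) (y i)) *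
        ∫⁻ t, gauss (c j) t * F (Function.update y j t) := by
        simp only [mul_assoc]
        exact lintegral_const_mul _ (by fun_prop)
    _ ≤ (∏ i ∈ Finset.univ.erase j, gauss (c i) (y i)) * (C * H y) := by gcongr; exact hle y
    _ = ∫⁻ t, C * ((∏ i ∈ Finset.univ.erase j, gauss (c i) (y i)) * gauss (c j) t * H y) := by
        have : ∀ t, C * ((∏ i ∈ Finset.univ.erase j, gauss (c i) (y i)) * gauss (c j) t * H y) =
          (∏ i ∈ Finset.univ.erase j, gauss (c i) (y i)) * (C * H y) * gauss (c j) t := by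
          intro t; ring
        simp only [this]
        rw [lintegral_const_mul _ (by fun_prop), lintegral_gauss, mul_one]

lemma lintegral_gaussian {n : ℕ} (c : E n) :
    ∫⁻ x : E n, ENNReal.ofReal (Real.exp (-Real.pi * ‖x - c‖ ^ 2)) = 1 := by
  rw [lintegral_sub_right_eq_self
    (fun x : E n => ENNReal.ofReal (Real.exp (-Real.pi * ‖x‖ ^ 2))) c,
    ← ofReal_integral_eq_lintegral_ofReal ?_
      (Filter.Eventually.of_forall fun _ => (Real.exp_pos _).le),
    GaussianFourier.integral_rexp_neg_mul_sq_norm Real.pi_pos]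
  · simp [Real.pi_ne_zero]
  · by_contra h
    have := GaussianFourier.integral_rexp_neg_mul_sq_norm (V := E n) Real.pi_pos
    rw [integral_undef h] at this
    simp [Real.pi_ne_zero] at this

lemma gaussPi_ofLp {n : ℕ} (c x : E n) :
    gaussPi c x = ENNReal.ofReal (Real.exp (-Real.pi * ‖x - c‖ ^ 2)) := by
  rw [gaussPi, EuclideanSpace.norm_sq_eq, Finset.mul_sum, Real.exp_sum,
    ENNReal.ofReal_prod_of_nonneg fun _ _ => (Real.exp_pos _).le]
  simp [gauss]

lemma lintegral_comp_ofLp {n : ℕ} {f : (Fin n → ℝ) → ℝ≥0∞} (hf : Measurable f) :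
    ∫⁻ x : E n, f x = ∫⁻ y, f y :=
  (PiLp.volume_preserving_ofLp (Fin n)).lintegral_comp hf

lemma lintegral_gaussPi {n : ℕ} (c : Fin n → ℝ) : ∫⁻ y, gaussPi c y = 1 := by
  rw [← lintegral_comp_ofLp (measurable_gaussPi c), ← lintegral_gaussian (WithLp.toLp 2 c)]
  exact lintegral_congr fun x => gaussPi_ofLp (WithLp.toLp 2 c) x

/-! ### The symbol near its characteristic sphere -/

/-- A real quantity comparable to the symbol, in coordinates adapted to `ζ`. -/
def normalForm {n : ℕ} (i₀ : Fin n) (s : ℝ) (y : Fin n → ℝ) : ℝ :=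
  |∑ i, y i ^ 2 - s ^ 2| + 2 * s * |y i₀|

/-- The modulus of the `j`-th coordinate on the characteristic sphere. -/
def sphereCoord {n : ℕ} (i₀ : Fin n) (s : ℝ) (j : Fin n) (y : Fin n → ℝ) : ℝ :=
  √(s ^ 2 - ∑ i ∈ (Finset.univ.erase i₀).erase j, y i ^ 2)

@[fun_prop]
lemma measurable_sphereCoord {n : ℕ} (i₀ : Fin n) (s : ℝ) (j : Fin n) :
    Measurable (sphereCoord i₀ s j) := by
  unfold sphereCoord; fun_prop

lemma sphereCoord_update {n : ℕ} (i₀ : Fin n) (s : ℝ) (j : Fin n) (y : Fin n → ℝ) (t : ℝ) :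
    sphereCoord i₀ s j (Function.update y j t) = sphereCoord i₀ s j y := by
  unfold sphereCoord
  congr 2
  refine Finset.sum_congr rfl fun i hi => ?_
  rw [Function.update_of_ne (Finset.ne_of_mem_erase hi)]

/-- Factor `y² - T = (y + √T)(y - √T)`. For `T ≤ 0` the convention `√T = 0` keeps the inequality
true, so no case distinction on whether the sphere meets the line is needed later. -/
lemma mul_abs_sub_sqrt_le {y T : ℝ} (hy : 0 ≤ y) : y * |y - √T| ≤ |y ^ 2 - T| := by
  rcases le_total 0 T with hT | hT
  · have h : y ^ 2 - T = (y + √T) * (y - √T) := by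
      have := Real.sq_sqrt hT
      nlinarith
    rw [h, abs_mul, abs_of_nonneg (add_nonneg hy (Real.sqrt_nonneg T))]
    gcongr
    linarith [Real.sqrt_nonneg T]
  · rw [Real.sqrt_eq_zero_of_nonpos hT, sub_zero, abs_of_nonneg hy,
      abs_of_nonneg (by nlinarith [sq_nonneg y])]
    nlinarith

/-- A geometric mean: if `P` controls both `|x|` and `|z|`, then `1/P` is controlled by `|x|^{-1/2}
|z|^{-1/2}`. This replaces a nonintegrable `1/|x|` by two integrable singularities in separate
variables. The value `∞` of `invSqrt` at the origin covers `x = 0` and `z = 0`. -/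
lemma ofReal_inv_le_invSqrt_mul {P x z c : ℝ} (hc : 0 < c) (hP : 0 ≤ P)
    (h : |x| * |z| ≤ (c * P) ^ 2) :
    ENNReal.ofReal (1 / P) ≤ ENNReal.ofReal c * (invSqrt x * invSqrt z) := by
  have hc' : ENNReal.ofReal c ≠ 0 := by simpa using hc
  by_cases hx : x = 0
  · rw [hx, invSqrt_zero, ENNReal.top_mul (invSqrt_ne_zero z), ENNReal.mul_top hc']
    exact le_top
  by_cases hz : z = 0
  · rw [hz, invSqrt_zero, ENNReal.mul_top (invSqrt_ne_zero x), ENNReal.mul_top hc']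
    exact le_top
  have hx' := abs_pos.mpr hx
  have hz' := abs_pos.mpr hz
  rw [invSqrt_of_ne hx, invSqrt_of_ne hz, ← ENNReal.ofReal_mul (by positivity),
    ← ENNReal.ofReal_mul hc.le]
  apply ENNReal.ofReal_le_ofReal
  have hcP : 0 < c * P := by
    rcases (mul_nonneg hc.le hP).lt_or_eq with h0 | h0
    · exact h0
    · rw [← h0] at h; nlinarith [mul_pos hx' hz']
  have hP' : 0 < P := by
    rcases hP.lt_or_eq with h0 | h0
    · exact h0
    · rw [← h0] at hcP; simp at hcP
  have h2 : √|x| * √|z| ≤ c * P := by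
    rw [← Real.sqrt_mul hx'.le]
    exact Real.sqrt_le_iff.mpr ⟨hcP.le, h⟩
  rw [← mul_inv, ← div_eq_mul_inv, div_le_div_iff₀ hP' (by positivity)]
  linarith

/-- Away from the characteristic sphere the quantity is at least `s/(2n)`. Near it, `y_{i₀}` is
small and some other coordinate `y_j` is comparable to `s`, so the sphere is a graph over the
remaining coordinates. There `y_{i₀}` and `|y_j| - sphereCoord` serve as two transversal variables,
both bounded by `(2n/s)` times the quantity. -/
lemma ofReal_inv_normalForm_le {n : ℕ} (i₀ : Fin n) {s : ℝ} (hs : 1 ≤ s) (y : Fin n → ℝ) :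
    ENNReal.ofReal (1 / normalForm i₀ s y) ≤ ENNReal.ofReal (2 * n / s) *
      (1 + ∑ j ∈ Finset.univ.erase i₀,
        invSqrt (y i₀) * invSqrt (|y j| - sphereCoord i₀ s j y)) := by
  have hn : (1 : ℝ) ≤ n := by
    have : 0 < n := i₀.pos
    exact_mod_cast this
  have hs0 : 0 < s := by linarith
  set P := normalForm i₀ s y with hP
  have hPdef : P = |∑ i, y i ^ 2 - s ^ 2| + 2 * s * |y i₀| := rfl
  have habs := abs_nonneg (∑ i, y i ^ 2 - s ^ 2)
  have hx0 : 0 ≤ 2 * s * |y i₀| := by positivity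
  have easy : s / (2 * n) ≤ P → ENNReal.ofReal (1 / P) ≤ ENNReal.ofReal (2 * n / s) *
      (1 + ∑ j ∈ Finset.univ.erase i₀,
        invSqrt (y i₀) * invSqrt (|y j| - sphereCoord i₀ s j y)) := by
    intro h
    rw [mul_add, mul_one]
    refine le_trans (ENNReal.ofReal_le_ofReal ?_) le_self_add
    rw [show 2 * (n : ℝ) / s = 1 / (s / (2 * n)) by field_simp]
    exact one_div_le_one_div_of_le (by positivity) h
  by_cases h1 : s ^ 2 / 2 ≤ |∑ i, y i ^ 2 - s ^ 2|
  · apply easy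
    rw [div_le_iff₀ (by positivity)]
    nlinarith
  by_cases h2 : s / (2 * n) ≤ |y i₀|
  · apply easy
    nlinarith [abs_nonneg (y i₀)]
  push Not at h1 h2
  have hxs : |y i₀| ≤ s / 2 := by
    refine h2.le.trans ?_
    rw [div_le_div_iff₀ (by positivity) (by positivity)]
    nlinarith
  have hx2 : y i₀ ^ 2 ≤ s ^ 2 / 4 := by
    rw [← sq_abs]; nlinarith [abs_nonneg (y i₀)]
  have hsum := Finset.add_sum_erase Finset.univ (fun i => y i ^ 2) (Finset.mem_univ i₀)
  -- Pigeonhole: the total of the squares exceeds `s²/2` and `y_{i₀}²` is at most `s²/4`, so the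
  -- other `n - 1` squares add up to at least `s²/4`.
  obtain ⟨j, hj, hjle⟩ : ∃ j ∈ Finset.univ.erase i₀, s ^ 2 / (4 * n) ≤ y j ^ 2 := by
    by_contra! hcon
    have hle : ∑ i ∈ Finset.univ.erase i₀, y i ^ 2 ≤
        ∑ i ∈ Finset.univ.erase i₀, s ^ 2 / (4 * (n : ℝ)) :=
      Finset.sum_le_sum fun i hi => (hcon i hi).le
    rw [Finset.sum_const, Finset.card_erase_of_mem (Finset.mem_univ _), Finset.card_univ,
      Fintype.card_fin, nsmul_eq_mul, Nat.cast_sub i₀.pos, Nat.cast_one] at hle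
    have h3 : ((n : ℝ) - 1) * (s ^ 2 / (4 * n)) < s ^ 2 / 4 := by
      rw [mul_div_assoc', div_lt_div_iff₀ (by positivity) (by positivity)]
      nlinarith [pow_pos hs0 2]
    have := neg_abs_le (∑ i, y i ^ 2 - s ^ 2)
    linarith
  have hyj : s / (2 * n) ≤ |y j| := by
    refine le_of_sq_le_sq ?_ (abs_nonneg _)
    rw [sq_abs]
    refine le_trans ?_ hjle
    rw [div_pow, div_le_div_iff₀ (by positivity) (by positivity)]
    nlinarith [mul_nonneg (pow_pos hs0 2).le (mul_nonneg (by linarith : (0 : ℝ) ≤ n)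
      (sub_nonneg.mpr hn))]
  have hsum2 := Finset.add_sum_erase (Finset.univ.erase i₀) (fun i => y i ^ 2) hj
  set T := s ^ 2 - ∑ i ∈ (Finset.univ.erase i₀).erase j, y i ^ 2 with hT
  -- `|y_j|² - T` differs from `|y|² - s²` by `y_{i₀}²`, which the term `2 s |y_{i₀}|` of `P`
  -- absorbs.
  have hkey : |y j| * |(|y j| - √T)| ≤ P := by
    refine (mul_abs_sub_sqrt_le (abs_nonneg (y j))).trans ?_
    have : |y j| ^ 2 - T = (∑ i, y i ^ 2 - s ^ 2) - y i₀ ^ 2 := by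
      rw [sq_abs, hT]; linarith
    rw [this]
    refine (abs_sub _ _).trans ?_
    rw [hPdef, abs_of_nonneg (sq_nonneg (y i₀))]
    have : y i₀ ^ 2 ≤ 2 * s * |y i₀| := by
      rw [← sq_abs]; nlinarith [abs_nonneg (y i₀)]
    linarith
  have hsc : sphereCoord i₀ s j y = √T := rfl
  have hmain : ENNReal.ofReal (1 / P) ≤ ENNReal.ofReal (2 * n / s) *
      (invSqrt (y i₀) * invSqrt (|y j| - sphereCoord i₀ s j y)) := by
    rw [hsc]
    refine ofReal_inv_le_invSqrt_mul (by positivity) (by rw [hPdef]; positivity) ?_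
    have h4 : s / (2 * n) * |(|y j| - √T)| ≤ P :=
      (mul_le_mul_of_nonneg_right hyj (abs_nonneg _)).trans hkey
    have h5 : |(|y j| - √T)| ≤ 2 * n / s * P := by
      rw [div_mul_eq_mul_div, le_div_iff₀ hs0]
      rw [div_mul_eq_mul_div, div_le_iff₀ (by positivity)] at h4
      linarith
    have h6 : |y i₀| ≤ 2 * n / s * P := by
      rw [div_mul_eq_mul_div, le_div_iff₀ hs0]
      nlinarith [abs_nonneg (y i₀), mul_nonneg hs0.le (abs_nonneg (y i₀))]
    rw [sq]
    exact mul_le_mul h6 h5 (abs_nonneg _) (by rw [hPdef]; positivity)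
  refine hmain.trans ?_
  gcongr
  refine le_trans ?_ le_add_self
  exact Finset.single_le_sum (f := fun j => invSqrt (y i₀) * invSqrt (|y j| - sphereCoord i₀ s j y))
    (fun _ _ => zero_le) hj

/-- The constant in `lintegral_gaussPi_mul_inv_normalForm_le`. -/
def normalFormConst (n : ℕ) : ℝ≥0∞ := 2 * n * (1 + n * (2 * invSqrtConst * invSqrtConst))

lemma normalFormConst_lt_top (n : ℕ) : normalFormConst n < ∞ := by
  have := invSqrtConst_lt_top
  unfold normalFormConst
  finiteness

/-- Each product term is integrated first in `y_j`, where `sphereCoord` is constant, then in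
`y_{i₀}`. The one-dimensional bound is uniform in the position of the singularity and in the centre
of the Gaussian, hence so is the result. -/
lemma lintegral_gaussPi_mul_inv_normalForm_le {n : ℕ} (i₀ : Fin n) {s : ℝ} (hs : 1 ≤ s)
    (c : Fin n → ℝ) :
    ∫⁻ y, gaussPi c y * ENNReal.ofReal (1 / normalForm i₀ s y) ≤
      normalFormConst n * ENNReal.ofReal (1 / s) := by
  have hterm : ∀ j ∈ Finset.univ.erase i₀, ∫⁻ y, gaussPi c y *
      (invSqrt (y i₀) * invSqrt (|y j| - sphereCoord i₀ s j y)) ≤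
      2 * invSqrtConst * invSqrtConst := by
    intro j hj
    have hji : i₀ ≠ j := (Finset.ne_of_mem_erase hj).symm
    calc ∫⁻ y, gaussPi c y * (invSqrt (y i₀) * invSqrt (|y j| - sphereCoord i₀ s j y))
        ≤ ∫⁻ y, gaussPi c y * (invSqrt (y i₀) * (invSqrt (y j - sphereCoord i₀ s j y) +
          invSqrt (y j + sphereCoord i₀ s j y))) := by
          gcongr with y; exact invSqrt_abs_sub_le _ _
      _ ≤ (2 * invSqrtConst) * ∫⁻ y, gaussPi c y * invSqrt (y i₀) := by
          refine lintegral_gaussPi_mul_le_of_update c j (by fun_prop) (by fun_prop) _ ?_ ?_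
          · intro y t; rw [Function.update_of_ne hji]
          · intro y
            simp only [Function.update_of_ne hji, Function.update_self, sphereCoord_update]
            set b := sphereCoord i₀ s j y
            have e1 : ∀ t, gauss (c j) t * (invSqrt (y i₀) * (invSqrt (t - b) +
              invSqrt (t + b))) = invSqrt (y i₀) * (gauss (c j) t * invSqrt (t - b) +
                gauss (c j) t * invSqrt (t - -b)) := by
              intro t; rw [sub_neg_eq_add]; ring
            simp only [e1]
            rw [lintegral_const_mul _ (by fun_prop), lintegral_add_left (by fun_prop), mul_comm]
            gcongr
            rw [two_mul]
            exact add_le_add (lintegral_gauss_mul_invSqrt_le _ _)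
              (lintegral_gauss_mul_invSqrt_le _ _)
      _ ≤ (2 * invSqrtConst) * (invSqrtConst * ∫⁻ y, gaussPi c y * 1) := by
          gcongr
          refine lintegral_gaussPi_mul_le_of_update c i₀ (by fun_prop) (by fun_prop) _ ?_ ?_
          · intro y t; rfl
          · intro y
            simp only [Function.update_self, mul_one]
            simpa using lintegral_gauss_mul_invSqrt_le (c i₀) 0
      _ = _ := by simp [lintegral_gaussPi]
  calc ∫⁻ y, gaussPi c y * ENNReal.ofReal (1 / normalForm i₀ s y)
      ≤ ∫⁻ y, ENNReal.ofReal (2 * n / s) * (gaussPi c y + ∑ j ∈ Finset.univ.erase i₀,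
        gaussPi c y * (invSqrt (y i₀) * invSqrt (|y j| - sphereCoord i₀ s j y))) := by
        refine lintegral_mono fun y => ?_
        refine (mul_le_mul_right (ofReal_inv_normalForm_le i₀ hs y) _).trans (le_of_eq ?_)
        rw [mul_left_comm, mul_add, mul_one, Finset.mul_sum]
    _ = ENNReal.ofReal (2 * n / s) * (1 + ∑ j ∈ Finset.univ.erase i₀, ∫⁻ y,
        gaussPi c y * (invSqrt (y i₀) * invSqrt (|y j| - sphereCoord i₀ s j y))) := by
        rw [lintegral_const_mul _ (by fun_prop), lintegral_add_left (by fun_prop),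
          lintegral_gaussPi, lintegral_finsetSum _ (by fun_prop)]
    _ ≤ ENNReal.ofReal (2 * n / s) * (1 + n * (2 * invSqrtConst * invSqrtConst)) := by
        gcongr
        refine (Finset.sum_le_sum hterm).trans ?_
        rw [Finset.sum_const, nsmul_eq_mul]
        gcongr
        exact (Finset.card_le_univ _).trans_eq (Fintype.card_fin n)
    _ = _ := by
        rw [normalFormConst, div_eq_mul_one_div, ENNReal.ofReal_mul (by positivity),
          ENNReal.ofReal_mul (by positivity)]
        simp only [ENNReal.ofReal_ofNat, ENNReal.ofReal_natCast]
        ring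

/-! ### The symbol of `Δ_ζ` -/

/-- The real part of `ζ ∈ ℂⁿ`. -/
def reVec {n : ℕ} (ζ : EuclideanSpace ℂ (Fin n)) : E n := WithLp.toLp 2 fun j => (ζ j).re

/-- The imaginary part of `ζ ∈ ℂⁿ`. -/
def imVec {n : ℕ} (ζ : EuclideanSpace ℂ (Fin n)) : E n := WithLp.toLp 2 fun j => (ζ j).im

/-- The symbol of `Δ_ζ` in the frequency variable of the transform with kernel
`exp (-2 π i x·ξ)`. -/
def freqSymb {n : ℕ} (ζ : EuclideanSpace ℂ (Fin n)) (ξ : E n) : ℂ :=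
  symb ζ ((2 * Real.pi) • ξ)

section Symbol

variable {n : ℕ} (ζ : EuclideanSpace ℂ (Fin n))

lemma cdot_eq_inner (x : E n) :
    cdot ζ x = (inner ℝ (reVec ζ) x : ℝ) + (inner ℝ (imVec ζ) x : ℝ) * Complex.I := by
  simp only [cdot, PiLp.inner_apply, reVec, imVec, RCLike.inner_apply, conj_trivial]
  push_cast
  rw [Finset.sum_mul, ← Finset.sum_add_distrib]
  refine Finset.sum_congr rfl fun j _ => ?_
  conv_lhs => rw [← Complex.re_add_im (ζ j)]
  ring

lemma symb_re (x : E n) : (symb ζ x).re = -(‖x‖ ^ 2 + 2 * inner ℝ (imVec ζ) x) := by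
  rw [symb, cdot_eq_inner]
  simp [-Complex.ofReal_pow]
  ring

lemma symb_im (x : E n) : (symb ζ x).im = 2 * inner ℝ (reVec ζ) x := by
  rw [symb, cdot_eq_inner]
  simp [-Complex.ofReal_pow]

lemma norm_sq_eq_reVec_add_imVec : ‖ζ‖ ^ 2 = ‖reVec ζ‖ ^ 2 + ‖imVec ζ‖ ^ 2 := by
  simp only [EuclideanSpace.norm_sq_eq, reVec, imVec, ← Finset.sum_add_distrib, Real.norm_eq_abs,
    sq_abs]
  refine Finset.sum_congr rfl fun j _ => ?_
  rw [Complex.sq_norm, Complex.normSq_apply]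
  ring

variable {ζ}

lemma norm_reVec_eq_norm_imVec (hζ : ∑ j, ζ j * ζ j = 0) : ‖reVec ζ‖ = ‖imVec ζ‖ := by
  have h := congrArg Complex.re hζ
  rw [Complex.re_sum] at h
  simp only [Complex.mul_re, Finset.sum_sub_distrib, Complex.zero_re] at h
  simp only [← sq] at h
  rw [← sq_eq_sq₀ (norm_nonneg _) (norm_nonneg _), EuclideanSpace.norm_sq_eq,
    EuclideanSpace.norm_sq_eq]
  simp only [reVec, imVec, Real.norm_eq_abs, sq_abs]
  linarith

lemma inner_reVec_imVec (hζ : ∑ j, ζ j * ζ j = 0) : inner ℝ (reVec ζ) (imVec ζ) = 0 := by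
  have h := congrArg Complex.im hζ
  rw [Complex.im_sum] at h
  simp only [Complex.mul_im, Complex.zero_im] at h
  simp only [PiLp.inner_apply, reVec, imVec, RCLike.inner_apply, conj_trivial]
  have : ∑ j, ((ζ j).re * (ζ j).im + (ζ j).im * (ζ j).re) = 2 * ∑ j, (ζ j).im * (ζ j).re := by
    rw [Finset.mul_sum]
    exact Finset.sum_congr rfl fun j _ => by ring
  linarith

lemma norm_eq_sqrt_two_mul (hζ : ∑ j, ζ j * ζ j = 0) : ‖ζ‖ ^ 2 = 2 * ‖reVec ζ‖ ^ 2 := by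
  rw [norm_sq_eq_reVec_add_imVec, ← norm_reVec_eq_norm_imVec hζ]; ring

variable (ζ) in
@[fun_prop]
lemma continuous_freqSymb : Continuous (freqSymb ζ) := by
  unfold freqSymb symb cdot
  fun_prop

lemma exists_orthonormalBasis_apply_eq (i₀ : Fin n) {a : E n} (ha : a ≠ 0) :
    ∃ b : OrthonormalBasis (Fin n) ℝ (E n), b i₀ = (‖a‖⁻¹ : ℝ) • a := by
  have hv : Orthonormal ℝ (({i₀} : Set (Fin n)).domRestrict fun _ => (‖a‖⁻¹ : ℝ) • a) := by
    refine ⟨fun i => ?_, fun i j hij => ?_⟩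
    · change ‖(‖a‖⁻¹ : ℝ) • a‖ = 1
      simp [norm_smul, ha]
    · exact absurd (Subsingleton.elim i j) hij
  obtain ⟨b, hb⟩ := hv.exists_orthonormalBasis_extension_of_card_eq (by simp)
  exact ⟨b, hb i₀ rfl⟩

/-- Completing the square in the real part centres the sphere at `-Im ζ/(2π)`, with radius `|Im
ζ|/(2π) = |Re ζ|/(2π)`. The imaginary part is linear in the `Re ζ` direction, and `Re ζ ⊥ Im ζ`
makes it unaffected by the translation. The second conclusion is needed because `1/0 = 0`:
reciprocals can be compared on the zero set only if both quantities vanish together. -/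
lemma normalForm_le_norm_freqSymb (hζ : ∑ j, ζ j * ζ j = 0) (i₀ : Fin n)
    (b : OrthonormalBasis (Fin n) ℝ (E n)) (hζ0 : reVec ζ ≠ 0)
    (hb : b i₀ = (‖reVec ζ‖⁻¹ : ℝ) • reVec ζ) (ξ : E n) :
    let y := b.repr (ξ + (2 * Real.pi)⁻¹ • imVec ζ)
    normalForm i₀ (‖reVec ζ‖ / (2 * Real.pi)) y ≤ ‖freqSymb ζ ξ‖ ∧
      (normalForm i₀ (‖reVec ζ‖ / (2 * Real.pi)) y = 0 → ‖freqSymb ζ ξ‖ = 0) := by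
  intro y
  have hpi := Real.pi_pos
  have ha := norm_pos_iff.mpr hζ0
  have hsq : ∑ i, y i ^ 2 = ‖ξ + (2 * Real.pi)⁻¹ • imVec ζ‖ ^ 2 := by
    rw [← b.repr.norm_map, EuclideanSpace.norm_sq_eq]
    simp [y]
  have hsq' : 4 * Real.pi ^ 2 * (∑ i, y i ^ 2 - (‖reVec ζ‖ / (2 * Real.pi)) ^ 2) =
      -(freqSymb ζ ξ).re := by
    rw [hsq, freqSymb, symb_re, norm_add_sq_real, norm_smul, norm_smul, inner_smul_right,
      inner_smul_right, real_inner_comm ξ, norm_reVec_eq_norm_imVec hζ, Real.norm_of_nonneg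
      (by positivity), Real.norm_of_nonneg (by positivity)]
    field_simp
    ring
  have hy0 : y i₀ = ‖reVec ζ‖⁻¹ * inner ℝ (reVec ζ) ξ := by
    have : y i₀ = inner ℝ (b i₀) (ξ + (2 * Real.pi)⁻¹ • imVec ζ) := by
      simp only [y, OrthonormalBasis.repr_apply_apply]
    rw [this, hb, inner_add_right, inner_smul_left, inner_smul_left, inner_smul_right,
      inner_reVec_imVec hζ]
    simp
  have him : 4 * Real.pi ^ 2 * (2 * (‖reVec ζ‖ / (2 * Real.pi)) * y i₀) = (freqSymb ζ ξ).im := by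
    rw [hy0, freqSymb, symb_im, inner_smul_right]
    field_simp
    ring
  have hN : 4 * Real.pi ^ 2 * normalForm i₀ (‖reVec ζ‖ / (2 * Real.pi)) y =
      |(freqSymb ζ ξ).re| + |(freqSymb ζ ξ).im| := by
    rw [← him, ← abs_neg (freqSymb ζ ξ).re, ← hsq', normalForm,
      abs_mul (4 * Real.pi ^ 2), abs_mul (4 * Real.pi ^ 2),
      abs_of_nonneg (by positivity : 0 ≤ 4 * Real.pi ^ 2), abs_mul (2 * (‖reVec ζ‖ / _)),
      abs_of_nonneg (by positivity : 0 ≤ 2 * (‖reVec ζ‖ / (2 * Real.pi)))]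
    ring
  have hnf : 0 ≤ normalForm i₀ (‖reVec ζ‖ / (2 * Real.pi)) y := by unfold normalForm; positivity
  constructor
  · have h1 := Complex.abs_re_le_norm (freqSymb ζ ξ)
    have h2 := Complex.abs_im_le_norm (freqSymb ζ ξ)
    have h3 : (1 : ℝ) ≤ Real.pi ^ 2 := by nlinarith [Real.pi_gt_three]
    nlinarith
  · intro h
    rw [h, mul_zero] at hN
    have := Complex.norm_le_abs_re_add_abs_im (freqSymb ζ ξ)
    exact le_antisymm (this.trans hN.symm.le) (norm_nonneg _)

/-- The reciprocal of the symbol, averaged against a Gaussian, is `O(|ζ|⁻¹)`, uniformly in the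
centre of the Gaussian. -/
lemma lintegral_gaussian_mul_inv_freqSymb_le (hζ : ∑ j, ζ j * ζ j = 0) (hζn : 10 ≤ ‖ζ‖)
    (η : E n) :
    ∫⁻ ξ : E n, ENNReal.ofReal (Real.exp (-Real.pi * ‖ξ - η‖ ^ 2)) *
      ENNReal.ofReal (1 / ‖freqSymb ζ ξ‖) ≤
      10 * normalFormConst n * ENNReal.ofReal (1 / ‖ζ‖) := by
  have hpi := Real.pi_pos
  have hpi3 := Real.pi_lt_d2
  have h2 := norm_eq_sqrt_two_mul hζ
  have hpos : 0 < ‖reVec ζ‖ := by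
    by_contra! h
    have := le_antisymm h (norm_nonneg _)
    rw [this] at h2
    nlinarith
  -- Here `|ζ| = √2 |Re ζ|` and `2π√2 < 10`; this is the origin of the threshold `10`, which
  -- guarantees `s ≥ 1`.
  have hbig : ‖ζ‖ ≤ 10 * (‖reVec ζ‖ / (2 * Real.pi)) := by
    have h3 : ‖ζ‖ ≤ 1.4143 * ‖reVec ζ‖ := by
      refine le_of_sq_le_sq ?_ (by positivity)
      nlinarith [sq_nonneg ‖reVec ζ‖]
    rw [mul_div_assoc', le_div_iff₀ (by positivity)]
    nlinarith
  have hs : 1 ≤ ‖reVec ζ‖ / (2 * Real.pi) := by linarith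
  have hne : reVec ζ ≠ 0 := norm_pos_iff.mp hpos
  obtain ⟨i₀⟩ : Nonempty (Fin n) := by
    rcases Nat.eq_zero_or_pos n with rfl | hn
    · exact absurd (Subsingleton.elim _ _) hne
    · exact ⟨⟨0, hn⟩⟩
  obtain ⟨b, hb⟩ := exists_orthonormalBasis_apply_eq i₀ hne
  set s := ‖reVec ζ‖ / (2 * Real.pi) with hsdef
  set w := (2 * Real.pi)⁻¹ • imVec ζ with hw
  have hmeas : Measurable fun y : Fin n → ℝ => gaussPi (b.repr (η + w)) y *
      ENNReal.ofReal (1 / normalForm i₀ s y) := by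
    unfold normalForm; fun_prop
  calc ∫⁻ ξ : E n, ENNReal.ofReal (Real.exp (-Real.pi * ‖ξ - η‖ ^ 2)) *
        ENNReal.ofReal (1 / ‖freqSymb ζ ξ‖)
      ≤ ∫⁻ ξ : E n, gaussPi (b.repr (η + w)) (b.repr (ξ + w)) *
          ENNReal.ofReal (1 / normalForm i₀ s (b.repr (ξ + w))) := by
        refine lintegral_mono fun ξ => ?_
        refine mul_le_mul' (le_of_eq ?_) (ENNReal.ofReal_le_ofReal ?_)
        · rw [gaussPi_ofLp, ← map_sub, b.repr.norm_map, add_sub_add_right_eq_sub]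
        · have h := normalForm_le_norm_freqSymb hζ i₀ b hne hb ξ
          have hnf : 0 ≤ normalForm i₀ s (b.repr (ξ + w)) := by unfold normalForm; positivity
          rcases hnf.lt_or_eq with h0 | h0
          · exact one_div_le_one_div_of_le h0 h.1
          · rw [h.2 h0.symm, ← h0]
    _ = ∫⁻ x : E n, gaussPi (b.repr (η + w)) (b.repr x) *
          ENNReal.ofReal (1 / normalForm i₀ s (b.repr x)) :=
        lintegral_add_right_eq_self (fun x : E n => gaussPi (b.repr (η + w)) (b.repr x) *
          ENNReal.ofReal (1 / normalForm i₀ s (b.repr x))) w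
    _ = ∫⁻ y : E n, gaussPi (b.repr (η + w)) y * ENNReal.ofReal (1 / normalForm i₀ s y) :=
        b.measurePreserving_repr.lintegral_comp
          (f := fun y : E n => gaussPi (b.repr (η + w)) y *
            ENNReal.ofReal (1 / normalForm i₀ s y))
          (hmeas.comp (WithLp.measurable_ofLp 2 _))
    _ ≤ normalFormConst n * ENNReal.ofReal (1 / s) := by
        rw [lintegral_comp_ofLp hmeas]
        exact lintegral_gaussPi_mul_inv_normalForm_le i₀ hs _
    _ ≤ normalFormConst n * ENNReal.ofReal (10 * (1 / ‖ζ‖)) := by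
        gcongr
        rw [mul_one_div, div_le_div_iff₀ (by positivity) (by positivity)]
        linarith
    _ = _ := by
        rw [ENNReal.ofReal_mul (by norm_num), ENNReal.ofReal_ofNat]; ring

lemma norm_cdot_le (x : E n) : ‖cdot ζ x‖ ≤ ‖ζ‖ * ‖x‖ := by
  have h : cdot ζ x = inner ℂ (WithLp.toLp 2 fun j => (x j : ℂ) : EuclideanSpace ℂ (Fin n)) ζ := by
    simp [cdot, PiLp.inner_apply]
  rw [h]
  refine (norm_inner_le_norm _ _).trans (le_of_eq ?_)
  rw [mul_comm]
  congr 1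
  simp [EuclideanSpace.norm_eq]

lemma norm_freqSymb_ge (ξ : E n) :
    ‖(2 * Real.pi) • ξ‖ ^ 2 - 2 * ‖ζ‖ * ‖(2 * Real.pi) • ξ‖ ≤ ‖freqSymb ζ ξ‖ := by
  set x := (2 * Real.pi) • ξ with hx
  have h := norm_sub_norm_le (((‖x‖ ^ 2 : ℝ) : ℂ)) (2 * Complex.I * cdot ζ x)
  have h2 : ‖2 * Complex.I * cdot ζ x‖ ≤ 2 * ‖ζ‖ * ‖x‖ := by
    rw [norm_mul, norm_mul, Complex.norm_I, mul_one, Complex.norm_ofNat, mul_assoc]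
    gcongr
    exact norm_cdot_le x
  have h3 : ‖((‖x‖ ^ 2 : ℝ) : ℂ) - 2 * Complex.I * cdot ζ x‖ = ‖freqSymb ζ ξ‖ := by
    rw [freqSymb, symb, ← norm_neg, ← hx]
    congr 1; ring
  rw [h3, Complex.norm_real, Real.norm_of_nonneg (by positivity)] at h
  linarith

lemma norm_freqSymb_le (ξ : E n) :
    ‖freqSymb ζ ξ‖ ≤ ‖(2 * Real.pi) • ξ‖ ^ 2 + 2 * ‖ζ‖ * ‖(2 * Real.pi) • ξ‖ := by
  set x := (2 * Real.pi) • ξ with hx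
  rw [freqSymb, symb, ← hx]
  refine (norm_add_le _ _).trans ?_
  rw [norm_neg, Complex.norm_real, Real.norm_of_nonneg (by positivity)]
  rw [norm_mul, norm_mul, Complex.norm_I, mul_one, Complex.norm_ofNat, mul_assoc]
  gcongr
  exact norm_cdot_le x

/-- For frequencies `|x| ≤ 4|ζ|` the numerator is at most `16|ζ|²`; beyond that, `|x|²` dominates
the linear term and the symbol is elliptic, with `|p_ζ| ≥ |x|²/2`. On the zero set both reciprocals
are `0`. -/
lemma sq_div_norm_freqSymb_le (ξ : E n) :
    ‖(2 * Real.pi) • ξ‖ ^ 2 * (1 / ‖freqSymb ζ ξ‖) ≤ 16 * ‖ζ‖ ^ 2 * (1 / ‖freqSymb ζ ξ‖) + 2 := by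
  have h := norm_freqSymb_ge (ζ := ζ) ξ
  set x := ‖(2 * Real.pi) • ξ‖
  have hx : 0 ≤ x := norm_nonneg _
  have hz := norm_nonneg ζ
  set p := ‖freqSymb ζ ξ‖
  have hp : 0 ≤ p := norm_nonneg _
  rcases hp.lt_or_eq with hp0 | hp0
  · rcases le_total x (4 * ‖ζ‖) with h1 | h1
    · have : x ^ 2 * (1 / p) ≤ 16 * ‖ζ‖ ^ 2 * (1 / p) := by
        gcongr
        nlinarith
      linarith
    · have : x ^ 2 * (1 / p) ≤ 2 := by
        rw [mul_one_div, div_le_iff₀ hp0]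
        nlinarith
      have : 0 ≤ 16 * ‖ζ‖ ^ 2 * (1 / p) := by positivity
      linarith
  · rw [← hp0]; norm_num

/-- The constant `K` with `∫ e^{-π|ξ-η|²} / |p_ζ| ≤ K / |ζ|`. -/
def symbConst (n : ℕ) : ℝ := 200 * (normalFormConst n).toReal + 2

lemma symbConst_pos (n : ℕ) : 0 < symbConst n := by
  unfold symbConst; positivity

lemma lintegral_gaussian_mul_inv_freqSymb_le' (hζ : ∑ j, ζ j * ζ j = 0) (hζn : 10 ≤ ‖ζ‖)
    (η : E n) :
    ∫⁻ ξ : E n, ENNReal.ofReal (Real.exp (-Real.pi * ‖ξ - η‖ ^ 2)) *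
      ENNReal.ofReal (1 / ‖freqSymb ζ ξ‖) ≤ ENNReal.ofReal (symbConst n / ‖ζ‖) := by
  refine (lintegral_gaussian_mul_inv_freqSymb_le hζ hζn η).trans ?_
  rw [← ENNReal.ofReal_toReal (normalFormConst_lt_top n).ne, show (10 : ℝ≥0∞) =
    ENNReal.ofReal 10 by simp, ← ENNReal.ofReal_mul (by norm_num),
    ← ENNReal.ofReal_mul (by positivity), mul_one_div]
  apply ENNReal.ofReal_le_ofReal
  gcongr
  unfold symbConst
  linarith [ENNReal.toReal_nonneg (a := normalFormConst n)]

lemma lintegral_gaussian_mul_sq_div_freqSymb_le (hζ : ∑ j, ζ j * ζ j = 0) (hζn : 10 ≤ ‖ζ‖)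
    (η : E n) :
    ∫⁻ ξ : E n, ENNReal.ofReal (Real.exp (-Real.pi * ‖ξ - η‖ ^ 2)) *
      ENNReal.ofReal (‖(2 * Real.pi) • ξ‖ ^ 2 * (1 / ‖freqSymb ζ ξ‖)) ≤
      ENNReal.ofReal (symbConst n * ‖ζ‖) := by
  have hm : Measurable fun ξ : E n => ENNReal.ofReal (Real.exp (-Real.pi * ‖ξ - η‖ ^ 2)) := by
    fun_prop
  have hm2 : Measurable fun ξ : E n => ENNReal.ofReal (1 / ‖freqSymb ζ ξ‖) := by
    have := (continuous_freqSymb ζ).measurable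
    fun_prop
  calc _ ≤ ∫⁻ ξ : E n, (ENNReal.ofReal (16 * ‖ζ‖ ^ 2) *
        (ENNReal.ofReal (Real.exp (-Real.pi * ‖ξ - η‖ ^ 2)) *
          ENNReal.ofReal (1 / ‖freqSymb ζ ξ‖)) +
          ENNReal.ofReal 2 * ENNReal.ofReal (Real.exp (-Real.pi * ‖ξ - η‖ ^ 2))) := by
        refine lintegral_mono fun ξ => ?_
        refine (mul_le_mul_right (ENNReal.ofReal_le_ofReal (sq_div_norm_freqSymb_le ξ)) _).trans
          (le_of_eq ?_)
        rw [ENNReal.ofReal_add (by positivity) (by norm_num), ENNReal.ofReal_mul (by positivity)]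
        ring
    _ ≤ ENNReal.ofReal (16 * ‖ζ‖ ^ 2) *
        (10 * normalFormConst n * ENNReal.ofReal (1 / ‖ζ‖)) + ENNReal.ofReal 2 := by
        rw [lintegral_add_left (by fun_prop), lintegral_const_mul _ (by fun_prop),
          lintegral_const_mul _ (by fun_prop), lintegral_gaussian, mul_one]
        gcongr
        exact lintegral_gaussian_mul_inv_freqSymb_le hζ hζn η
    _ ≤ _ := by
        rw [← ENNReal.ofReal_toReal (normalFormConst_lt_top n).ne, show (10 : ℝ≥0∞) =
          ENNReal.ofReal 10 by simp, ← ENNReal.ofReal_mul (by norm_num),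
          ← ENNReal.ofReal_mul (by positivity), ← ENNReal.ofReal_mul (by positivity),
          ← ENNReal.ofReal_add (by positivity) (by norm_num)]
        apply ENNReal.ofReal_le_ofReal
        have hz : ‖ζ‖ ≠ 0 := by positivity
        have e : 16 * ‖ζ‖ ^ 2 * (10 * (normalFormConst n).toReal * (1 / ‖ζ‖)) =
          160 * (normalFormConst n).toReal * ‖ζ‖ := by field_simp; ring
        rw [e, symbConst]
        nlinarith [mul_nonneg (ENNReal.toReal_nonneg (a := normalFormConst n)) (norm_nonneg ζ)]

/-- The imaginary part already confines the zeros to the hyperplane orthogonal to `Re ζ`. -/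
lemma ae_freqSymb_ne_zero (hζ0 : reVec ζ ≠ 0) : ∀ᵐ ξ : E n, freqSymb ζ ξ ≠ 0 := by
  have h0 : volume ((LinearMap.ker (innerₛₗ ℝ (reVec ζ)) : Submodule ℝ (E n)) : Set (E n)) = 0 := by
    refine Measure.addHaar_submodule _ _ fun h => hζ0 ?_
    have : reVec ζ ∈ LinearMap.ker (innerₛₗ ℝ (reVec ζ)) := by rw [h]; trivial
    simpa using this
  refine measure_mono_null (fun ξ hξ => ?_) h0
  have h1 : freqSymb ζ ξ = 0 := by simpa using hξ
  have h2 := congrArg Complex.im h1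
  rw [freqSymb, symb_im, inner_smul_right] at h2
  simpa [Real.pi_ne_zero] using h2

end Symbol

/-! ### Multiplication operators and the Fourier transform on `L²` -/

section GaussianLocalization

/-- The Hilbert space `L²(ℝⁿ; ℂ)`. -/
abbrev L2 (n : ℕ) : Type := Lp ℂ 2 (volume : Measure (E n))

variable {n : ℕ}

lemma eLpNorm_two_sq {α : Type*} [MeasurableSpace α] {μ : Measure α} (f : α → ℂ) :
    eLpNorm f 2 μ ^ 2 = ∫⁻ x, ‖f x‖ₑ ^ 2 ∂μ := by
  have := eLpNorm_nnreal_pow_eq_lintegral (μ := μ) (f := f) (p := 2) (by norm_num)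
  simpa using this

/-- Multiplication by a bounded function, as an operator on `L²`. -/
def mulL2 {m : E n → ℂ} (hm : MemLp m ∞ volume) : L2 n →L[ℂ] L2 n :=
  (ContinuousLinearMap.mul ℂ ℂ).holderL volume ∞ 2 2 (hm.toLp m)

lemma coeFn_mulL2 {m : E n → ℂ} (hm : MemLp m ∞ volume) (f : L2 n) :
    mulL2 hm f =ᵐ[volume] fun x => m x * f x := by
  filter_upwards [(ContinuousLinearMap.mul ℂ ℂ).coeFn_holder (r := 2) (hm.toLp m) f,
    hm.coeFn_toLp] with x h1 h2
  rw [← h2]; exact h1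

lemma inner_L2 (f g : L2 n) : inner ℂ f g = ∫ x, (starRingEnd ℂ) (f x) * g x := by
  rw [L2.inner_def]
  simp [RCLike.inner_apply, mul_comm]

/-- The `L²` transform and the integral transform define the same distribution: both move onto the
test function by the self-adjointness of the Fourier integral. -/
lemma coeFn_fourier_eq {F : E n → ℂ} (h1 : Integrable F) (h2 : MemLp F 2 volume) :
    (𝓕 (h2.toLp F) : L2 n) =ᵐ[volume] 𝓕 F := by
  have hc : Continuous (𝓕 F) :=
    VectorFourier.fourierIntegral_continuous Real.continuous_fourierChar
      (by exact continuous_inner) h1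
  refine ae_eq_of_integral_contDiff_smul_eq
    ((Lp.memLp (𝓕 (h2.toLp F) : L2 n)).locallyIntegrable (by norm_num))
    hc.locallyIntegrable fun g hg hgc => ?_
  have hg1 : HasCompactSupport (Complex.ofRealCLM ∘ g) := hgc.comp_left rfl
  have hg2 : ContDiff ℝ ((⊤ : ℕ∞) : WithTop ℕ∞) (Complex.ofRealCLM ∘ g) := by fun_prop
  set gS : 𝓢(E n, ℂ) := hg1.toSchwartzMap hg2 with hgS
  have hgx : ∀ x, gS x = (g x : ℂ) := fun x => rfl
  have key := congrArg (fun T : 𝓢'(E n, ℂ) => T gS)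
    (Lp.fourier_toTemperedDistribution_eq (h2.toLp F))
  simp only [TemperedDistribution.fourier_apply, Lp.toTemperedDistribution_apply] at key
  have flip := VectorFourier.integral_fourierIntegral_smul_eq_flip
    (μ := volume) (ν := volume) (L := innerₗ (E n)) (f := (gS : E n → ℂ)) (g := F)
    Real.continuous_fourierChar (by exact continuous_inner) gS.integrable h1
  rw [flip_innerₗ] at flip
  calc ∫ x, g x • (𝓕 (h2.toLp F) : L2 n) x = ∫ x, gS x • (𝓕 (h2.toLp F) : L2 n) x := by
        simp [hgx]
    _ = ∫ x, (𝓕 gS) x • (h2.toLp F) x := key.symm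
    _ = ∫ x, (𝓕 (gS : E n → ℂ)) x • F x := by
        refine integral_congr_ae ?_
        filter_upwards [h2.coeFn_toLp] with x hx
        rw [hx, SchwartzMap.fourier_coe]
    _ = ∫ x, g x • 𝓕 F x := by
        refine flip.trans ?_
        simp only [hgx]
        rfl

/-! ### The Gaussian -/

/-- The Gaussian `exp (-π |x|²)`. -/
def gaussian (x : E n) : ℂ := ((Real.exp (-Real.pi * ‖x‖ ^ 2) : ℝ) : ℂ)

@[fun_prop]
lemma continuous_gaussian : Continuous (gaussian (n := n)) := by
  unfold gaussian; fun_prop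

lemma norm_gaussian (x : E n) : ‖gaussian x‖ = Real.exp (-Real.pi * ‖x‖ ^ 2) := by
  rw [gaussian, Complex.norm_real, Real.norm_of_nonneg (Real.exp_pos _).le]

lemma gaussian_ne_zero (x : E n) : gaussian x ≠ 0 := by
  rw [← norm_ne_zero_iff, norm_gaussian]; positivity

lemma conj_gaussian (x : E n) : (starRingEnd ℂ) (gaussian x) = gaussian x := Complex.conj_ofReal _

lemma memLp_gaussian_top : MemLp (gaussian (n := n)) ∞ volume := by
  refine memLp_top_of_bound continuous_gaussian.aestronglyMeasurable 1
    (Filter.Eventually.of_forall fun x => ?_)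
  rw [norm_gaussian, Real.exp_le_one_iff]
  nlinarith [mul_nonneg Real.pi_pos.le (sq_nonneg ‖x‖)]

/-- The modulated Gaussian `exp (-π |x|² + 2 π i ξ·x)`. -/
def gaussianWave (ξ x : E n) : ℂ :=
  Complex.exp (-Real.pi * ‖x‖ ^ 2 + 2 * Real.pi * Complex.I * (inner ℝ ξ x : ℝ))

lemma norm_gaussianWave (ξ x : E n) : ‖gaussianWave ξ x‖ = Real.exp (-Real.pi * ‖x‖ ^ 2) := by
  rw [gaussianWave, Complex.norm_exp]
  congr 1
  simp [← Complex.ofReal_pow]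

lemma continuous_gaussianWave (ξ : E n) : Continuous (gaussianWave ξ) := by
  unfold gaussianWave; fun_prop

lemma lintegral_enorm_gaussianWave (ξ : E n) : ∫⁻ x, ‖gaussianWave ξ x‖ₑ = 1 := by
  rw [← lintegral_gaussian (0 : E n)]
  refine lintegral_congr fun x => ?_
  rw [← ofReal_norm, norm_gaussianWave, sub_zero]

lemma integrable_gaussianWave (ξ : E n) : Integrable (gaussianWave ξ) :=
  ⟨(continuous_gaussianWave ξ).aestronglyMeasurable, by
    rw [HasFiniteIntegral, lintegral_enorm_gaussianWave]; exact ENNReal.one_lt_top⟩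

lemma memLp_gaussianWave (ξ : E n) : MemLp (gaussianWave ξ) 2 volume := by
  refine ⟨(continuous_gaussianWave ξ).aestronglyMeasurable, ?_⟩
  have h : eLpNorm (gaussianWave ξ) 2 volume ^ 2 < ∞ := by
    rw [eLpNorm_two_sq]
    refine lt_of_le_of_lt (lintegral_mono fun x => ?_)
      ((lintegral_enorm_gaussianWave ξ).trans_lt ENNReal.one_lt_top)
    have : ‖gaussianWave ξ x‖ₑ ≤ 1 := by
      rw [← ofReal_norm, norm_gaussianWave, ENNReal.ofReal_le_one, Real.exp_le_one_iff]
      nlinarith [mul_nonneg Real.pi_pos.le (sq_nonneg ‖x‖)]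
    rw [sq]
    exact mul_le_of_le_one_left' this
  by_contra hc
  rw [not_lt, top_le_iff] at hc
  simp [hc] at h

lemma fourier_gaussianWave (ξ η : E n) :
    𝓕 (gaussianWave ξ) η = ((Real.exp (-Real.pi * ‖ξ - η‖ ^ 2) : ℝ) : ℂ) := by
  have h := fourier_gaussian_innerProductSpace' (V := E n) (b := (Real.pi : ℂ))
    (by simpa using Real.pi_pos) ξ η
  have hpi : (Real.pi : ℂ) ≠ 0 := by exact_mod_cast Real.pi_ne_zero
  unfold gaussianWave
  rw [h, div_self hpi, Complex.one_cpow, one_mul]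
  push_cast
  congr 1
  field_simp

/-- The function `f ↦ e^{-π|x|²} f` on `L²`. -/
abbrev mulGauss : L2 n →L[ℂ] L2 n := mulL2 memLp_gaussian_top

lemma memLp_gaussian_two : MemLp (gaussian (n := n)) 2 volume := by
  refine (memLp_congr_norm continuous_gaussian.aestronglyMeasurable
    (continuous_gaussianWave 0).aestronglyMeasurable
    (Filter.Eventually.of_forall fun x => ?_)).mpr (memLp_gaussianWave 0)
  rw [norm_gaussian, norm_gaussianWave]

/-- The Fourier transform of `e^{-π|x|²} f` is the convolution of `𝓕 f` with a Gaussian. -/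
lemma fourier_mulGauss (f : L2 n) :
    (𝓕 (mulGauss f) : L2 n) =ᵐ[volume]
      fun ξ => ∫ η, ((Real.exp (-Real.pi * ‖ξ - η‖ ^ 2) : ℝ) : ℂ) * (𝓕 f : L2 n) η := by
  have h2 : MemLp (fun x => gaussian x * f x) 2 volume :=
    (memLp_congr_ae (coeFn_mulL2 memLp_gaussian_top f)).mp (Lp.memLp _)
  have h1 : Integrable (fun x => gaussian x * f x) :=
    memLp_gaussian_two.integrable_mul (Lp.memLp f)
  have heq : mulGauss f = h2.toLp _ := by
    refine Lp.ext ?_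
    exact (coeFn_mulL2 memLp_gaussian_top f).trans h2.coeFn_toLp.symm
  rw [heq]
  refine (coeFn_fourier_eq h1 h2).trans (Filter.Eventually.of_forall fun ξ => ?_)
  -- The transform of `e^{-π|x|²} f` at `ξ` is the inner product of `f` with a modulated Gaussian;
  -- Plancherel moves it to frequency, where the wave is a Gaussian centred at `ξ`. No convolution
  -- theorem on `L²` is required.
  have hw := coeFn_fourier_eq (integrable_gaussianWave ξ) (memLp_gaussianWave ξ)
  calc 𝓕 (fun x => gaussian x * f x) ξ
      = ∫ x, (starRingEnd ℂ) (gaussianWave ξ x) * f x := by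
        rw [Real.fourier_eq']
        refine integral_congr_ae (Filter.Eventually.of_forall fun x => ?_)
        simp only [smul_eq_mul]
        rw [← mul_assoc]
        congr 1
        rw [gaussian, gaussianWave, ← Complex.exp_conj, Complex.ofReal_exp, ← Complex.exp_add]
        congr 1
        simp only [map_add, map_mul, map_neg, map_pow, Complex.conj_ofReal, Complex.conj_I,
          map_ofNat, real_inner_comm x ξ]
        push_cast
        ring
    _ = inner ℂ ((memLp_gaussianWave ξ).toLp _) f := by
        rw [inner_L2]
        refine integral_congr_ae ?_
        filter_upwards [(memLp_gaussianWave ξ).coeFn_toLp] with x hx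
        rw [hx]
    _ = inner ℂ (𝓕 ((memLp_gaussianWave ξ).toLp _) : L2 n) (𝓕 f : L2 n) :=
        (Lp.inner_fourier_eq _ _).symm
    _ = _ := by
        rw [inner_L2]
        refine integral_congr_ae ?_
        filter_upwards [hw] with x hx
        rw [hx, fourier_gaussianWave, Complex.conj_ofReal]

/-! ### Multipliers with bounded Gaussian averages -/

/-- Jensen's inequality for the Gaussian measure centred at `ξ`. -/
lemma sq_lintegral_gaussian_mul_le (ξ : E n) {f : E n → ℝ≥0∞} (hf : AEMeasurable f) :
    (∫⁻ η, ENNReal.ofReal (Real.exp (-Real.pi * ‖ξ - η‖ ^ 2)) * f η) ^ 2 ≤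
      ∫⁻ η, ENNReal.ofReal (Real.exp (-Real.pi * ‖ξ - η‖ ^ 2)) * f η ^ 2 := by
  -- Square root of the Gaussian density: Jensen is Cauchy–Schwarz applied to `r · (r f)`, with `∫
  -- r² = 1`.
  set r : E n → ℝ≥0∞ := fun η => ENNReal.ofReal (Real.exp (-(Real.pi / 2) * ‖ξ - η‖ ^ 2)) with hr
  have hrm : Measurable r := by rw [hr]; fun_prop
  have hrr : ∀ η, ENNReal.ofReal (Real.exp (-Real.pi * ‖ξ - η‖ ^ 2)) = r η * r η := by
    intro η
    rw [hr, ← ENNReal.ofReal_mul (Real.exp_pos _).le, ← Real.exp_add]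
    congr 2; ring
  have h1 : ∫⁻ η, r η ^ (2 : ℝ) = 1 := by
    rw [← lintegral_gaussian ξ]
    refine lintegral_congr fun η => ?_
    rw [norm_sub_rev, hrr, ENNReal.rpow_two, sq]
  have h := ENNReal.lintegral_mul_le_Lp_mul_Lq volume Real.HolderConjugate.two_two
    hrm.aemeasurable (hrm.aemeasurable.mul hf)
  rw [h1, ENNReal.one_rpow, one_mul] at h
  calc _ = (∫⁻ η, (r * (r * f)) η) ^ 2 := by
        congr 1
        refine lintegral_congr fun η => ?_
        rw [hrr]; simp [mul_assoc]
    _ ≤ ((∫⁻ η, (r * f) η ^ (2 : ℝ)) ^ (1 / 2 : ℝ)) ^ 2 := by gcongr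
    _ = _ := by
        rw [← ENNReal.rpow_natCast, ← ENNReal.rpow_mul]
        norm_num only [one_div]
        rw [ENNReal.rpow_one]
        refine lintegral_congr fun η => ?_
        rw [hrr, Pi.mul_apply, ENNReal.rpow_two, mul_pow, sq (r η)]

/-- The function `m` satisfies `∫ e^{-π|ξ-η|²} |m(ξ)|² dξ ≤ K²` for every `η`. -/
structure GaussBounded (m : E n → ℂ) (K : ℝ) : Prop where
  measurable : Measurable m
  nonneg : 0 ≤ K
  bound : ∀ η : E n, ∫⁻ ξ : E n, ENNReal.ofReal (Real.exp (-Real.pi * ‖ξ - η‖ ^ 2)) *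
    ‖m ξ‖ₑ ^ 2 ≤ ENNReal.ofReal (K ^ 2)

/-- Jensen bounds the square of the convolution by the Gaussian average of `|𝓕 f|²`. Tonelli then
places the other Gaussian average on `|m|²`, where the defining bound applies uniformly, and
Plancherel finishes. -/
lemma GaussBounded.eLpNorm_le {m : E n → ℂ} {K : ℝ} (h : GaussBounded m K) (f : L2 n) :
    eLpNorm (fun ξ => m ξ * (𝓕 (mulGauss f) : L2 n) ξ) 2 volume ≤ ENNReal.ofReal K * ‖f‖ₑ := by
  have hfm : AEMeasurable (fun η => ‖(𝓕 f : L2 n) η‖ₑ) :=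
    (Lp.aestronglyMeasurable (𝓕 f : L2 n)).enorm
  have hpt : ∀ᵐ ξ, ‖m ξ * (𝓕 (mulGauss f) : L2 n) ξ‖ₑ ^ 2 ≤
      ∫⁻ η, (ENNReal.ofReal (Real.exp (-Real.pi * ‖ξ - η‖ ^ 2)) * ‖m ξ‖ₑ ^ 2) *
        ‖(𝓕 f : L2 n) η‖ₑ ^ 2 := by
    filter_upwards [fourier_mulGauss f] with ξ hξ
    rw [enorm_mul, mul_pow, hξ]
    calc ‖m ξ‖ₑ ^ 2 * ‖∫ η, ((Real.exp (-Real.pi * ‖ξ - η‖ ^ 2) : ℝ) : ℂ) *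
          (𝓕 f : L2 n) η‖ₑ ^ 2
        ≤ ‖m ξ‖ₑ ^ 2 * (∫⁻ η, ENNReal.ofReal (Real.exp (-Real.pi * ‖ξ - η‖ ^ 2)) *
          ‖(𝓕 f : L2 n) η‖ₑ) ^ 2 := by
          gcongr
          refine (enorm_integral_le_lintegral_enorm _).trans
            (lintegral_mono fun η => le_of_eq ?_)
          rw [enorm_mul, ← ofReal_norm (((Real.exp _ : ℝ) : ℂ)), Complex.norm_real,
            Real.norm_of_nonneg (Real.exp_pos _).le]
      _ ≤ ‖m ξ‖ₑ ^ 2 * ∫⁻ η, ENNReal.ofReal (Real.exp (-Real.pi * ‖ξ - η‖ ^ 2)) *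
          ‖(𝓕 f : L2 n) η‖ₑ ^ 2 := by
          gcongr; exact sq_lintegral_gaussian_mul_le ξ hfm
      _ = _ := by
          rw [← lintegral_const_mul'' _ (by fun_prop)]
          refine lintegral_congr fun η => ?_
          ring
  have hsq : eLpNorm (fun ξ => m ξ * (𝓕 (mulGauss f) : L2 n) ξ) 2 volume ^ 2 ≤
      (ENNReal.ofReal K * ‖f‖ₑ) ^ 2 := by
    have hm := h.measurable
    rw [eLpNorm_two_sq]
    calc _ ≤ ∫⁻ ξ, ∫⁻ η, (ENNReal.ofReal (Real.exp (-Real.pi * ‖ξ - η‖ ^ 2)) * ‖m ξ‖ₑ ^ 2) *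
          ‖(𝓕 f : L2 n) η‖ₑ ^ 2 := lintegral_mono_ae hpt
      _ = ∫⁻ η, ∫⁻ ξ, (ENNReal.ofReal (Real.exp (-Real.pi * ‖ξ - η‖ ^ 2)) * ‖m ξ‖ₑ ^ 2) *
          ‖(𝓕 f : L2 n) η‖ₑ ^ 2 := by
          refine lintegral_lintegral_swap ?_
          have hA : Measurable fun p : E n × E n =>
              ENNReal.ofReal (Real.exp (-Real.pi * ‖p.1 - p.2‖ ^ 2)) * ‖m p.1‖ₑ ^ 2 := by
            fun_prop
          exact hA.aemeasurable.mul (hfm.comp_snd.pow_const 2)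
      _ ≤ ∫⁻ η, ENNReal.ofReal (K ^ 2) * ‖(𝓕 f : L2 n) η‖ₑ ^ 2 := by
          refine lintegral_mono fun η => ?_
          rw [lintegral_mul_const _ (by fun_prop)]
          gcongr
          exact h.bound η
      _ = ENNReal.ofReal (K ^ 2) * ‖f‖ₑ ^ 2 := by
          rw [lintegral_const_mul'' _ (hfm.pow_const 2), ← eLpNorm_two_sq,
            ← Lp.enorm_def, ← ofReal_norm, Lp.norm_fourier_eq, ofReal_norm]
      _ = _ := by rw [mul_pow, ENNReal.ofReal_pow h.nonneg]
  exact (ENNReal.pow_le_pow_left_iff (by norm_num)).mp hsq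

lemma GaussBounded.memLp {m : E n → ℂ} {K : ℝ} (h : GaussBounded m K) (f : L2 n) :
    MemLp (fun ξ => m ξ * (𝓕 (mulGauss f) : L2 n) ξ) 2 volume :=
  ⟨h.measurable.aestronglyMeasurable.mul (Lp.aestronglyMeasurable _),
    (h.eLpNorm_le f).trans_lt (ENNReal.mul_lt_top ENNReal.ofReal_lt_top enorm_lt_top)⟩

/-- The operator `f ↦ m · 𝓕 (e^{-π|x|²} f)` on `L²`. -/
def gaussOp {m : E n → ℂ} {K : ℝ} (h : GaussBounded m K) : L2 n →L[ℂ] L2 n :=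
  LinearMap.mkContinuous
    { toFun f := (h.memLp f).toLp _
      map_add' f g := by
        refine Lp.ext ?_
        filter_upwards [(h.memLp (f + g)).coeFn_toLp, (h.memLp f).coeFn_toLp,
          (h.memLp g).coeFn_toLp, Lp.coeFn_add ((h.memLp f).toLp _) ((h.memLp g).toLp _),
          Lp.coeFn_add (𝓕 (mulGauss f) : L2 n) (𝓕 (mulGauss g))] with x h1 h2 h3 h4 h5
        rw [h1, h4, map_add, FourierTransform.fourier_add, Pi.add_apply, h2, h3, h5, Pi.add_apply, mul_add]
      map_smul' c f := by
        refine Lp.ext ?_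
        filter_upwards [(h.memLp (c • f)).coeFn_toLp, (h.memLp f).coeFn_toLp,
          Lp.coeFn_smul c ((h.memLp f).toLp _),
          Lp.coeFn_smul c (𝓕 (mulGauss f) : L2 n)] with x h1 h2 h3 h4
        simp only [RingHom.id_apply]
        rw [h1, h3, map_smul, FourierTransform.fourier_smul, Pi.smul_apply, h2, h4, Pi.smul_apply, smul_eq_mul, smul_eq_mul]
        ring } K fun f => by
    change ‖(h.memLp f).toLp _‖ ≤ K * ‖f‖
    rw [Lp.norm_toLp]
    refine ENNReal.toReal_le_of_le_ofReal (mul_nonneg h.nonneg (norm_nonneg f)) ?_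
    rw [ENNReal.ofReal_mul h.nonneg, ofReal_norm]
    exact h.eLpNorm_le f

lemma coeFn_gaussOp {m : E n → ℂ} {K : ℝ} (h : GaussBounded m K) (f : L2 n) :
    gaussOp h f =ᵐ[volume] fun ξ => m ξ * (𝓕 (mulGauss f) : L2 n) ξ :=
  (h.memLp f).coeFn_toLp

lemma norm_gaussOp_le {m : E n → ℂ} {K : ℝ} (h : GaussBounded m K) : ‖gaussOp h‖ ≤ K :=
  LinearMap.mkContinuous_norm_le _ h.nonneg _

end GaussianLocalization

/-! ### Compactly supported Schwartz functions are dense -/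

section Density

variable {n : ℕ}

/-- A smooth cutoff function: one on the unit ball, supported in the ball of radius two. -/
def cutoff : 𝓢(E n, ℂ) :=
  HasCompactSupport.toSchwartzMap (E := E n)
    (f := fun x => (((⟨1, 2, one_pos, one_lt_two⟩ : ContDiffBump (0 : E n)) x : ℝ) : ℂ))
    ((ContDiffBump.hasCompactSupport _).comp_left (g := fun t : ℝ => (t : ℂ)) rfl)
    (Complex.ofRealCLM.contDiff.comp (ContDiffBump.contDiff _))

lemma hasCompactSupport_cutoff : HasCompactSupport (cutoff (n := n)) :=
  (ContDiffBump.hasCompactSupport _).comp_left (g := fun t : ℝ => (t : ℂ)) rfl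

lemma cutoff_eq_one {x : E n} (hx : ‖x‖ ≤ 1) : cutoff x = 1 := by
  have : (⟨1, 2, one_pos, one_lt_two⟩ : ContDiffBump (0 : E n)) x = 1 :=
    ContDiffBump.one_of_mem_closedBall _ (by simpa using hx)
  change (((⟨1, 2, one_pos, one_lt_two⟩ : ContDiffBump (0 : E n)) x : ℝ) : ℂ) = 1
  rw [this, Complex.ofReal_one]

/-- The truncation `χ(x / r) φ(x)` of a Schwartz function. -/
def truncate (φ : 𝓢(E n, ℂ)) (r : ℝ) : 𝓢(E n, ℂ) :=
  SchwartzMap.smulLeftCLM ℂ (fun x => cutoff (r⁻¹ • x)) φ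

lemma hasTemperateGrowth_cutoff_comp (r : ℝ) :
    (fun x : E n => cutoff (r⁻¹ • x)).HasTemperateGrowth :=
  (cutoff (n := n)).hasTemperateGrowth.comp
    (r⁻¹ • ContinuousLinearMap.id ℝ (E n)).hasTemperateGrowth

lemma truncate_apply (φ : 𝓢(E n, ℂ)) (r : ℝ) (x : E n) :
    truncate φ r x = cutoff (r⁻¹ • x) * φ x := by
  rw [truncate, SchwartzMap.smulLeftCLM_apply_apply (hasTemperateGrowth_cutoff_comp r),
    smul_eq_mul]

lemma hasCompactSupport_truncate (φ : 𝓢(E n, ℂ)) {r : ℝ} (hr : 0 < r) :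
    HasCompactSupport (truncate φ r) := by
  have : (truncate φ r : E n → ℂ) = fun x => cutoff (r⁻¹ • x) * φ x :=
    funext (truncate_apply φ r)
  rw [this]
  refine HasCompactSupport.mul_right ?_
  exact hasCompactSupport_cutoff.comp_smul (inv_ne_zero hr.ne')

lemma norm_iteratedFDeriv_cutoff_comp_le {r : ℝ} (hr : 1 ≤ r) (i : ℕ) (x : E n) :
    ‖iteratedFDeriv ℝ i (fun x : E n => cutoff (r⁻¹ • x)) x‖ ≤
      SchwartzMap.seminorm ℝ 0 i (cutoff (n := n)) := by
  set L : E n →L[ℝ] E n := r⁻¹ • ContinuousLinearMap.id ℝ (E n) with hL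
  have hLn : ‖L‖ ≤ 1 := by
    rw [hL, norm_smul, norm_inv, Real.norm_of_nonneg (by linarith)]
    exact mul_le_one₀ (inv_le_one_of_one_le₀ hr) (norm_nonneg _) ContinuousLinearMap.norm_id_le
  have hf : (fun x : E n => cutoff (r⁻¹ • x)) = cutoff ∘ L := rfl
  rw [hf, L.iteratedFDeriv_comp_right (cutoff.smooth i) x le_rfl]
  refine (ContinuousMultilinearMap.norm_compContinuousLinearMap_le _ _).trans ?_
  refine (mul_le_of_le_one_right (norm_nonneg _) ?_).trans
    (SchwartzMap.norm_iteratedFDeriv_le_seminorm ℝ cutoff i _)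
  exact Finset.prod_le_one (fun _ _ => norm_nonneg _) fun _ _ => hLn

/-- The difference vanishes for `|x| < r`, so elsewhere `1 ≤ |x|/r` buys a factor `1/r` at the price
of one more power of `|x|`. Derivatives of the rescaled cutoff are bounded uniformly in `r ≥ 1`. -/
lemma seminorm_truncate_sub_le (φ : 𝓢(E n, ℂ)) (k m : ℕ) :
    ∃ C : ℝ, 0 ≤ C ∧ ∀ r : ℝ, 1 ≤ r →
      SchwartzMap.seminorm ℝ k m (truncate φ r - φ) ≤ C * r⁻¹ := by
  refine ⟨∑ i ∈ Finset.range (m + 1), (m.choose i : ℝ) *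
    SchwartzMap.seminorm ℝ 0 i (cutoff (n := n)) * SchwartzMap.seminorm ℝ (k + 1) (m - i) φ +
      SchwartzMap.seminorm ℝ (k + 1) m φ, by positivity, fun r hr => ?_⟩
  have hr0 : 0 < r := by linarith
  refine SchwartzMap.seminorm_le_bound ℝ k m _ (by positivity) fun x => ?_
  have hcoe : ((truncate φ r - φ : 𝓢(E n, ℂ)) : E n → ℂ) =
      (fun x => cutoff (r⁻¹ • x) * φ x) - φ := by
    ext y; simp [truncate_apply]
  have hcs : ContDiff ℝ m (fun x : E n => cutoff (r⁻¹ • x)) :=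
    (cutoff.smooth m).comp (contDiff_const_smul _)
  rcases lt_or_ge ‖x‖ r with hx | hx
  · have h0 : ((truncate φ r - φ : 𝓢(E n, ℂ)) : E n → ℂ) =ᶠ[nhds x] fun _ => 0 := by
      have : ∀ᶠ y in nhds x, ‖y‖ < r := continuous_norm.continuousAt.eventually_lt_const hx
      filter_upwards [this] with y hy
      rw [hcoe, Pi.sub_apply, cutoff_eq_one, one_mul, sub_self]
      rw [norm_smul, norm_inv, Real.norm_of_nonneg hr0.le, inv_mul_le_one₀ hr0]
      exact hy.le
    rw [(h0.iteratedFDeriv ℝ m).eq_of_nhds]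
    simp only [iteratedFDeriv_fun_zero, Pi.zero_apply, norm_zero, mul_zero]
    positivity
  · have h1 : ‖iteratedFDeriv ℝ m (truncate φ r - φ : 𝓢(E n, ℂ)) x‖ ≤
        ∑ i ∈ Finset.range (m + 1), (m.choose i : ℝ) *
          SchwartzMap.seminorm ℝ 0 i (cutoff (n := n)) * ‖iteratedFDeriv ℝ (m - i) φ x‖ +
          ‖iteratedFDeriv ℝ m φ x‖ := by
      rw [hcoe, iteratedFDeriv_sub_apply (hcs.mul (φ.smooth m)).contDiffAt
        (φ.smooth m).contDiffAt]
      refine (norm_sub_le _ _).trans (add_le_add_left ?_ _)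
      refine (norm_iteratedFDeriv_mul_le hcs (φ.smooth m) x le_rfl).trans ?_
      gcongr with i hi
      exact norm_iteratedFDeriv_cutoff_comp_le hr i x
    have h2 : ∀ j, ‖x‖ ^ k * ‖iteratedFDeriv ℝ j φ x‖ ≤
        r⁻¹ * SchwartzMap.seminorm ℝ (k + 1) j φ := by
      intro j
      rw [inv_mul_eq_div, le_div_iff₀ hr0]
      refine le_trans ?_ (SchwartzMap.le_seminorm ℝ (k + 1) j φ x)
      calc ‖x‖ ^ k * ‖iteratedFDeriv ℝ j φ x‖ * r ≤ ‖x‖ ^ k * ‖iteratedFDeriv ℝ j φ x‖ * ‖x‖ := by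
            gcongr
        _ = _ := by ring
    calc _ ≤ ‖x‖ ^ k * (∑ i ∈ Finset.range (m + 1), (m.choose i : ℝ) *
          SchwartzMap.seminorm ℝ 0 i (cutoff (n := n)) * ‖iteratedFDeriv ℝ (m - i) φ x‖ +
          ‖iteratedFDeriv ℝ m φ x‖) := by gcongr
      _ = ∑ i ∈ Finset.range (m + 1), (m.choose i : ℝ) *
          SchwartzMap.seminorm ℝ 0 i (cutoff (n := n)) *
            (‖x‖ ^ k * ‖iteratedFDeriv ℝ (m - i) φ x‖) +
          ‖x‖ ^ k * ‖iteratedFDeriv ℝ m φ x‖ := by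
          rw [mul_add, Finset.mul_sum]
          congr 1
          exact Finset.sum_congr rfl fun i _ => by ring
      _ ≤ ∑ i ∈ Finset.range (m + 1), (m.choose i : ℝ) *
          SchwartzMap.seminorm ℝ 0 i (cutoff (n := n)) *
            (r⁻¹ * SchwartzMap.seminorm ℝ (k + 1) (m - i) φ) +
          r⁻¹ * SchwartzMap.seminorm ℝ (k + 1) m φ := by
          exact add_le_add (Finset.sum_le_sum fun i _ =>
            mul_le_mul_of_nonneg_left (h2 _) (by positivity)) (h2 _)
      _ = _ := by
          rw [add_mul, Finset.sum_mul]
          congr 1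
          · exact Finset.sum_congr rfl fun i _ => by ring
          · ring

lemma tendsto_truncate (φ : 𝓢(E n, ℂ)) :
    Filter.Tendsto (truncate φ) Filter.atTop (nhds φ) := by
  rw [(schwartz_withSeminorms ℝ (E n) ℂ).tendsto_nhds]
  rintro ⟨k, m⟩ ε hε
  obtain ⟨C, hC, h⟩ := seminorm_truncate_sub_le φ k m
  have hlim : Filter.Tendsto (fun r : ℝ => C * r⁻¹) Filter.atTop (nhds (C * 0)) :=
    tendsto_inv_atTop_zero.const_mul C
  rw [mul_zero] at hlim
  filter_upwards [hlim.eventually_lt_const hε, Filter.eventually_ge_atTop 1] with r h1 h2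
  exact (h r h2).trans_lt h1

lemma dense_hasCompactSupport : Dense {φ : 𝓢(E n, ℂ) | HasCompactSupport φ} := by
  intro φ
  refine mem_closure_of_tendsto (tendsto_truncate φ) ?_
  filter_upwards [Filter.eventually_gt_atTop 0] with r hr
  exact hasCompactSupport_truncate φ hr

end Density

/-! ### Weights given by powers of the symbol -/

section Weights

variable {n : ℕ}

/-- `ζ` is isotropic and large. -/
structure Admissible (ζ : EuclideanSpace ℂ (Fin n)) : Prop where
  isotropic : ∑ j, ζ j * ζ j = 0
  large : 10 ≤ ‖ζ‖

/-- The weight `|p_ζ|^b`. -/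
def weight (ζ : EuclideanSpace ℂ (Fin n)) (b : ℝ) (ξ : E n) : ℂ :=
  ((‖freqSymb ζ ξ‖ ^ b : ℝ) : ℂ)

variable {ζ : EuclideanSpace ℂ (Fin n)}

lemma Admissible.reVec_ne_zero (hζ : Admissible ζ) : reVec ζ ≠ 0 := by
  intro h
  have h1 := norm_eq_sqrt_two_mul hζ.isotropic
  rw [h, norm_zero] at h1
  nlinarith [hζ.large]

@[fun_prop]
lemma measurable_weight (b : ℝ) : Measurable (weight ζ b) := by
  have := (continuous_freqSymb ζ).measurable
  unfold weight; fun_prop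

lemma continuous_weight {b : ℝ} (hb : 0 ≤ b) : Continuous (weight ζ b) := by
  unfold weight
  refine Complex.continuous_ofReal.comp ?_
  exact (continuous_freqSymb ζ).norm.rpow_const fun _ => Or.inr hb

lemma conj_weight (b : ℝ) (ξ : E n) : (starRingEnd ℂ) (weight ζ b ξ) = weight ζ b ξ :=
  Complex.conj_ofReal _

lemma norm_weight (b : ℝ) (ξ : E n) : ‖weight ζ b ξ‖ = ‖freqSymb ζ ξ‖ ^ b := by
  rw [weight, Complex.norm_real, Real.norm_of_nonneg (by positivity)]

lemma Admissible.ae_ne_zero (hζ : Admissible ζ) : ∀ᵐ ξ : E n, freqSymb ζ ξ ≠ 0 :=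
  ae_freqSymb_ne_zero hζ.reVec_ne_zero

lemma weight_mul_weight_neg {ξ : E n} (h : freqSymb ζ ξ ≠ 0) :
    weight ζ (1 / 2) ξ * weight ζ (-1 / 2) ξ = 1 := by
  rw [weight, weight, ← Complex.ofReal_mul, ← Real.rpow_add (norm_pos_iff.mpr h)]
  norm_num

lemma enorm_weight_neg_sq (ξ : E n) :
    ‖weight ζ (-1 / 2) ξ‖ₑ ^ 2 = ENNReal.ofReal (1 / ‖freqSymb ζ ξ‖) := by
  rw [← ofReal_norm, norm_weight, ← ENNReal.ofReal_pow (by positivity), ← Real.rpow_natCast,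
    ← Real.rpow_mul (norm_nonneg _)]
  norm_num [Real.rpow_neg_one]

/-- The symbol `2 π i ξ_j |p_ζ|^{-1/2}`. -/
def gradWeight (ζ : EuclideanSpace ℂ (Fin n)) (j : Fin n) (ξ : E n) : ℂ :=
  2 * Real.pi * Complex.I * (ξ j : ℂ) * weight ζ (-1 / 2) ξ

lemma Admissible.gaussBounded_weight (hζ : Admissible ζ) :
    GaussBounded (weight ζ (-1 / 2)) (√(symbConst n / ‖ζ‖)) where
  measurable := by fun_prop
  nonneg := Real.sqrt_nonneg _
  bound η := by
    have := symbConst_pos n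
    rw [Real.sq_sqrt (by positivity)]
    simp only [enorm_weight_neg_sq]
    exact lintegral_gaussian_mul_inv_freqSymb_le' hζ.isotropic hζ.large η

lemma Admissible.gaussBounded_gradWeight (hζ : Admissible ζ) (j : Fin n) :
    GaussBounded (gradWeight ζ j) (√(symbConst n * ‖ζ‖)) where
  measurable := by unfold gradWeight; fun_prop
  nonneg := Real.sqrt_nonneg _
  bound η := by
    have := symbConst_pos n
    rw [Real.sq_sqrt (by positivity)]
    refine (lintegral_mono fun ξ => ?_).trans
      (lintegral_gaussian_mul_sq_div_freqSymb_le hζ.isotropic hζ.large η)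
    refine mul_le_mul_right ?_ _
    rw [gradWeight, enorm_mul, mul_pow, enorm_weight_neg_sq, ENNReal.ofReal_mul (by positivity)]
    gcongr
    rw [← ofReal_norm, ENNReal.ofReal_pow (norm_nonneg _)]
    gcongr
    rw [norm_smul, norm_mul, norm_mul, norm_mul, Complex.norm_I, mul_one, Complex.norm_real,
      Complex.norm_real, Complex.norm_ofNat, Real.norm_of_nonneg Real.pi_pos.le,
      Real.norm_of_nonneg (mul_nonneg zero_le_two Real.pi_pos.le)]
    gcongr
    exact PiLp.norm_apply_le ξ j

lemma norm_weight_half_le (ξ : E n) :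
    ‖weight ζ (1 / 2) ξ‖ ≤ (1 + 4 * Real.pi ^ 2 + 4 * Real.pi * ‖ζ‖) * (1 + ‖ξ‖ ^ 2) := by
  have hpi := Real.pi_pos
  have h1 := norm_freqSymb_le (ζ := ζ) ξ
  rw [norm_smul, Real.norm_of_nonneg (by positivity)] at h1
  have h2 : ‖weight ζ (1 / 2) ξ‖ ≤ 1 + ‖freqSymb ζ ξ‖ := by
    rw [norm_weight, ← Real.sqrt_eq_rpow, Real.sqrt_le_iff]
    constructor
    · positivity
    · nlinarith [norm_nonneg (freqSymb ζ ξ)]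
  have h3 : ‖ξ‖ ≤ 1 + ‖ξ‖ ^ 2 := by nlinarith [sq_nonneg (‖ξ‖ - 1), norm_nonneg ξ]
  have h4 : 2 * ‖ζ‖ * (2 * Real.pi * ‖ξ‖) ≤ 4 * Real.pi * ‖ζ‖ * (1 + ‖ξ‖ ^ 2) := by
    have : 2 * ‖ζ‖ * (2 * Real.pi * ‖ξ‖) = 4 * Real.pi * ‖ζ‖ * ‖ξ‖ := by ring
    rw [this]; gcongr
  nlinarith [sq_nonneg ‖ξ‖, sq_nonneg Real.pi]

/-- The function `1 + |ξ|²`. -/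
def bracket (ξ : E n) : ℂ := ((1 + ‖ξ‖ ^ 2 : ℝ) : ℂ)

lemma hasTemperateGrowth_bracket : (bracket (n := n)).HasTemperateGrowth := by
  unfold bracket
  exact Function.Complex.hasTemperateGrowth_ofReal.comp
    ((Function.HasTemperateGrowth.const 1).add (Function.hasTemperateGrowth_norm_sq _))

lemma norm_bracket (ξ : E n) : ‖bracket ξ‖ = 1 + ‖ξ‖ ^ 2 := by
  rw [bracket, Complex.norm_real, Real.norm_of_nonneg (by positivity)]

lemma bracket_ne_zero (ξ : E n) : bracket ξ ≠ 0 := by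
  rw [← norm_ne_zero_iff, norm_bracket]; positivity

/-- `|p_ζ|^{1/2}` is not smooth on the zero set, so it does not act on Schwartz functions. Dividing
by the smooth function `1 + |ξ|²`, which dominates its growth, leaves a bounded multiplier on `L²`;
the bracket itself acts on Schwartz functions. -/
lemma memLp_weight_div_bracket :
    MemLp (fun ξ : E n => weight ζ (1 / 2) ξ / bracket ξ) ∞ volume := by
  refine memLp_top_of_bound ?_ (1 + 4 * Real.pi ^ 2 + 4 * Real.pi * ‖ζ‖)
    (Filter.Eventually.of_forall fun ξ => ?_)
  · have : Measurable (bracket (n := n)) := by unfold bracket; fun_prop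
    exact Measurable.aestronglyMeasurable (by fun_prop)
  · rw [norm_div, div_le_iff₀ (norm_pos_iff.mpr (bracket_ne_zero ξ)), norm_bracket]
    exact norm_weight_half_le ξ

variable (ζ) in
/-- The map `θ ↦ |p_ζ|^{1/2} θ` from Schwartz functions to `L²`. -/
def sqrtWeight : 𝓢(E n, ℂ) →L[ℂ] L2 n :=
  mulL2 (memLp_weight_div_bracket (ζ := ζ)) ∘L SchwartzMap.toLpCLM ℂ ℂ 2 volume ∘L
    SchwartzMap.smulLeftCLM ℂ (bracket (n := n))

lemma coeFn_sqrtWeight (θ : 𝓢(E n, ℂ)) :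
    sqrtWeight ζ θ =ᵐ[volume] fun ξ => weight ζ (1 / 2) ξ * θ ξ := by
  filter_upwards [coeFn_mulL2 (memLp_weight_div_bracket (ζ := ζ))
    ((SchwartzMap.smulLeftCLM ℂ (bracket (n := n)) θ).toLp 2 volume),
    (SchwartzMap.smulLeftCLM ℂ (bracket (n := n)) θ).coeFn_toLp 2 volume] with ξ h1 h2
  have h3 : sqrtWeight ζ θ = mulL2 (memLp_weight_div_bracket (ζ := ζ))
    ((SchwartzMap.smulLeftCLM ℂ (bracket (n := n)) θ).toLp 2 volume) := rfl
  rw [h3, h1, h2, SchwartzMap.smulLeftCLM_apply_apply hasTemperateGrowth_bracket, smul_eq_mul]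
  have := bracket_ne_zero ξ
  field_simp

/-- A locally integrable function that is orthogonal to all compactly supported Schwartz functions
vanishes almost everywhere. -/
lemma ae_eq_zero_of_integral_schwartz_eq_zero {f : E n → ℂ} (hf : LocallyIntegrable f)
    (h : ∀ φ : 𝓢(E n, ℂ), HasCompactSupport φ → ∫ x, f x * φ x = 0) : f =ᵐ[volume] 0 := by
  refine ae_eq_zero_of_integral_contDiff_smul_eq_zero hf fun g hg hgc => ?_
  have hg1 : HasCompactSupport (Complex.ofRealCLM ∘ g) := hgc.comp_left rfl
  have hg2 : ContDiff ℝ ((⊤ : ℕ∞) : WithTop ℕ∞) (Complex.ofRealCLM ∘ g) := by fun_prop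
  rw [← h (hg1.toSchwartzMap hg2) hg1]
  refine integral_congr_ae (Filter.Eventually.of_forall fun x => ?_)
  simp [mul_comm]

lemma ae_eq_of_integral_schwartz_eq {f g : E n → ℂ} (hf : LocallyIntegrable f)
    (hg : LocallyIntegrable g)
    (h : ∀ φ : 𝓢(E n, ℂ), HasCompactSupport φ → ∫ x, f x * φ x = ∫ x, g x * φ x) :
    f =ᵐ[volume] g := by
  have hi : ∀ {u : E n → ℂ}, LocallyIntegrable u → ∀ φ : 𝓢(E n, ℂ), HasCompactSupport φ →
      Integrable fun x => u x * φ x := fun hu φ hφ =>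
    hu.integrable_smul_right_of_hasCompactSupport φ.continuous hφ
  have := ae_eq_zero_of_integral_schwartz_eq_zero (hf.sub hg) fun φ hφ => by
    simp only [Pi.sub_apply, sub_mul]
    rw [integral_sub (hi hf φ hφ) (hi hg φ hφ), h φ hφ, sub_self]
  filter_upwards [this] with x hx
  exact sub_eq_zero.mp hx

lemma L2.locallyIntegrable (h : L2 n) : LocallyIntegrable h :=
  (Lp.memLp h).locallyIntegrable (by norm_num)

/-- A function `h` orthogonal to the range satisfies `|p_ζ|^{1/2} h = 0` almost everywhere, and the
weight vanishes only on a null set. -/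
lemma Admissible.denseRange_sqrtWeight (hζ : Admissible ζ) : DenseRange (sqrtWeight ζ) := by
  have : (LinearMap.range (sqrtWeight ζ).toLinearMap).topologicalClosure = ⊤ := by
    rw [Submodule.topologicalClosure_eq_top_iff, Submodule.eq_bot_iff]
    intro h hh
    have h0 : (fun ξ => weight ζ (1 / 2) ξ * h ξ) =ᵐ[volume] 0 := by
      refine ae_eq_zero_of_integral_contDiff_smul_eq_zero
        ((L2.locallyIntegrable h).continuous_mul (continuous_weight (by norm_num)))
        fun g hg hgc => ?_
      have hg1 : HasCompactSupport (Complex.ofRealCLM ∘ g) := hgc.comp_left rfl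
      have hg2 : ContDiff ℝ ((⊤ : ℕ∞) : WithTop ℕ∞) (Complex.ofRealCLM ∘ g) := by fun_prop
      have key := (Submodule.mem_orthogonal _ _).mp hh _ ⟨hg1.toSchwartzMap hg2, rfl⟩
      change inner ℂ (sqrtWeight ζ (hg1.toSchwartzMap hg2)) h = 0 at key
      rw [inner_L2] at key
      rw [← key]
      refine integral_congr_ae ?_
      filter_upwards [coeFn_sqrtWeight (ζ := ζ) (hg1.toSchwartzMap hg2)] with ξ hξ
      rw [hξ, map_mul, conj_weight]
      simp only [HasCompactSupport.toSchwartzMap_toFun, Function.comp_apply,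
        Complex.ofRealCLM_apply, Complex.conj_ofReal, Complex.real_smul]
      ring
    refine Lp.ext ?_
    filter_upwards [h0, hζ.ae_ne_zero, Lp.coeFn_zero ℂ 2 (volume : Measure (E n))] with ξ h1 h2 h3
    rw [h3]
    have h4 := weight_mul_weight_neg h2
    have h5 : weight ζ (1 / 2) ξ ≠ 0 := left_ne_zero_of_mul_eq_one h4
    exact (mul_eq_zero.mp h1).resolve_left h5
  rw [← Submodule.dense_iff_topologicalClosure_eq_top] at this
  exact this

/-- Identities tested only against `C_c^∞` thus determine elements of `L²`. The set is the image of
the compactly supported functions, dense in Schwartz space, under the Fourier transform followed by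
a continuous map with dense range. -/
lemma Admissible.dense_sqrtWeight_image (hζ : Admissible ζ) :
    Dense (sqrtWeight ζ '' {θ | HasCompactSupport (𝓕⁻ θ : 𝓢(E n, ℂ))}) := by
  refine hζ.denseRange_sqrtWeight.dense_image (sqrtWeight ζ).continuous ?_
  have h1 : DenseRange (fun φ : 𝓢(E n, ℂ) => 𝓕 φ) :=
    Function.Surjective.denseRange fun θ => ⟨𝓕⁻ θ, FourierTransform.fourier_fourierInv_eq θ⟩
  have h2 := h1.dense_image (FourierTransform.continuous_fourier) (dense_hasCompactSupport (n := n))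
  refine h2.mono ?_
  rintro _ ⟨φ, hφ, rfl⟩
  simpa [FourierTransform.fourierInv_fourier_eq] using hφ

end Weights

/-! ### Conjugation, derivatives and the Fourier transform of Schwartz functions -/

section Representation

variable {n : ℕ}

/-- Complex conjugation of Schwartz functions. -/
def conjS (φ : 𝓢(E n, ℂ)) : 𝓢(E n, ℂ) :=
  φ.postcompCLM (𝕜 := ℝ) (Complex.conjCLE : ℂ →L[ℝ] ℂ)

@[simp]
lemma conjS_apply (φ : 𝓢(E n, ℂ)) (x : E n) : conjS φ x = (starRingEnd ℂ) (φ x) := by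
  simp [conjS]

@[simp]
lemma conjS_conjS (φ : 𝓢(E n, ℂ)) : conjS (conjS φ) = φ := by
  ext x; simp

lemma hasCompactSupport_conjS {φ : 𝓢(E n, ℂ)} (h : HasCompactSupport φ) :
    HasCompactSupport (conjS φ) := by
  have : (conjS φ : E n → ℂ) = (starRingEnd ℂ) ∘ φ := by ext x; simp
  rw [this]
  exact h.comp_left (map_zero _)

lemma fourier_conjS (φ : 𝓢(E n, ℂ)) : 𝓕 (conjS φ) = conjS (𝓕⁻ φ) := by
  ext ξ
  rw [conjS_apply, SchwartzMap.fourier_coe, SchwartzMap.fourierInv_coe, Real.fourier_eq',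
    Real.fourierInv_eq', ← integral_conj]
  refine integral_congr_ae (Filter.Eventually.of_forall fun x => ?_)
  simp only [conjS_apply, smul_eq_mul, map_mul, ← Complex.exp_conj, Complex.conj_ofReal,
    Complex.conj_I]
  congr 2
  push_cast
  ring

lemma pd_eq_lineDerivOp (j : Fin n) (φ : 𝓢(E n, ℂ)) (x : E n) :
    pd j φ x = (∂_{(e j : E n)} φ) x := rfl

lemma lineDerivOp_conjS (m : E n) (φ : 𝓢(E n, ℂ)) : ∂_{m} (conjS φ) = conjS (∂_{m} φ) := by
  ext x
  rw [conjS_apply, SchwartzMap.lineDerivOp_apply_eq_fderiv,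
    SchwartzMap.lineDerivOp_apply_eq_fderiv]
  have h : (conjS φ : E n → ℂ) = (Complex.conjCLE : ℂ →L[ℝ] ℂ) ∘ φ := by ext x; simp
  rw [h, ((Complex.conjCLE : ℂ →L[ℝ] ℂ).hasFDerivAt.comp x (φ.hasFDerivAt x)).fderiv]
  simp

/-- Multiplication by `2 π i ξ_j` on Schwartz functions. -/
def mulFreq (j : Fin n) (θ : 𝓢(E n, ℂ)) : 𝓢(E n, ℂ) :=
  (2 * Real.pi * Complex.I) • SchwartzMap.smulLeftCLM ℂ (inner ℝ · (e j : E n)) θ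

lemma inner_e (ξ : E n) (j : Fin n) : inner ℝ ξ (e j) = ξ j := by
  simp [e, EuclideanSpace.inner_single_right]

lemma mulFreq_apply (j : Fin n) (θ : 𝓢(E n, ℂ)) (ξ : E n) :
    mulFreq j θ ξ = 2 * Real.pi * Complex.I * (ξ j : ℂ) * θ ξ := by
  have : (fun ξ : E n => inner ℝ ξ (e j : E n)).HasTemperateGrowth := by fun_prop
  rw [mulFreq, smul_apply, SchwartzMap.smulLeftCLM_apply_apply this, inner_e, smul_eq_mul,
    Complex.real_smul]
  ring

lemma lineDerivOp_fourierInv (j : Fin n) (θ : 𝓢(E n, ℂ)) :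
    ∂_{(e j : E n)} (𝓕⁻ θ) = 𝓕⁻ (mulFreq j θ) :=
  SchwartzMap.lineDerivOp_fourierInv_eq θ (e j)

lemma fourierInv_lineDerivOp (j : Fin n) (φ : 𝓢(E n, ℂ)) :
    𝓕⁻ (∂_{(e j : E n)} φ) = -mulFreq j (𝓕⁻ φ) := by
  rw [SchwartzMap.fourierInv_lineDerivOp_eq, mulFreq, neg_smul]

/-! ### Adjoints of the weighted Fourier operators -/

lemma inner_mulGauss (f g : L2 n) : inner ℂ (mulGauss f) g = inner ℂ f (mulGauss g) := by
  rw [inner_L2, inner_L2]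
  refine integral_congr_ae ?_
  filter_upwards [coeFn_mulL2 memLp_gaussian_top f, coeFn_mulL2 memLp_gaussian_top g] with x h1 h2
  rw [h1, h2, map_mul, conj_gaussian]
  ring

variable {ζ : EuclideanSpace ℂ (Fin n)}

/-- By Plancherel the adjoint is formally `h ↦ e^{-π|x|²} 𝓕⁻(m̄ h)`. Here `m̄ |p_ζ|^{1/2} θ` is
again a Schwartz function `θ'`, so the formula holds literally. -/
lemma adjoint_gaussOp_sqrtWeight {m : E n → ℂ} {K : ℝ} (h : GaussBounded m K)
    (θ θ' : 𝓢(E n, ℂ))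
    (hm : ∀ᵐ ξ, (starRingEnd ℂ) (m ξ) * (weight ζ (1 / 2) ξ * θ ξ) = θ' ξ) :
    (gaussOp h).adjoint (sqrtWeight ζ θ) = mulGauss ((𝓕⁻ θ').toLp 2 volume) := by
  refine ext_inner_left ℂ fun f => ?_
  have h1 : inner ℂ (gaussOp h f) (sqrtWeight ζ θ) =
      inner ℂ (𝓕 (mulGauss f) : L2 n) (θ'.toLp 2 volume) := by
    rw [inner_L2, inner_L2]
    refine integral_congr_ae ?_
    filter_upwards [coeFn_gaussOp h f, coeFn_sqrtWeight (ζ := ζ) θ, θ'.coeFn_toLp 2 volume, hm]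
      with ξ h1 h2 h3 h4
    rw [h1, h2, h3, ← h4, map_mul]
    ring
  have h2 : inner ℂ (mulGauss f) ((𝓕⁻ θ' : 𝓢(E n, ℂ)).toLp 2 volume) =
      inner ℂ (𝓕 (mulGauss f) : L2 n) (θ'.toLp 2 volume) := by
    have := Lp.inner_fourier_eq (mulGauss f) ((𝓕⁻ θ' : 𝓢(E n, ℂ)).toLp 2 volume)
    rw [SchwartzMap.toLp_fourier_eq, FourierTransform.fourier_fourierInv_eq] at this
    exact this.symm
  rw [ContinuousLinearMap.adjoint_inner_right, h1, ← h2, inner_mulGauss]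

lemma Admissible.adjoint_weight_sqrtWeight (hζ : Admissible ζ) (θ : 𝓢(E n, ℂ)) :
    (gaussOp hζ.gaussBounded_weight).adjoint (sqrtWeight ζ θ) =
      mulGauss ((𝓕⁻ θ).toLp 2 volume) := by
  refine adjoint_gaussOp_sqrtWeight _ θ θ ?_
  filter_upwards [hζ.ae_ne_zero] with ξ h
  rw [conj_weight, ← mul_assoc, mul_comm (weight ζ (-1 / 2) ξ), weight_mul_weight_neg h, one_mul]

lemma Admissible.adjoint_gradWeight_sqrtWeight (hζ : Admissible ζ) (j : Fin n)
    (θ : 𝓢(E n, ℂ)) :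
    (gaussOp (hζ.gaussBounded_gradWeight j)).adjoint (sqrtWeight ζ θ) =
      -mulGauss ((∂_{(e j : E n)} (𝓕⁻ θ)).toLp 2 volume) := by
  rw [adjoint_gaussOp_sqrtWeight (θ' := -mulFreq j θ)]
  · rw [lineDerivOp_fourierInv, ← map_neg]
    congr 1
    have h1 : (𝓕⁻ (-mulFreq j θ) : 𝓢(E n, ℂ)) = -𝓕⁻ (mulFreq j θ) :=
      map_neg (FourierTransform.fourierInvCLM ℂ 𝓢(E n, ℂ)) _
    rw [h1]
    exact map_neg (SchwartzMap.toLpCLM ℂ ℂ 2 volume) _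
  · filter_upwards [hζ.ae_ne_zero] with ξ h
    rw [neg_apply, mulFreq_apply, gradWeight, map_mul, conj_weight]
    have h1 := weight_mul_weight_neg h
    simp only [map_mul, Complex.conj_I, Complex.conj_ofReal, map_ofNat]
    linear_combination (-(2 * Real.pi * Complex.I * (ξ j : ℂ) * θ ξ)) * h1

/-- The function `e^{π|x|²} f(x)` for `f ∈ L²`. -/
def unGauss (f : L2 n) (x : E n) : ℂ := (gaussian x)⁻¹ * f x

lemma continuous_gaussian_inv : Continuous fun x : E n => (gaussian x)⁻¹ :=
  continuous_gaussian.inv₀ gaussian_ne_zero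

lemma locallyIntegrable_unGauss (f : L2 n) : LocallyIntegrable (unGauss f) :=
  (L2.locallyIntegrable f).continuous_mul continuous_gaussian_inv

lemma memL2loc_continuous_mul {f : E n → ℂ} (hf : MemL2loc f) {c : E n → ℂ} (hc : Continuous c) :
    MemL2loc fun x => c x * f x := by
  intro K hK
  obtain ⟨B, hB⟩ := hK.exists_bound_of_continuousOn hc.continuousOn
  refine (hf K hK).of_le_mul (c := B) (hc.aestronglyMeasurable.mul (hf K hK).1) ?_
  filter_upwards [ae_restrict_mem hK.measurableSet] with x hx
  rw [norm_mul]
  gcongr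
  exact hB x hx

lemma memL2loc_L2 (f : L2 n) : MemL2loc f := fun K _ => (Lp.memLp f).restrict K

lemma memL2loc_unGauss (f : L2 n) : MemL2loc (unGauss f) :=
  memL2loc_continuous_mul (memL2loc_L2 f) continuous_gaussian_inv

/-- Pairing `e^{π|x|²} (R_m)^† h` with a test function. -/
lemma integral_unGauss_adjoint_mul {m : E n → ℂ} {K : ℝ} (hm : GaussBounded m K) (h : L2 n)
    (φ : 𝓢(E n, ℂ)) (hφ : HasCompactSupport φ) :
    ∫ x, unGauss ((gaussOp hm).adjoint h) x * φ x =
      ∫ ξ, (starRingEnd ℂ) (m ξ) * h ξ * (𝓕⁻ φ) ξ := by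
  -- The growing factor `e^{π|x|²}` is put on the test function, whose compact support keeps it in
  -- `L²`; the conjugate turns the inner product into a bilinear pairing.
  have hF2 : MemLp (fun x => (gaussian x)⁻¹ * conjS φ x) 2 volume := by
    refine Continuous.memLp_of_hasCompactSupport
      (continuous_gaussian_inv.mul (conjS φ).continuous) ?_
    exact (hasCompactSupport_conjS hφ).mul_left
  have hmul : mulGauss (hF2.toLp _) = (conjS φ).toLp 2 volume := by
    refine Lp.ext ?_
    filter_upwards [coeFn_mulL2 memLp_gaussian_top (hF2.toLp _), hF2.coeFn_toLp,
      (conjS φ).coeFn_toLp 2 volume] with x h1 h2 h3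
    rw [h1, h2, h3, mul_inv_cancel_left₀ (gaussian_ne_zero x)]
  calc ∫ x, unGauss ((gaussOp hm).adjoint h) x * φ x
      = inner ℂ (hF2.toLp _) ((gaussOp hm).adjoint h) := by
        rw [inner_L2]
        refine integral_congr_ae ?_
        filter_upwards [hF2.coeFn_toLp] with x hx
        rw [hx, map_mul, conjS_apply, Complex.conj_conj, map_inv₀, conj_gaussian, unGauss]
        ring
    _ = inner ℂ (gaussOp hm (hF2.toLp _)) h := ContinuousLinearMap.adjoint_inner_right _ _ _
    _ = _ := by
        rw [inner_L2]
        refine integral_congr_ae ?_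
        filter_upwards [coeFn_gaussOp hm (hF2.toLp _), (𝓕 (conjS φ)).coeFn_toLp 2 volume]
          with ξ h1 h2
        rw [h1, hmul, SchwartzMap.toLp_fourier_eq, h2, fourier_conjS, conjS_apply, map_mul,
          Complex.conj_conj]
        ring

/-! ### The space `Ẋ^{1/2}_ζ` on the Fourier side -/

variable (ζ) in
/-- The Fourier transform `|p_ζ|^{-1/2} h` of the element of `Ẋ^{1/2}_ζ` with profile `h`. -/
def profile (h : L2 n) (ξ : E n) : ℂ := weight ζ (-1 / 2) ξ * h ξ

/-- On a ball the Gaussian centred at the origin is bounded below, so the averaged estimate already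
bounds the integral of `1/|p_ζ|`. -/
lemma Admissible.integrableOn_weight_sq (hζ : Admissible ζ) (ρ : ℝ) :
    MemLp (weight ζ (-1 / 2)) 2 (volume.restrict (Metric.closedBall (0 : E n) ρ)) := by
  refine ⟨(measurable_weight _).aestronglyMeasurable, ?_⟩
  have hsq : eLpNorm (weight ζ (-1 / 2)) 2
      (volume.restrict (Metric.closedBall (0 : E n) ρ)) ^ 2 < ∞ := by
    rw [eLpNorm_two_sq]
    have hb := hζ.gaussBounded_weight.bound 0
    have hmono : ∫⁻ ξ in Metric.closedBall (0 : E n) ρ, ‖weight ζ (-1 / 2) ξ‖ₑ ^ 2 ≤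
        ∫⁻ ξ in Metric.closedBall (0 : E n) ρ, ENNReal.ofReal (Real.exp (Real.pi * ρ ^ 2)) *
          (ENNReal.ofReal (Real.exp (-Real.pi * ‖ξ - 0‖ ^ 2)) * ‖weight ζ (-1 / 2) ξ‖ₑ ^ 2) := by
      refine setLIntegral_mono' measurableSet_closedBall fun ξ hξ => ?_
      rw [← mul_assoc, ← ENNReal.ofReal_mul (Real.exp_pos _).le, ← Real.exp_add]
      refine le_mul_of_one_le_left' ?_
      rw [ENNReal.one_le_ofReal, Real.one_le_exp_iff, sub_zero]
      have h1 : ‖ξ‖ ≤ ρ := by simpa using hξ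
      have h2 : ‖ξ‖ ^ 2 ≤ ρ ^ 2 := by gcongr
      nlinarith [Real.pi_pos]
    refine hmono.trans_lt ((setLIntegral_le_lintegral _ _).trans_lt ?_)
    rw [lintegral_const_mul _ (by fun_prop)]
    exact ENNReal.mul_lt_top ENNReal.ofReal_lt_top (hb.trans_lt ENNReal.ofReal_lt_top)
  by_contra hc
  rw [not_lt, top_le_iff] at hc
  simp [hc] at hsq

lemma Admissible.locallyIntegrable_profile (hζ : Admissible ζ) (h : L2 n) :
    LocallyIntegrable (profile ζ h) := by
  rw [locallyIntegrable_iff]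
  intro K hK
  obtain ⟨ρ, hρ⟩ := hK.isBounded.subset_closedBall 0
  refine IntegrableOn.mono_set ?_ hρ
  exact MemLp.integrable_mul (hζ.integrableOn_weight_sq ρ) ((Lp.memLp h).restrict _)

lemma norm_weight_neg_le_one {ξ : E n} (hξ : 2 * ‖ζ‖ + 1 ≤ ‖ξ‖) :
    ‖weight ζ (-1 / 2) ξ‖ ≤ 1 := by
  rw [norm_weight]
  refine Real.rpow_le_one_of_one_le_of_nonpos ?_ (by norm_num)
  refine le_trans ?_ (norm_freqSymb_ge ξ)
  have hx : 2 * ‖ζ‖ + 1 ≤ ‖(2 * Real.pi) • ξ‖ := by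
    rw [norm_smul, Real.norm_of_nonneg (by positivity)]
    nlinarith [Real.pi_gt_three, norm_nonneg ξ]
  nlinarith [norm_nonneg ζ]

/-- The transform is split at radius `2|ζ| + 1`. Inside, it is a product of two `L²` functions,
hence `L¹`; outside, the weight is at most one and it is `L²`. Both pieces are tempered. -/
lemma Admissible.exists_temperedDistribution (hζ : Admissible ζ) (h : L2 n) :
    ∃ ψ : 𝓢'(E n, ℂ), HasFourierRep ψ (profile ζ h) := by
  set S := Metric.closedBall (0 : E n) (2 * ‖ζ‖ + 1) with hS
  have hSm : MeasurableSet S := measurableSet_closedBall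
  have h1 : MemLp (S.indicator (profile ζ h)) 1 volume := by
    rw [memLp_one_iff_integrable]
    exact ((hζ.locallyIntegrable_profile h).integrableOn_isCompact
      (isCompact_closedBall _ _)).integrable_indicator hSm
  have h2 : MemLp (Sᶜ.indicator (profile ζ h)) 2 volume := by
    have hae : AEStronglyMeasurable (profile ζ h) volume :=
      (measurable_weight _).aestronglyMeasurable.mul (Lp.aestronglyMeasurable h)
    refine (Lp.memLp h).of_le (hae.indicator hSm.compl)
      (Filter.Eventually.of_forall fun ξ => ?_)
    by_cases hξ : ξ ∈ Sᶜ
    · rw [Set.indicator_of_mem hξ, profile, norm_mul]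
      refine mul_le_of_le_one_left (norm_nonneg _) (norm_weight_neg_le_one ?_)
      have : ¬ ‖ξ‖ ≤ 2 * ‖ζ‖ + 1 := by simpa [hS] using hξ
      exact (not_le.mp this).le
    · rw [Set.indicator_of_notMem hξ, norm_zero]; exact norm_nonneg _
  refine ⟨𝓕⁻ (((h1.toLp _ : Lp ℂ 1 (volume : Measure (E n))) : 𝓢'(E n, ℂ)) +
    ((h2.toLp _ : L2 n) : 𝓢'(E n, ℂ))), hζ.locallyIntegrable_profile h, fun φ => ?_⟩
  have i1 : Integrable fun ξ => S.indicator (profile ζ h) ξ * φ ξ := by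
    have := (φ.memLp_top volume).mul (memLp_one_iff_integrable.mpr
      (memLp_one_iff_integrable.mp h1)) (r := 1)
    exact memLp_one_iff_integrable.mp this
  have i2 : Integrable fun ξ => Sᶜ.indicator (profile ζ h) ξ * φ ξ :=
    h2.integrable_mul (φ.memLp 2 volume)
  have hsum : ∀ ξ, profile ζ h ξ * φ ξ = S.indicator (profile ζ h) ξ * φ ξ +
      Sᶜ.indicator (profile ζ h) ξ * φ ξ := by
    intro ξ
    rw [← add_mul]
    congr 1
    exact (congrFun (Set.indicator_self_add_compl S (profile ζ h)) ξ).symm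
  refine ⟨(i1.add i2).congr (Filter.Eventually.of_forall fun ξ => (hsum ξ).symm), ?_⟩
  rw [TemperedDistribution.fourierInv_apply, FourierTransform.fourierInv_fourier_eq]
  simp only [hsum]
  rw [integral_add i1 i2]
  change (Lp.toTemperedDistribution (h1.toLp _) φ + Lp.toTemperedDistribution (h2.toLp _) φ) = _
  rw [Lp.toTemperedDistribution_apply, Lp.toTemperedDistribution_apply]
  congr 1
  · refine integral_congr_ae ?_
    filter_upwards [h1.coeFn_toLp] with x hx
    rw [hx, smul_eq_mul, mul_comm]
  · refine integral_congr_ae ?_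
    filter_upwards [h2.coeFn_toLp] with x hx
    rw [hx, smul_eq_mul, mul_comm]

lemma HasFourierRep.ae_eq {T : 𝓢(E n, ℂ) → ℂ} {g g' : E n → ℂ} (h : HasFourierRep T g)
    (h' : HasFourierRep T g') : g =ᵐ[volume] g' :=
  ae_eq_of_integral_schwartz_eq h.1 h'.1 fun φ _ => by rw [← (h.2 φ).2, ← (h'.2 φ).2]

lemma xNorm_eq_of_hasFourierRep {T : 𝓢(E n, ℂ) → ℂ} {g : E n → ℂ} (h : HasFourierRep T g)
    (b : ℝ) : xNorm ζ b T = eLpNorm (fun ξ => weight ζ b ξ * g ξ) 2 volume := by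
  refine le_antisymm (iInf₂_le g h) (le_iInf₂ fun g' h' => le_of_eq ?_)
  refine eLpNorm_congr_ae ?_
  filter_upwards [h.ae_eq h'] with ξ hξ
  rw [hξ]; rfl

lemma Admissible.xNorm_half (hζ : Admissible ζ) {T : 𝓢(E n, ℂ) → ℂ} {h : L2 n}
    (hT : HasFourierRep T (profile ζ h)) : xNorm ζ (1 / 2) T = ENNReal.ofReal ‖h‖ := by
  rw [xNorm_eq_of_hasFourierRep hT, ofReal_norm, Lp.enorm_def]
  refine eLpNorm_congr_ae ?_
  filter_upwards [hζ.ae_ne_zero] with ξ hξ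
  rw [profile, ← mul_assoc, weight_mul_weight_neg hξ, one_mul]

lemma Admissible.exists_profile (hζ : Admissible ζ) {T : 𝓢(E n, ℂ) → ℂ}
    (hT : MemX ζ (1 / 2) T) : ∃ h : L2 n, HasFourierRep T (profile ζ h) := by
  rw [MemX, xNorm, iInf_lt_iff] at hT
  obtain ⟨g, hg⟩ := hT
  rw [iInf_lt_iff] at hg
  obtain ⟨hrep, hlt⟩ := hg
  have hmem : MemLp (fun ξ => weight ζ (1 / 2) ξ * g ξ) 2 volume :=
    ⟨(measurable_weight _).aestronglyMeasurable.mul hrep.1.aestronglyMeasurable, hlt⟩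
  have hae : profile ζ (hmem.toLp _) =ᵐ[volume] g := by
    filter_upwards [hmem.coeFn_toLp, hζ.ae_ne_zero] with ξ h1 h2
    rw [profile, h1, ← mul_assoc, mul_comm (weight ζ (-1 / 2) ξ), weight_mul_weight_neg h2,
      one_mul]
  refine ⟨hmem.toLp _, (locallyIntegrable_congr hae).mpr hrep.1, fun φ => ?_⟩
  have hae2 : (fun ξ => g ξ * φ ξ) =ᵐ[volume] fun ξ => profile ζ (hmem.toLp _) ξ * φ ξ := by
    filter_upwards [hae] with ξ hξ
    rw [hξ]
  exact ⟨(hrep.2 φ).1.congr hae2, (hrep.2 φ).2.trans (integral_congr_ae hae2)⟩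

/-- The representing function of the element of `Ẋ^{1/2}_ζ` with profile `h`. -/
def reprFun (hζ : Admissible ζ) (h : L2 n) : E n → ℂ :=
  unGauss ((gaussOp hζ.gaussBounded_weight).adjoint h)

/-- The weak gradient of `reprFun`. -/
def reprGrad (hζ : Admissible ζ) (h : L2 n) (j : Fin n) : E n → ℂ :=
  fun x => -unGauss ((gaussOp (hζ.gaussBounded_gradWeight j)).adjoint h) x

lemma integral_reprFun_mul (hζ : Admissible ζ) (h : L2 n) (φ : 𝓢(E n, ℂ))
    (hφ : HasCompactSupport φ) :
    ∫ x, reprFun hζ h x * φ x = ∫ ξ, profile ζ h ξ * (𝓕⁻ φ) ξ := by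
  rw [reprFun, integral_unGauss_adjoint_mul _ h φ hφ]
  simp only [conj_weight, profile]

lemma isRepresentedBy_reprFun (hζ : Admissible ζ) {h : L2 n} {ψ : 𝓢'(E n, ℂ)}
    (hψ : HasFourierRep ψ (profile ζ h)) : IsRepresentedBy ψ (reprFun hζ h) := by
  refine ⟨locallyIntegrable_unGauss _, fun φ hφ => ?_⟩
  rw [integral_reprFun_mul hζ h φ hφ, ← (hψ.2 (𝓕⁻ φ)).2, FourierTransform.fourier_fourierInv_eq]

lemma hasCompactSupport_lineDerivOp {φ : 𝓢(E n, ℂ)} (hφ : HasCompactSupport φ) (m : E n) :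
    HasCompactSupport (∂_{m} φ : 𝓢(E n, ℂ)) :=
  hφ.mono' (subset_closure.trans (SchwartzMap.tsupport_lineDerivOp_subset m φ))

lemma hasWeakGradient_reprFun (hζ : Admissible ζ) (h : L2 n) :
    HasWeakGradient (reprFun hζ h) (reprGrad hζ h) := by
  refine ⟨locallyIntegrable_unGauss _, fun j => (locallyIntegrable_unGauss _).neg,
    fun φ hφ j => ?_⟩
  simp only [pd_eq_lineDerivOp, reprGrad, neg_mul, integral_neg, neg_neg]
  rw [integral_reprFun_mul hζ h _ (hasCompactSupport_lineDerivOp hφ _),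
    integral_unGauss_adjoint_mul _ h φ hφ, fourierInv_lineDerivOp]
  refine integral_congr_ae (Filter.Eventually.of_forall fun ξ => ?_)
  simp only [neg_apply, mulFreq_apply, gradWeight, map_mul, conj_weight, profile, Complex.conj_I,
    Complex.conj_ofReal, map_ofNat]
  ring

end Representation

/-! ### First-order perturbations of `Δ_ζ` on the Fourier side -/

section Perturbation

variable {n : ℕ}

/-- A bounded function supported in the closed ball of radius `ρ`. -/
structure BddCoeff (ρ N : ℝ) (a : E n → ℂ) : Prop where
  aesm : AEStronglyMeasurable a volume
  bound : ∀ᵐ x, ‖a x‖ ≤ N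
  supp : ∀ x, ρ < ‖x‖ → a x = 0

lemma BddCoeff.add {ρ N N' : ℝ} {a b : E n → ℂ} (ha : BddCoeff ρ N a) (hb : BddCoeff ρ N' b) :
    BddCoeff ρ (N + N') (fun x => a x + b x) := by
  refine ⟨ha.aesm.add hb.aesm, ?_, fun x hx => by rw [ha.supp x hx, hb.supp x hx, add_zero]⟩
  filter_upwards [ha.bound, hb.bound] with x h1 h2
  exact (norm_add_le _ _).trans (add_le_add h1 h2)

lemma BddCoeff.neg {ρ N : ℝ} {a : E n → ℂ} (ha : BddCoeff ρ N a) :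
    BddCoeff ρ N (fun x => -a x) :=
  ⟨ha.aesm.neg, ha.bound.mono fun _ hx => by rwa [norm_neg],
    fun x hx => by rw [ha.supp x hx, neg_zero]⟩

lemma BddCoeff.sum {ρ N : ℝ} {a : Fin n → E n → ℂ} (ha : ∀ j, BddCoeff ρ N (a j)) :
    BddCoeff ρ (n * N) (fun x => ∑ j, a j x) := by
  refine ⟨?_, ?_, fun x hx => Finset.sum_eq_zero fun j _ => (ha j).supp x hx⟩
  · exact Finset.aestronglyMeasurable_fun_sum _ fun j _ => (ha j).aesm
  · filter_upwards [ae_all_iff.mpr fun j => (ha j).bound] with x hx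
    refine (norm_sum_le _ _).trans ((Finset.sum_le_sum fun j _ => hx j).trans (le_of_eq ?_))
    simp

lemma BddCoeff.nonneg {ρ N : ℝ} {a : E n → ℂ} (ha : BddCoeff ρ N a) : 0 ≤ N := by
  obtain ⟨x, hx⟩ := ha.bound.exists
  exact (norm_nonneg _).trans hx

lemma norm_gaussian_inv_le {ρ : ℝ} {x : E n} (hx : ‖x‖ ≤ ρ) :
    ‖(gaussian x)⁻¹‖ ≤ Real.exp (Real.pi * ρ ^ 2) := by
  rw [norm_inv, norm_gaussian, ← Real.exp_neg, Real.exp_le_exp]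
  have : ‖x‖ ^ 2 ≤ ρ ^ 2 := by gcongr
  nlinarith [Real.pi_pos]

lemma BddCoeff.gaussian_inv_mul {ρ N : ℝ} {a : E n → ℂ} (ha : BddCoeff ρ N a) :
    BddCoeff ρ (Real.exp (Real.pi * ρ ^ 2) * N) (fun x => (gaussian x)⁻¹ * a x) := by
  refine ⟨continuous_gaussian_inv.aestronglyMeasurable.mul ha.aesm, ?_,
    fun x hx => by rw [ha.supp x hx, mul_zero]⟩
  filter_upwards [ha.bound] with x hx
  rcases le_or_gt ‖x‖ ρ with h | h
  · rw [norm_mul]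
    gcongr
    exact norm_gaussian_inv_le h
  · rw [ha.supp x h, mul_zero, norm_zero]
    exact mul_nonneg (Real.exp_pos _).le ha.nonneg

lemma BddCoeff.memLp {ρ N : ℝ} {a : E n → ℂ} (ha : BddCoeff ρ N a) (p : ℝ≥0∞) :
    MemLp a p volume := by
  have h1 : MemLp a p (volume.restrict (Metric.closedBall (0 : E n) ρ)) := by
    have : IsFiniteMeasure (volume.restrict (Metric.closedBall (0 : E n) ρ)) :=
      ⟨by rw [Measure.restrict_apply_univ]; exact measure_closedBall_lt_top⟩
    exact MemLp.of_bound ha.aesm.restrict N (ae_restrict_of_ae ha.bound)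
  rw [← memLp_indicator_iff_restrict measurableSet_closedBall] at h1
  convert h1 using 1
  refine (Set.indicator_eq_self.mpr fun x hx => ?_).symm
  by_contra hc
  exact hx (ha.supp x (by simpa using hc))

lemma BddCoeff.integrable_mul {ρ N : ℝ} {a f : E n → ℂ} (ha : BddCoeff ρ N a)
    (hf : LocallyIntegrable f) : Integrable fun x => a x * f x := by
  have h1 : IntegrableOn (fun x => a x * f x) (Metric.closedBall (0 : E n) ρ) := by
    refine Integrable.bdd_mul (hf.integrableOn_isCompact (isCompact_closedBall _ _))
      ha.aesm.restrict (c := N) (ae_restrict_of_ae ha.bound)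
  refine (integrableOn_iff_integrable_of_support_subset fun x hx => ?_).mp h1
  by_contra hc
  exact Function.mem_support.mp hx (by rw [ha.supp x (by simpa using hc), zero_mul])

/-- The bounded operator `f ↦ e^{2π|x|²} a f` on `L²`, for a compactly supported bounded `a`. -/
def mulCoeff (a : E n → ℂ) : L2 n →L[ℂ] L2 n :=
  open Classical in
  if h : MemLp (fun x => (gaussian x)⁻¹ * ((gaussian x)⁻¹ * a x)) ∞ volume then mulL2 h else 0

lemma BddCoeff.coeFn_mulCoeff {ρ N : ℝ} {a : E n → ℂ} (ha : BddCoeff ρ N a) (f : L2 n) :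
    mulCoeff a f =ᵐ[volume] fun x => (gaussian x)⁻¹ * ((gaussian x)⁻¹ * a x) * f x := by
  have h := ha.gaussian_inv_mul.gaussian_inv_mul.memLp ∞
  rw [mulCoeff, dif_pos h]
  exact coeFn_mulL2 h f

lemma BddCoeff.norm_mulCoeff_le {ρ N : ℝ} {a : E n → ℂ} (ha : BddCoeff ρ N a) :
    ‖mulCoeff a‖ ≤ Real.exp (Real.pi * ρ ^ 2) * (Real.exp (Real.pi * ρ ^ 2) * N) := by
  have hb := ha.gaussian_inv_mul.gaussian_inv_mul
  refine ContinuousLinearMap.opNorm_le_bound _ hb.nonneg fun f => ?_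
  refine Lp.norm_le_mul_norm_of_ae_le_mul ?_
  filter_upwards [ha.coeFn_mulCoeff f, hb.bound] with x h1 h2
  rw [h1, norm_mul]
  gcongr

variable {ζ : EuclideanSpace ℂ (Fin n)}

/-- The operator `f ↦ |p_ζ|^{-1/2} 𝓕 (e^{-π|x|²} f)`. -/
abbrev opR (hζ : Admissible ζ) : L2 n →L[ℂ] L2 n := gaussOp hζ.gaussBounded_weight

/-- The operator `f ↦ 2 π i ξ_j |p_ζ|^{-1/2} 𝓕 (e^{-π|x|²} f)`. -/
abbrev opGradR (hζ : Admissible ζ) (j : Fin n) : L2 n →L[ℂ] L2 n :=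
  gaussOp (hζ.gaussBounded_gradWeight j)

/-- Against the vector attached to `φ`, the weights `|p_ζ|^{±1/2}` cancel and Plancherel leaves a
physical-space integral. The analogue with the gradient weight yields a derivative of `φ` with a
minus sign. -/
lemma inner_sqrtWeight_opR (hζ : Admissible ζ) (φ : 𝓢(E n, ℂ)) (g : L2 n) :
    inner ℂ (sqrtWeight ζ (𝓕 (conjS φ))) (opR hζ g) = ∫ x, gaussian x * g x * φ x := by
  rw [← ContinuousLinearMap.adjoint_inner_left, hζ.adjoint_weight_sqrtWeight,
    FourierTransform.fourierInv_fourier_eq, inner_L2]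
  refine integral_congr_ae ?_
  filter_upwards [coeFn_mulL2 memLp_gaussian_top ((conjS φ).toLp 2 volume),
    (conjS φ).coeFn_toLp 2 volume] with x h1 h2
  rw [h1, h2, map_mul, conj_gaussian, conjS_apply, Complex.conj_conj]
  ring

lemma inner_sqrtWeight_opGradR (hζ : Admissible ζ) (j : Fin n) (φ : 𝓢(E n, ℂ)) (g : L2 n) :
    inner ℂ (sqrtWeight ζ (𝓕 (conjS φ))) (opGradR hζ j g) =
      -∫ x, gaussian x * g x * pd j φ x := by
  rw [← ContinuousLinearMap.adjoint_inner_left, hζ.adjoint_gradWeight_sqrtWeight,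
    FourierTransform.fourierInv_fourier_eq, inner_neg_left, inner_L2, lineDerivOp_conjS]
  congr 1
  refine integral_congr_ae ?_
  filter_upwards [coeFn_mulL2 memLp_gaussian_top ((conjS (∂_{(e j : E n)} φ)).toLp 2 volume),
    (conjS (∂_{(e j : E n)} φ)).coeFn_toLp 2 volume] with x h1 h2
  rw [h1, h2, map_mul, conj_gaussian, conjS_apply, Complex.conj_conj, pd_eq_lineDerivOp]
  ring

/-- The integral `∫ a₀ f + ∑ ∫ A_j F_j`. -/
def form (a₀ : E n → ℂ) (A : Fin n → E n → ℂ) (f : E n → ℂ) (F : Fin n → E n → ℂ) : ℂ :=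
  (∫ x, a₀ x * f x) + ∑ j, ∫ x, A j x * F j x

/-- The operator on `L²` induced by the first-order form with coefficients `a₀`, `A`. -/
def opT (hζ : Admissible ζ) (a₀ : E n → ℂ) (A : Fin n → E n → ℂ) : L2 n →L[ℂ] L2 n :=
  opR hζ ∘L mulCoeff a₀ ∘L (opR hζ).adjoint -
    ∑ j, (opR hζ ∘L mulCoeff (A j) ∘L (opGradR hζ j).adjoint +
      opGradR hζ j ∘L mulCoeff (A j) ∘L (opR hζ).adjoint)

lemma BddCoeff.integral_gaussian_mulCoeff {ρ N : ℝ} {a : E n → ℂ} (ha : BddCoeff ρ N a)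
    (f : L2 n) (φ : E n → ℂ) :
    ∫ x, gaussian x * mulCoeff a f x * φ x = ∫ x, a x * (unGauss f x * φ x) := by
  refine integral_congr_ae ?_
  filter_upwards [ha.coeFn_mulCoeff f] with x hx
  rw [hx, unGauss]
  have := gaussian_ne_zero x
  field_simp

lemma locallyIntegrable_mul_continuous {u c : E n → ℂ} (hu : LocallyIntegrable u)
    (hc : Continuous c) : LocallyIntegrable fun x => u x * c x :=
  (hu.continuous_mul hc).congr (Filter.Eventually.of_forall fun _ => mul_comm _ _)

lemma continuous_pd (j : Fin n) (φ : 𝓢(E n, ℂ)) : Continuous (pd j φ) :=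
  (∂_{(e j : E n)} φ : 𝓢(E n, ℂ)).continuous

/-- The two summands for each `j` are the two terms of the product rule for `∂_j(uφ)`. The minus
sign in `opT` compensates `∂_j* = -∂_j`, which occurs once in each: in the adjoint giving `∂_j u`,
or in the pairing giving `∂_j φ`. The two inverse Gaussians in `mulCoeff` cancel the localisers on
either side. -/
lemma inner_opT (hζ : Admissible ζ) {ρ N N' : ℝ} {a₀ : E n → ℂ} {A : Fin n → E n → ℂ}
    (h0 : BddCoeff ρ N a₀) (hA : ∀ j, BddCoeff ρ N' (A j)) (φ : 𝓢(E n, ℂ)) (h : L2 n) :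
    inner ℂ (sqrtWeight ζ (𝓕 (conjS φ))) (opT hζ a₀ A h) =
      form a₀ A (fun x => reprFun hζ h x * φ x)
        (fun j x => reprGrad hζ h j x * φ x + reprFun hζ h x * pd j φ x) := by
  simp only [opT, sub_apply, sum_apply,
    add_apply, ContinuousLinearMap.comp_apply, inner_sub_right, inner_sum,
    inner_add_right, inner_sqrtWeight_opR, inner_sqrtWeight_opGradR,
    h0.integral_gaussian_mulCoeff, (hA _).integral_gaussian_mulCoeff]
  rw [form, sub_eq_add_neg, ← Finset.sum_neg_distrib]
  refine congrArg₂ (· + ·) rfl (Finset.sum_congr rfl fun j _ => ?_)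
  have i1 : Integrable fun x => A j x * (reprGrad hζ h j x * φ x) :=
    (hA j).integrable_mul
      (locallyIntegrable_mul_continuous (locallyIntegrable_unGauss _).neg φ.continuous)
  have i2 : Integrable fun x => A j x * (reprFun hζ h x * pd j φ x) :=
    (hA j).integrable_mul
      (locallyIntegrable_mul_continuous (locallyIntegrable_unGauss _) (continuous_pd j φ))
  simp only [mul_add]
  rw [integral_add i1 i2, neg_add, neg_neg, ← integral_neg]
  congr 1
  refine integral_congr_ae (Filter.Eventually.of_forall fun x => ?_)
  simp only [reprGrad]
  ring

/-- With `K = √(σ/|ζ|)` and `L = √(σ|ζ|)` bounding the two localised operators, a zeroth-order term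
costs `K² = σ/|ζ|`, while a first-order term costs `K L = σ`: only the zeroth-order part gains from
large `|ζ|`. -/
lemma norm_opT_le (hζ : Admissible ζ) {ρ N N' : ℝ} {a₀ : E n → ℂ} {A : Fin n → E n → ℂ}
    (h0 : BddCoeff ρ N a₀) (hA : ∀ j, BddCoeff ρ N' (A j)) :
    ‖opT hζ a₀ A‖ ≤ Real.exp (Real.pi * ρ ^ 2) ^ 2 * symbConst n *
      (N / ‖ζ‖ + 2 * n * N') := by
  have hσ := symbConst_pos n
  have hz : 0 < ‖ζ‖ := by linarith [hζ.large]
  set w := Real.exp (Real.pi * ρ ^ 2)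
  have hw : 0 < w := Real.exp_pos _
  have hN := h0.nonneg
  set K := √(symbConst n / ‖ζ‖) with hK
  set L := √(symbConst n * ‖ζ‖) with hL
  have hKK : K * K = symbConst n / ‖ζ‖ := Real.mul_self_sqrt (by positivity)
  have hKL : K * L = symbConst n := by
    rw [hK, hL, ← Real.sqrt_mul (by positivity), show symbConst n / ‖ζ‖ * (symbConst n * ‖ζ‖) =
      symbConst n ^ 2 by field_simp, Real.sqrt_sq hσ.le]
  have hK0 : 0 ≤ K := Real.sqrt_nonneg _
  have hL0 : 0 ≤ L := Real.sqrt_nonneg _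
  have comp3 : ∀ {P Q S : L2 n →L[ℂ] L2 n} {p q s : ℝ}, ‖P‖ ≤ p → ‖Q‖ ≤ q → ‖S‖ ≤ s →
      ‖P ∘L Q ∘L S‖ ≤ p * (q * s) := by
    intro P Q S p q s hp hq hs
    refine (ContinuousLinearMap.opNorm_comp_le _ _).trans ?_
    refine mul_le_mul hp ((ContinuousLinearMap.opNorm_comp_le _ _).trans ?_) (norm_nonneg _)
      ((norm_nonneg _).trans hp)
    exact mul_le_mul hq hs (norm_nonneg _) ((norm_nonneg _).trans hq)
  have hR : ‖opR hζ‖ ≤ K := norm_gaussOp_le _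
  have hRa : ‖(opR hζ).adjoint‖ ≤ K := by rwa [LinearIsometryEquiv.norm_map]
  have hG : ∀ j, ‖opGradR hζ j‖ ≤ L := fun j => norm_gaussOp_le _
  have hGa : ∀ j, ‖(opGradR hζ j).adjoint‖ ≤ L := fun j => by
    rw [LinearIsometryEquiv.norm_map]; exact hG j
  have t1 := comp3 hR h0.norm_mulCoeff_le hRa
  have t2 : ∀ j, ‖opR hζ ∘L mulCoeff (A j) ∘L (opGradR hζ j).adjoint +
      opGradR hζ j ∘L mulCoeff (A j) ∘L (opR hζ).adjoint‖ ≤ 2 * (w ^ 2 * symbConst n * N') := by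
    intro j
    refine (norm_add_le _ _).trans ((add_le_add (comp3 hR (hA j).norm_mulCoeff_le (hGa j))
      (comp3 (hG j) (hA j).norm_mulCoeff_le hRa)).trans (le_of_eq ?_))
    rw [← hKL]
    ring
  refine (norm_sub_le _ _).trans ((add_le_add t1 ((norm_sum_le _ _).trans
    (Finset.sum_le_sum fun j _ => t2 j))).trans (le_of_eq ?_))
  rw [Finset.sum_const, Finset.card_univ, Fintype.card_fin, nsmul_eq_mul]
  have : K * (w * (w * N) * K) = w ^ 2 * N * (K * K) := by ring
  rw [this, hKK]
  ring

/-- Smooth parts of the vector field `A` can be moved to the zeroth-order coefficient. -/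
lemma opT_eq_of_smooth (hζ : Admissible ζ) {ρ N N' N₁ N₂ : ℝ} {a₀ : E n → ℂ}
    {A : Fin n → E n → ℂ} (h0 : BddCoeff ρ N a₀) (hA : ∀ j, BddCoeff ρ N' (A j))
    (S : Fin n → 𝓢(E n, ℂ)) (hS : ∀ j, BddCoeff ρ N₁ (S j))
    (hdS : ∀ j, BddCoeff ρ N₂ (pd j (S j))) :
    opT hζ a₀ A = opT hζ (fun x => a₀ x + -∑ j, pd j (S j) x)
      (fun j x => A j x + -S j x) := by
  have h0' := h0.add (BddCoeff.sum hdS).neg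
  have hA' := fun j => (hA j).add (hS j).neg
  ext1 h
  refine hζ.dense_sqrtWeight_image.eq_of_inner_right (𝕜 := ℂ) ?_
  rintro _ ⟨θ, hθ, rfl⟩
  obtain ⟨φ, rfl, hφ⟩ : ∃ φ : 𝓢(E n, ℂ), θ = 𝓕 (conjS φ) ∧ HasCompactSupport φ :=
    ⟨conjS (𝓕⁻ θ), by rw [conjS_conjS, FourierTransform.fourier_fourierInv_eq],
      hasCompactSupport_conjS hθ⟩
  rw [inner_opT hζ h0 hA, inner_opT hζ h0' hA']
  set u := reprFun hζ h
  set w := reprGrad hζ h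
  have hgrad := hasWeakGradient_reprFun hζ h
  have hu : LocallyIntegrable u := hgrad.1
  have hw : ∀ j, LocallyIntegrable (w j) := hgrad.2.1
  have huφ := locallyIntegrable_mul_continuous hu φ.continuous
  have hF : ∀ j, LocallyIntegrable fun x => w j x * φ x + u x * pd j φ x := fun j =>
    (locallyIntegrable_mul_continuous (hw j) φ.continuous).add
      (locallyIntegrable_mul_continuous hu (continuous_pd j φ))
  -- Integration by parts: the weak gradient of `u` is tested against `S_j φ`, which is again a
  -- compactly supported Schwartz function.
  have key : ∀ j, ∫ x, S j x * (w j x * φ x + u x * pd j φ x) =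
      -∫ x, pd j (S j) x * (u x * φ x) := by
    intro j
    set χ : 𝓢(E n, ℂ) := SchwartzMap.smulLeftCLM ℂ (S j) φ with hχ
    have hχa : ∀ x, χ x = S j x * φ x := fun x => by
      rw [hχ, SchwartzMap.smulLeftCLM_apply_apply (S j).hasTemperateGrowth, smul_eq_mul]
    have hχf : (χ : E n → ℂ) = fun x => S j x * φ x := funext hχa
    have hχc : HasCompactSupport χ := by rw [hχf]; exact hφ.mul_left
    have hpd : ∀ x, pd j χ x = pd j (S j) x * φ x + S j x * pd j φ x := by
      intro x
      rw [hχf, pd, pd, pd, fderiv_fun_mul (S j).differentiableAt φ.differentiableAt]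
      simp only [add_apply, smul_apply, smul_eq_mul]
      ring
    have hd := hgrad.2.2 χ hχc j
    have i1 : Integrable fun x => pd j (S j) x * (u x * φ x) := (hdS j).integrable_mul huφ
    have i2 : Integrable fun x => S j x * (u x * pd j φ x) :=
      (hS j).integrable_mul (locallyIntegrable_mul_continuous hu (continuous_pd j φ))
    have i3 : Integrable fun x => S j x * (w j x * φ x) :=
      (hS j).integrable_mul (locallyIntegrable_mul_continuous (hw j) φ.continuous)
    have e1 : ∫ x, u x * pd j χ x =
        (∫ x, pd j (S j) x * (u x * φ x)) + ∫ x, S j x * (u x * pd j φ x) := by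
      rw [← integral_add i1 i2]
      refine integral_congr_ae (Filter.Eventually.of_forall fun x => ?_)
      simp only [hpd]; ring
    have e2 : ∫ x, w j x * χ x = ∫ x, S j x * (w j x * φ x) := by
      refine integral_congr_ae (Filter.Eventually.of_forall fun x => ?_)
      simp only [hχa]; ring
    simp only [mul_add]
    rw [integral_add i3 i2, ← e2]
    change ∫ x, u x * pd j χ x = -∫ x, w j x * χ x at hd
    rw [e1] at hd
    linear_combination hd
  have e0 : ∫ x, (a₀ x + -∑ j, pd j (S j) x) * (u x * φ x) =
      (∫ x, a₀ x * (u x * φ x)) + ∑ j, -∫ x, pd j (S j) x * (u x * φ x) := by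
    have i : ∀ j ∈ Finset.univ, Integrable fun x => pd j (S j) x * (u x * φ x) :=
      fun j _ => (hdS j).integrable_mul huφ
    have i' : Integrable fun x => -∑ j, pd j (S j) x * (u x * φ x) :=
      (integrable_finsetSum _ i).neg
    rw [Finset.sum_neg_distrib, ← integral_finsetSum _ i, ← integral_neg,
      ← integral_add (h0.integrable_mul huφ) i']
    refine integral_congr_ae (Filter.Eventually.of_forall fun x => ?_)
    simp only [add_mul, neg_mul, Finset.sum_mul]
  have e1 : ∀ j, ∫ x, (A j x + -S j x) * (w j x * φ x + u x * pd j φ x) =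
      (∫ x, A j x * (w j x * φ x + u x * pd j φ x)) +
        ∫ x, pd j (S j) x * (u x * φ x) := by
    intro j
    have i' : Integrable fun x => -(S j x * (w j x * φ x + u x * pd j φ x)) :=
      ((hS j).integrable_mul (hF j)).neg
    rw [← neg_eq_iff_eq_neg.mpr (key j), ← integral_neg,
      ← integral_add ((hA j).integrable_mul (hF j)) i']
    refine integral_congr_ae (Filter.Eventually.of_forall fun x => ?_)
    simp only [add_mul, neg_mul]
  simp only [form]
  rw [e0]
  simp only [e1, Finset.sum_add_distrib, Finset.sum_neg_distrib]
  ring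

end Perturbation

/-! ### Solvability of perturbations of a unitary operator -/

section Neumann

variable {H : Type*} [NormedAddCommGroup H] [NormedSpace ℂ H]

lemma norm_le_two_mul_of_small_perturbation {U V T : H →L[ℂ] H} (hVU : V ∘L U = 1) (hV : ‖V‖ ≤ 1)
    (hT : ‖T‖ ≤ 1 / 2) {h q : H} (hh : U h + T h = q) : ‖h‖ ≤ 2 * ‖q‖ := by
  have h1 : h = V q - V (T h) := by
    have := DFunLike.congr_fun hVU h
    rw [← hh, map_add, add_sub_cancel_right]
    exact this.symm
  have h2 : ‖V q‖ ≤ ‖q‖ := (V.le_of_opNorm_le hV q).trans_eq (one_mul _)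
  have h3 : ‖V (T h)‖ ≤ 1 / 2 * ‖h‖ :=
    ((V.le_of_opNorm_le hV _).trans_eq (one_mul _)).trans (T.le_of_opNorm_le hT h)
  have h4 : ‖h‖ ≤ ‖V q‖ + ‖V (T h)‖ := by
    conv_lhs => rw [h1]
    exact norm_sub_le _ _
  linarith

/-- The solution is `(1 + V T)⁻¹ V q`, the inverse being a Neumann series since `‖V T‖ ≤ 1/2`. -/
lemma exists_of_small_perturbation [CompleteSpace H] {U V T : H →L[ℂ] H} (hUV : U ∘L V = 1) (hV : ‖V‖ ≤ 1)
    (hT : ‖T‖ ≤ 1 / 2) (q : H) : ∃ h, U h + T h = q := by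
  have hlt : ‖-(V ∘L T)‖ < 1 := by
    rw [norm_neg]
    refine (ContinuousLinearMap.opNorm_comp_le _ _).trans_lt ?_
    nlinarith [norm_nonneg V, norm_nonneg T]
  obtain ⟨W, hW⟩ := isUnit_one_sub_of_norm_lt_one hlt
  refine ⟨(↑W⁻¹ : H →L[ℂ] H) (V q), ?_⟩
  have h1 : ((W : H →L[ℂ] H) * (↑W⁻¹ : H →L[ℂ] H)) (V q) = V q := by
    rw [Units.mul_inv]; rfl
  rw [hW] at h1
  set h := (↑W⁻¹ : H →L[ℂ] H) (V q)
  have h2 : h + V (T h) = V q := by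
    rw [← h1]
    simp [h]
  have hU : ∀ y, U (V y) = y := fun y => DFunLike.congr_fun hUV y
  have h3 := congrArg U h2
  rw [map_add, hU, hU] at h3
  exact h3

end Neumann

section Solver

variable {n : ℕ} {ζ : EuclideanSpace ℂ (Fin n)}

/-! ### The sources `Q` on the Fourier side -/

lemma BddCoeff.memLp_source {ρ N : ℝ} {a : E n → ℂ} (ha : BddCoeff ρ N a) :
    MemLp (fun x => (gaussian x)⁻¹ * a x) 2 volume :=
  ha.gaussian_inv_mul.memLp 2

lemma BddCoeff.integral_gaussian_source {ρ N : ℝ} {a : E n → ℂ} (ha : BddCoeff ρ N a)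
    (φ : E n → ℂ) :
    ∫ x, gaussian x * ha.memLp_source.toLp _ x * φ x = ∫ x, a x * φ x := by
  refine integral_congr_ae ?_
  filter_upwards [ha.memLp_source.coeFn_toLp] with x hx
  rw [hx, mul_inv_cancel_left₀ (gaussian_ne_zero x)]

/-- The profile of `Q` comes from applying the same localised operators to the coefficients
themselves, which are in `L²` even after division by the Gaussian because of their compact support.
-/
lemma exists_source (hζ : Admissible ζ) {ρ N N' : ℝ} {a₀ : E n → ℂ} {A : Fin n → E n → ℂ}
    (h0 : BddCoeff ρ N a₀) (hA : ∀ j, BddCoeff ρ N' (A j)) :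
    ∃ q : L2 n, ∀ φ : 𝓢(E n, ℂ), inner ℂ (sqrtWeight ζ (𝓕 (conjS φ))) q =
      form a₀ A φ (fun j => pd j φ) := by
  refine ⟨opR hζ (h0.memLp_source.toLp _) -
    ∑ j, opGradR hζ j ((hA j).memLp_source.toLp _), fun φ => ?_⟩
  simp only [inner_sub_right, inner_sum, inner_sqrtWeight_opR, inner_sqrtWeight_opGradR,
    h0.integral_gaussian_source, (hA _).integral_gaussian_source, Finset.sum_neg_distrib,
    sub_neg_eq_add]
  rfl

lemma hasFourierRep_of_inner {T : 𝓢(E n, ℂ) → ℂ} {q : L2 n}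
    (hT : ∀ φ : 𝓢(E n, ℂ), inner ℂ (sqrtWeight ζ (𝓕 (conjS φ))) q = T φ) :
    HasFourierRep T (fun ξ => weight ζ (1 / 2) ξ * q ξ) := by
  refine ⟨(L2.locallyIntegrable q).continuous_mul (continuous_weight (by norm_num)),
    fun φ => ?_⟩
  have hae : (fun ξ => (starRingEnd ℂ) (sqrtWeight ζ (conjS φ) ξ) * q ξ) =ᵐ[volume]
      fun ξ => weight ζ (1 / 2) ξ * q ξ * φ ξ := by
    filter_upwards [coeFn_sqrtWeight (ζ := ζ) (conjS φ)] with ξ hξ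
    rw [hξ, map_mul, conj_weight, conjS_apply, Complex.conj_conj]
    ring
  constructor
  · refine Integrable.congr ?_ hae
    have := L2.integrable_inner (𝕜 := ℂ) (sqrtWeight ζ (conjS φ)) q
    refine this.congr (Filter.Eventually.of_forall fun ξ => ?_)
    simp [RCLike.inner_apply, mul_comm]
  · rw [← hT, fourier_conjS, FourierTransform.fourierInv_fourier_eq, inner_L2]
    exact integral_congr_ae hae

lemma Admissible.xNorm_neg_half (hζ : Admissible ζ) {T : 𝓢(E n, ℂ) → ℂ} {q : L2 n}
    (hT : HasFourierRep T (fun ξ => weight ζ (1 / 2) ξ * q ξ)) :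
    xNorm ζ (-1 / 2) T = ENNReal.ofReal ‖q‖ := by
  rw [xNorm_eq_of_hasFourierRep hT, ofReal_norm, Lp.enorm_def]
  refine eLpNorm_congr_ae ?_
  filter_upwards [hζ.ae_ne_zero] with ξ hξ
  rw [← mul_assoc, mul_comm (weight ζ (-1 / 2) ξ), weight_mul_weight_neg hξ, one_mul]

/-! ### The operator `Δ_ζ` on the Fourier side -/

variable (ζ) in
/-- The phase `p_ζ / |p_ζ|`. -/
def phase (ξ : E n) : ℂ := freqSymb ζ ξ / (‖freqSymb ζ ξ‖ : ℂ)

lemma norm_phase_le (ξ : E n) : ‖phase ζ ξ‖ ≤ 1 := by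
  rw [phase, norm_div, Complex.norm_real, norm_norm]
  exact div_self_le_one _

lemma measurable_phase : Measurable (phase ζ) := by
  have := (continuous_freqSymb ζ).measurable
  unfold phase; fun_prop

lemma memLp_phase : MemLp (phase ζ) ∞ volume :=
  memLp_top_of_bound measurable_phase.aestronglyMeasurable 1
    (Filter.Eventually.of_forall norm_phase_le)

lemma memLp_conj_phase : MemLp (fun ξ => (starRingEnd ℂ) (phase ζ ξ)) ∞ volume :=
  memLp_top_of_bound (Complex.continuous_conj.measurable.comp
    measurable_phase).aestronglyMeasurable 1
    (Filter.Eventually.of_forall fun ξ => by rw [RCLike.norm_conj]; exact norm_phase_le ξ)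

lemma conj_phase_mul {ξ : E n} (h : freqSymb ζ ξ ≠ 0) :
    (starRingEnd ℂ) (phase ζ ξ) * phase ζ ξ = 1 := by
  rw [← Complex.normSq_eq_conj_mul_self, Complex.normSq_eq_norm_sq, phase, norm_div,
    Complex.norm_real, norm_norm, div_self (norm_ne_zero_iff.mpr h)]
  norm_num

lemma norm_mulL2_le {m : E n → ℂ} (hm : MemLp m ∞ volume) {c : ℝ} (hc : 0 ≤ c)
    (h : ∀ x, ‖m x‖ ≤ c) : ‖mulL2 hm‖ ≤ c := by
  refine ContinuousLinearMap.opNorm_le_bound _ hc fun f => ?_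
  refine Lp.norm_le_mul_norm_of_ae_le_mul ?_
  filter_upwards [coeFn_mulL2 hm f] with x hx
  rw [hx, norm_mul]
  gcongr
  exact h x

lemma mulL2_comp_mulL2_eq_one {m m' : E n → ℂ} (hm : MemLp m ∞ volume) (hm' : MemLp m' ∞ volume)
    (h : ∀ᵐ x, m x * m' x = 1) : mulL2 hm ∘L mulL2 hm' = 1 := by
  ext1 f
  refine Lp.ext ?_
  filter_upwards [coeFn_mulL2 hm (mulL2 hm' f), coeFn_mulL2 hm' f, h] with x h1 h2 h3
  change mulL2 hm (mulL2 hm' f) x = f x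
  rw [h1, h2, ← mul_assoc, h3, one_mul]

lemma fourierInv_laplacian_apply (φ : 𝓢(E n, ℂ)) (ξ : E n) :
    (𝓕⁻ (Δ φ)) ξ = -((‖(2 * Real.pi) • ξ‖ ^ 2 : ℝ) : ℂ) * (𝓕⁻ φ) ξ := by
  have hb : ∀ i, EuclideanSpace.basisFun (Fin n) ℝ i = e i := fun i => by
    simp [e, EuclideanSpace.basisFun_apply]
  rw [SchwartzMap.laplacian_eq_sum (EuclideanSpace.basisFun (Fin n) ℝ)]
  have hs : (𝓕⁻ (∑ i, ∂_{(e i : E n)} (∂_{(e i : E n)} φ)) : 𝓢(E n, ℂ)) =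
      ∑ i, 𝓕⁻ (∂_{(e i : E n)} (∂_{(e i : E n)} φ)) :=
    map_sum (FourierTransform.fourierInvCLM ℂ 𝓢(E n, ℂ)) _ _
  simp only [hb]
  rw [hs]
  simp only [fourierInv_lineDerivOp, sum_apply, neg_apply, mulFreq_apply]
  rw [norm_smul, mul_pow, EuclideanSpace.norm_sq_eq, Real.norm_of_nonneg (by positivity)]
  push_cast
  rw [Finset.mul_sum, ← Finset.sum_neg_distrib, Finset.sum_mul]
  refine Finset.sum_congr rfl fun j _ => ?_
  have hI := Complex.I_sq
  have hx : ((‖ξ j‖ : ℝ) : ℂ) ^ 2 = (ξ j : ℂ) ^ 2 := by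
    rw [← Complex.ofReal_pow, Real.norm_eq_abs, sq_abs, Complex.ofReal_pow]
  rw [hx]
  linear_combination (4 * Real.pi ^ 2 * (ξ j : ℂ) ^ 2 * (𝓕⁻ φ) ξ) * hI

lemma lapZeta_apply (ψ : 𝓢'(E n, ℂ)) (φ : 𝓢(E n, ℂ)) :
    lapZeta ζ ψ φ = ψ (Δ φ - (2 : ℂ) • ∑ j, ζ j • ∂_{(e j : E n)} φ) := by
  have h : ∀ j, (ζ j • ∂_{(e j : E n)} ψ) φ = -(ζ j * ψ (∂_{(e j : E n)} φ)) := fun j => by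
    change ζ j • (∂_{(e j : E n)} ψ) φ = _
    rw [TemperedDistribution.lineDerivOp_apply_apply, map_neg, smul_eq_mul, mul_neg]
  have h2 : lapZeta ζ ψ φ = (Δ ψ) φ + (2 : ℂ) • ∑ j, (ζ j • ∂_{(e j : E n)} ψ) φ := by
    rw [lapZeta]
    change (Δ ψ) φ + (2 : ℂ) • (∑ j, ζ j • ∂_{(e j : E n)} ψ) φ = _
    congr 2
    exact sum_apply _ _ _
  rw [h2, TemperedDistribution.laplacian_apply_apply]
  simp only [h]
  rw [map_sub, map_smul, map_sum]
  simp only [map_smul, smul_eq_mul, Finset.sum_neg_distrib]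
  ring

/-- On the Fourier side `Δ_ζ` multiplies by `p_ζ`, and `p_ζ |p_ζ|^{-1/2} = |p_ζ|^{1/2} (p_ζ/|p_ζ|)`:
between profiles only the phase remains. -/
lemma lapZeta_eq_inner (hζ : Admissible ζ) {ψ : 𝓢'(E n, ℂ)} {h : L2 n}
    (hψ : HasFourierRep ψ (profile ζ h)) (φ : 𝓢(E n, ℂ)) :
    lapZeta ζ ψ φ =
      inner ℂ (sqrtWeight ζ (𝓕 (conjS φ))) (mulL2 (memLp_phase (ζ := ζ)) h) := by
  set χ : 𝓢(E n, ℂ) := Δ φ - (2 : ℂ) • ∑ j, ζ j • ∂_{(e j : E n)} φ with hχ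
  have hχF : ∀ ξ, (𝓕⁻ χ) ξ = freqSymb ζ ξ * (𝓕⁻ φ) ξ := by
    intro ξ
    have h1 : (𝓕⁻ χ : 𝓢(E n, ℂ)) =
        𝓕⁻ (Δ φ) - (2 : ℂ) • ∑ j, ζ j • 𝓕⁻ (∂_{(e j : E n)} φ) := by
      rw [← FourierTransform.fourierInvCLM_apply (R := ℂ) χ, hχ, map_sub, map_smul, map_sum]
      simp only [map_smul, FourierTransform.fourierInvCLM_apply]
    rw [h1]
    simp only [sub_apply, smul_apply, sum_apply, fourierInv_lineDerivOp, neg_apply, mulFreq_apply,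
      fourierInv_laplacian_apply, freqSymb, symb, cdot, PiLp.smul_apply, smul_eq_mul]
    rw [add_mul, sub_eq_add_neg, Finset.mul_sum, Finset.mul_sum, Finset.sum_mul,
      ← Finset.sum_neg_distrib]
    congr 1
    refine Finset.sum_congr rfl fun j _ => ?_
    push_cast
    ring
  have h2 : ψ χ = ∫ ξ, profile ζ h ξ * (𝓕⁻ χ) ξ := by
    rw [← (hψ.2 (𝓕⁻ χ)).2, FourierTransform.fourier_fourierInv_eq]
  rw [lapZeta_apply, ← hχ, h2, inner_L2]
  refine integral_congr_ae ?_
  filter_upwards [coeFn_sqrtWeight (ζ := ζ) (𝓕 (conjS φ)), coeFn_mulL2 (memLp_phase (ζ := ζ)) h,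
    hζ.ae_ne_zero] with ξ h1 h2 h3
  rw [h1, h2, hχF, map_mul, conj_weight, fourier_conjS, conjS_apply, Complex.conj_conj, profile,
    phase]
  have h4 := weight_mul_weight_neg h3
  have h5 : weight ζ (1 / 2) ξ * weight ζ (1 / 2) ξ = (‖freqSymb ζ ξ‖ : ℂ) := by
    rw [weight, ← Complex.ofReal_mul, ← Real.rpow_add (norm_pos_iff.mpr h3)]
    norm_num
  have h6 : (‖freqSymb ζ ξ‖ : ℂ) ≠ 0 := by exact_mod_cast norm_ne_zero_iff.mpr h3
  generalize weight ζ (1 / 2) ξ = b at h4 h5 ⊢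
  generalize weight ζ (-1 / 2) ξ = a at h4 ⊢
  field_simp
  rw [← h5]
  linear_combination (h ξ * (𝓕⁻ φ) ξ * b) * h4

/-! ### The remainder equation -/

lemma form_congr_ae {a₀ : E n → ℂ} {A : Fin n → E n → ℂ} {f f' : E n → ℂ}
    {F F' : Fin n → E n → ℂ} (hf : f =ᵐ[volume] f') (hF : ∀ j, F j =ᵐ[volume] F' j) :
    form a₀ A f F = form a₀ A f' F' := by
  unfold form
  congr 1
  · refine integral_congr_ae ?_
    filter_upwards [hf] with x hx
    rw [hx]
  · refine Finset.sum_congr rfl fun j _ => integral_congr_ae ?_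
    filter_upwards [hF j] with x hx
    rw [hx]

lemma IsRepresentedBy.ae_eq {ψ : 𝓢'(E n, ℂ)} {u u' : E n → ℂ} (h : IsRepresentedBy ψ u)
    (h' : IsRepresentedBy ψ u') : u =ᵐ[volume] u' :=
  ae_eq_of_integral_schwartz_eq h.1 h'.1 fun φ hφ => by rw [← h.2 φ hφ, h'.2 φ hφ]

lemma HasWeakGradient.ae_eq {u u' : E n → ℂ} {w w' : Fin n → E n → ℂ} (h : HasWeakGradient u w)
    (h' : HasWeakGradient u' w') (huu : u =ᵐ[volume] u') (j : Fin n) : w j =ᵐ[volume] w' j := by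
  refine ae_eq_of_integral_schwartz_eq (h.2.1 j) (h'.2.1 j) fun φ hφ => ?_
  have h1 : ∫ x, u x * pd j φ x = ∫ x, u' x * pd j φ x := by
    refine integral_congr_ae ?_
    filter_upwards [huu] with x hx
    rw [hx]
  rw [h.2.2 φ hφ j, h'.2.2 φ hφ j] at h1
  exact neg_injective h1

/-- `Δ_ζ ψ + m ψ = -q`, where `m` and `q` are given by the form with coefficients `a₀`, `A`. -/
def SolvesFormEq (ζ : EuclideanSpace ℂ (Fin n)) (a₀ : E n → ℂ) (A : Fin n → E n → ℂ)
    (ψ : 𝓢'(E n, ℂ)) (u : E n → ℂ) (w : Fin n → E n → ℂ) : Prop :=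
  ∀ φ : 𝓢(E n, ℂ), HasCompactSupport φ →
    lapZeta ζ ψ φ + form a₀ A (fun x => u x * φ x)
      (fun j x => w j x * φ x + u x * pd j φ x) = -form a₀ A φ (fun j => pd j φ)

/-- Each term of the weak equation is an inner product with the vector attached to `φ`. These
vectors are dense, so the weak equation is one equation in `L²`. -/
lemma solvesFormEq_iff (hζ : Admissible ζ) {ρ N N' : ℝ} {a₀ : E n → ℂ} {A : Fin n → E n → ℂ}
    (h0 : BddCoeff ρ N a₀) (hA : ∀ j, BddCoeff ρ N' (A j)) {q : L2 n}
    (hq : ∀ φ : 𝓢(E n, ℂ), inner ℂ (sqrtWeight ζ (𝓕 (conjS φ))) q =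
      form a₀ A φ (fun j => pd j φ))
    {ψ : 𝓢'(E n, ℂ)} {h : L2 n} (hψ : HasFourierRep ψ (profile ζ h)) :
    SolvesFormEq ζ a₀ A ψ (reprFun hζ h) (reprGrad hζ h) ↔
      mulL2 (memLp_phase (ζ := ζ)) h + opT hζ a₀ A h = -q := by
  have key : ∀ φ : 𝓢(E n, ℂ), (lapZeta ζ ψ φ + form a₀ A (fun x => reprFun hζ h x * φ x)
      (fun j x => reprGrad hζ h j x * φ x + reprFun hζ h x * pd j φ x) =
        -form a₀ A φ (fun j => pd j φ)) ↔
      inner ℂ (sqrtWeight ζ (𝓕 (conjS φ))) (mulL2 (memLp_phase (ζ := ζ)) h + opT hζ a₀ A h) =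
        inner ℂ (sqrtWeight ζ (𝓕 (conjS φ))) (-q) := fun φ => by
    rw [inner_add_right, inner_opT hζ h0 hA, ← lapZeta_eq_inner hζ hψ, inner_neg_right, hq]
  constructor
  · intro hs
    refine hζ.dense_sqrtWeight_image.eq_of_inner_right (𝕜 := ℂ) ?_
    rintro _ ⟨θ, hθ, rfl⟩
    have := (key (conjS (𝓕⁻ θ))).mp (hs _ (hasCompactSupport_conjS hθ))
    rwa [conjS_conjS, FourierTransform.fourier_fourierInv_eq] at this
  · intro hs φ _
    exact (key φ).mpr (by rw [hs])

/-- For uniqueness, a competitor may come with its own representative and weak gradient; these agree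
almost everywhere with the ones built from its profile, so the operator equation applies to it. -/
theorem exists_unique_solvesFormEq (hζ : Admissible ζ) {ρ N N' : ℝ} {a₀ : E n → ℂ}
    {A : Fin n → E n → ℂ} (h0 : BddCoeff ρ N a₀) (hA : ∀ j, BddCoeff ρ N' (A j))
    (hT : ‖opT hζ a₀ A‖ ≤ 1 / 2) :
    MemX ζ (-1 / 2) (fun φ => form a₀ A φ (fun j => pd j φ)) ∧
    ∃ (ψ : 𝓢'(E n, ℂ)) (u : E n → ℂ) (w : Fin n → E n → ℂ),
      MemX ζ (1 / 2) ψ ∧ IsRepresentedBy ψ u ∧ HasWeakGradient u w ∧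
      MemL2loc u ∧ (∀ j, MemL2loc (w j)) ∧ SolvesFormEq ζ a₀ A ψ u w ∧
      (∀ (ψ' : 𝓢'(E n, ℂ)) (u' : E n → ℂ) (w' : Fin n → E n → ℂ), MemX ζ (1 / 2) ψ' →
        IsRepresentedBy ψ' u' → HasWeakGradient u' w' → SolvesFormEq ζ a₀ A ψ' u' w' → ψ' = ψ) ∧
      xNorm ζ (1 / 2) ψ ≤
        ENNReal.ofReal 2 * xNorm ζ (-1 / 2) (fun φ => form a₀ A φ (fun j => pd j φ)) := by
  obtain ⟨q, hq⟩ := exists_source hζ h0 hA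
  have hqn := hζ.xNorm_neg_half (hasFourierRep_of_inner hq)
  set U := mulL2 (memLp_phase (ζ := ζ))
  set V := mulL2 (memLp_conj_phase (ζ := ζ))
  have hVU : V ∘L U = 1 := mulL2_comp_mulL2_eq_one _ _
    (hζ.ae_ne_zero.mono fun ξ hξ => conj_phase_mul hξ)
  have hUV : U ∘L V = 1 := mulL2_comp_mulL2_eq_one _ _
    (hζ.ae_ne_zero.mono fun ξ hξ => by rw [mul_comm]; exact conj_phase_mul hξ)
  have hV : ‖V‖ ≤ 1 := norm_mulL2_le _ zero_le_one fun ξ => by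
    rw [RCLike.norm_conj]; exact norm_phase_le ξ
  obtain ⟨h, hh⟩ := exists_of_small_perturbation hUV hV hT (-q)
  obtain ⟨ψ, hψ⟩ := hζ.exists_temperedDistribution h
  refine ⟨by rw [MemX, hqn]; exact ENNReal.ofReal_lt_top, ψ, reprFun hζ h, reprGrad hζ h,
    by rw [MemX, hζ.xNorm_half hψ]; exact ENNReal.ofReal_lt_top,
    isRepresentedBy_reprFun hζ hψ, hasWeakGradient_reprFun hζ h, memL2loc_unGauss _,
    fun j K hK => (memL2loc_unGauss _ K hK).neg, (solvesFormEq_iff hζ h0 hA hq hψ).mpr hh, ?_, ?_⟩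
  · intro ψ' u' w' hψ' hu' hw' hs'
    obtain ⟨h', hp'⟩ := hζ.exists_profile hψ'
    have hu : u' =ᵐ[volume] reprFun hζ h' := hu'.ae_eq (isRepresentedBy_reprFun hζ hp')
    have hw := hw'.ae_eq (hasWeakGradient_reprFun hζ h') hu
    have hs : SolvesFormEq ζ a₀ A ψ' (reprFun hζ h') (reprGrad hζ h') := by
      intro φ hφ
      rw [← hs' φ hφ]
      congr 1
      refine form_congr_ae ?_ fun j => ?_
      · filter_upwards [hu] with x hx
        rw [hx]
      · filter_upwards [hu, hw j] with x hx hx'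
        rw [hx, hx']
    have hh' := (solvesFormEq_iff hζ h0 hA hq hp').mp hs
    have hdiff : U (h' - h) + opT hζ a₀ A (h' - h) = 0 := by
      rw [map_sub, map_sub, sub_add_sub_comm, hh, hh', sub_self]
    have hn := norm_le_two_mul_of_small_perturbation hVU hV hT hdiff
    rw [norm_zero, mul_zero] at hn
    have : h' = h := by rwa [norm_le_zero_iff, sub_eq_zero] at hn
    subst this
    ext φ
    have hφ : φ = 𝓕 (𝓕⁻ φ : 𝓢(E n, ℂ)) := (FourierTransform.fourier_fourierInv_eq φ).symm
    rw [hφ, (hp'.2 _).2, (hψ.2 _).2]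
  · rw [hζ.xNorm_half hψ, hqn, ← ENNReal.ofReal_mul (by norm_num)]
    refine ENNReal.ofReal_le_ofReal ?_
    have := norm_le_two_mul_of_small_perturbation hVU hV hT hh
    rwa [norm_neg] at this

end Solver

/-! ### Mollification -/

section Mollification

variable {n : ℕ}

lemma norm_e (j : Fin n) : ‖(e j : E n)‖ = 1 := by simp [e]

lemma norm_pd_le {G : Type*} [NormedAddCommGroup G] [NormedSpace ℝ G] (j : Fin n) (f : E n → G)
    (x : E n) : ‖pd j f x‖ ≤ ‖fderiv ℝ f x‖ := by
  have := (fderiv ℝ f x).le_opNorm (e j)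
  rwa [norm_e, mul_one] at this

/-- Mollification at a fixed scale `r`, with a gradient bound depending only on `r`. -/
lemma exists_mollifier (n : ℕ) {r : ℝ} (hr : 0 < r) :
    ∃ B : ℝ, 0 ≤ B ∧ ∀ (f : E n → ℝ) (ρ N δ : ℝ), Continuous f → (∀ x, ‖f x‖ ≤ N) →
      (∀ x, ρ < ‖x‖ → f x = 0) → (∀ x y, dist x y < r → dist (f x) (f y) ≤ δ) →
      ∃ S : 𝓢(E n, ℂ), (∀ x, ‖(f x : ℂ) - S x‖ ≤ δ) ∧ (∀ x, ρ + r < ‖x‖ → S x = 0) ∧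
        (∀ j x, ρ + r < ‖x‖ → pd j S x = 0) ∧ ∀ j x, ‖pd j S x‖ ≤ B * N := by
  set φ : ContDiffBump (0 : E n) := ⟨r / 2, r, by positivity, by linarith⟩ with hφ
  set η := φ.normed (volume : Measure (E n)) with hη
  have hηc : HasCompactSupport η := φ.hasCompactSupport_normed
  have hηs : ∀ {m : ℕ∞}, ContDiff ℝ m η := φ.contDiff_normed
  have hη1 : ContDiff ℝ 1 η := by exact_mod_cast φ.contDiff_normed (n := 1)
  -- All derivatives fall on the fixed bump `η`, so the gradient bound is its `L¹` gradient norm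
  -- times `sup |f|`.
  refine ⟨∫ x, ‖fderiv ℝ η x‖, integral_nonneg fun x => norm_nonneg _,
    fun f ρ N δ hf hN hsupp hδ => ?_⟩
  set g : E n → ℝ := convolution η f (ContinuousLinearMap.lsmul ℝ ℝ) volume with hg
  have hfl : LocallyIntegrable f := hf.locallyIntegrable
  have hfc : HasCompactSupport f :=
    HasCompactSupport.intro (isCompact_closedBall (0 : E n) ρ) fun x hx =>
      hsupp x (by simpa using hx)
  have hgs : ContDiff ℝ ((⊤ : ℕ∞) : WithTop ℕ∞) g :=
    hηc.contDiff_convolution_left _ hηs hfl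
  have hgc : HasCompactSupport g := hηc.convolution _ hfc
  have hgd : ∀ x, HasFDerivAt g _ x := hηc.hasFDerivAt_convolution_left _ hη1 hfl
  have hc1 : HasCompactSupport (Complex.ofRealCLM ∘ g) := hgc.comp_left rfl
  have hc2 : ContDiff ℝ ((⊤ : ℕ∞) : WithTop ℕ∞) (Complex.ofRealCLM ∘ g) :=
    Complex.ofRealCLM.contDiff.comp hgs
  have hSg : ∀ x, hc1.toSchwartzMap hc2 x = (g x : ℂ) := fun x => rfl
  have hg0 : ∀ x, ρ + r < ‖x‖ → g x = 0 := by
    intro x hx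
    by_contra hne
    obtain ⟨y, hy, z, hz, rfl⟩ := support_convolution_subset _ hne
    rw [φ.support_normed_eq] at hy
    have h1 : ‖y‖ < r := by simpa [hφ] using hy
    have h2 : ‖z‖ ≤ ρ := by
      by_contra hc
      exact hz (hsupp z (not_le.mp hc))
    linarith [norm_add_le y z]
  have hS0 : ∀ x, ρ + r < ‖x‖ → hc1.toSchwartzMap hc2 x = 0 := fun x hx => by
    rw [hSg, hg0 x hx, Complex.ofReal_zero]
  refine ⟨hc1.toSchwartzMap hc2, fun x => ?_, hS0, fun j x hx => ?_, fun j x => ?_⟩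
  · rw [hSg, ← Complex.ofReal_sub, Complex.norm_real, ← dist_eq_norm, dist_comm]
    exact ContDiffBump.dist_normed_convolution_le hf.aestronglyMeasurable fun y hy =>
      hδ y x (by simpa [hφ] using hy)
  · have hev : (hc1.toSchwartzMap hc2 : E n → ℂ) =ᶠ[nhds x] fun _ => 0 := by
      have hopen : IsOpen {y : E n | ρ + r < ‖y‖} := isOpen_lt continuous_const continuous_norm
      filter_upwards [hopen.mem_nhds hx] with y hy
      exact hS0 y hy
    rw [pd, hev.fderiv_eq]
    simp
  · refine (norm_pd_le j _ x).trans ?_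
    have hS : HasFDerivAt (hc1.toSchwartzMap hc2 : E n → ℂ) _ x :=
      Complex.ofRealCLM.hasFDerivAt.comp x (hgd x)
    rw [hS.fderiv]
    refine (ContinuousLinearMap.opNorm_comp_le _ _).trans ?_
    rw [Complex.ofRealCLM_norm, one_mul, convolution, ← integral_mul_const]
    have hint : Integrable fun t => ‖fderiv ℝ η t‖ * N :=
      (((hη1.continuous_fderiv one_ne_zero).norm.integrable_of_hasCompactSupport
        (hηc.fderiv ℝ).norm)).mul_const N
    refine norm_integral_le_of_norm_le hint (Filter.Eventually.of_forall fun t => ?_)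
    refine ContinuousLinearMap.opNorm_le_bound _
      (mul_nonneg (norm_nonneg _) ((norm_nonneg _).trans (hN x))) fun v => ?_
    rw [ContinuousLinearMap.precompL_apply, ContinuousLinearMap.lsmul_apply, norm_smul,
      mul_right_comm]
    exact mul_le_mul ((fderiv ℝ η t).le_opNorm v) (hN _) (norm_nonneg _) (by positivity)

end Mollification

/-! ### The coefficients of the potential -/

section Coefficients

variable {n : ℕ}

/-- The a priori bounds on the coefficient `γ`. -/
structure IsConductivity (R M ε : ℝ) (γ : E n → ℝ) : Prop where
  contDiff : ContDiff ℝ 1 γ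
  norm_grad_le : ∀ x, ‖fderiv ℝ γ x‖ ≤ M
  holder : ∀ x y, ‖fderiv ℝ γ x - fderiv ℝ γ y‖ ≤ M * dist x y ^ ε
  lower : ∀ x, 1 / (2 * M) < γ x
  supp : ∀ x, R < ‖x‖ → fderiv ℝ γ x = 0

lemma isConductivity_of_c1HolderNorm_le {R M : ℝ} {ε : ℝ≥0} {γ : E n → ℝ} (hM : 1 < M)
    (hγ : ContDiff ℝ 1 γ) (hn : c1HolderNorm ε γ ≤ ENNReal.ofReal M)
    (hl : ∀ x, 1 / (2 * M) < γ x) (hs : tsupport (fun x => γ x - 1) ⊆ Metric.closedBall 0 R) :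
    IsConductivity R M ε γ where
  contDiff := hγ
  norm_grad_le x := by
    have h1 : ‖fderiv ℝ γ x‖ₑ ≤ ENNReal.ofReal M :=
      (le_iSup (fun x => ‖fderiv ℝ γ x‖ₑ) x).trans
        ((le_add_self.trans le_self_add).trans hn)
    rwa [← ofReal_norm, ENNReal.ofReal_le_ofReal_iff (by linarith)] at h1
  holder x y := by
    have h1 : eHolderNorm ε (fderiv ℝ γ) ≤ ENNReal.ofReal M := le_add_self.trans hn
    have h2 : MemHolder ε (fderiv ℝ γ) := eHolderNorm_lt_top.mp (h1.trans_lt ENNReal.ofReal_lt_top)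
    rw [← h2.coe_nnHolderNorm_eq_eHolderNorm] at h1
    have h3 : (nnHolderNorm ε (fderiv ℝ γ) : ℝ) ≤ M := by
      rw [← ENNReal.ofReal_coe_nnreal] at h1
      rwa [ENNReal.ofReal_le_ofReal_iff (by linarith)] at h1
    rw [← dist_eq_norm]
    refine (h2.holderWith.dist_le x y).trans ?_
    gcongr
  lower := hl
  supp x hx := by
    have h1 : x ∉ Function.support (fderiv ℝ fun x => γ x - 1) := fun hc => by
      have := hs (support_fderiv_subset ℝ hc)
      rw [mem_closedBall_zero_iff] at this
      linarith
    rwa [Function.mem_support, not_not, fderiv_sub_const] at h1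

namespace IsConductivity

variable {R M ε : ℝ} {γ : E n → ℝ}

lemma pos (h : IsConductivity R M ε γ) (hM : 1 < M) (x : E n) : 0 < γ x :=
  lt_trans (by positivity) (h.lower x)

lemma inv_le (h : IsConductivity R M ε γ) (hM : 1 < M) (x : E n) : (γ x)⁻¹ ≤ 2 * M := by
  have := h.lower x
  rw [one_div] at this
  exact (inv_le_comm₀ (by positivity) (h.pos hM x)).mp this.le

lemma abs_pd_le (h : IsConductivity R M ε γ) (j : Fin n) (x : E n) : |pd j γ x| ≤ M :=
  (norm_pd_le j γ x).trans (h.norm_grad_le x)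

lemma pd_eq_zero (h : IsConductivity R M ε γ) (j : Fin n) {x : E n} (hx : R < ‖x‖) :
    pd j γ x = 0 := by
  rw [pd, h.supp x hx]; rfl

lemma continuous_pd (h : IsConductivity R M ε γ) (j : Fin n) : Continuous (pd j γ) :=
  (h.contDiff.continuous_fderiv one_ne_zero).clm_apply continuous_const

lemma hasFDerivAt (h : IsConductivity R M ε γ) (x : E n) : HasFDerivAt γ (fderiv ℝ γ x) x :=
  (h.contDiff.differentiable one_ne_zero x).hasFDerivAt

lemma pd_sqrt (h : IsConductivity R M ε γ) (hM : 1 < M) (j : Fin n) (x : E n) :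
    pd j (fun y => √(γ y)) x = pd j γ x / (2 * √(γ x)) := by
  rw [pd, ((h.hasFDerivAt x).sqrt (h.pos hM x).ne').fderiv, smul_apply, smul_eq_mul, pd]
  ring

lemma pd_inv_sqrt (h : IsConductivity R M ε γ) (hM : 1 < M) (j : Fin n) (x : E n) :
    pd j (fun y => (√(γ y))⁻¹) x = -pd j γ x / (2 * γ x * √(γ x)) := by
  have hp := h.pos hM x
  have hs := Real.sqrt_pos.mpr hp
  have h1 := (h.hasFDerivAt x).sqrt hp.ne'
  have h2 := (hasDerivAt_inv hs.ne').comp_hasFDerivAt x h1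
  have h3 : pd j (fun y => (√(γ y))⁻¹) x =
      (-((√(γ x)) ^ 2)⁻¹ • (1 / (2 * √(γ x))) • fderiv ℝ γ x) (e j) := by
    rw [pd]; exact congrArg (· (e j)) h2.fderiv
  rw [h3, smul_apply, smul_apply, smul_eq_mul, smul_eq_mul, Real.sq_sqrt hp.le, pd]
  field_simp

end IsConductivity

/-- The vector field `γ^{-1/2} ∇γ^{1/2} = ∇γ / (2 γ)`. -/
def drift (γ : E n → ℝ) (j : Fin n) (x : E n) : ℝ := pd j γ x / (2 * γ x)

/-- The zeroth-order coefficient `∇γ^{1/2} · ∇γ^{-1/2} + 1_Ω (k² + D) / γ`. -/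
def potential (Ω : Set (E n)) (γ : E n → ℝ) (D : E n → ℂ) (k : ℝ) (x : E n) : ℂ :=
  (∑ j, ((-(pd j γ x) ^ 2 / (4 * γ x ^ 2) : ℝ) : ℂ)) +
    Ω.indicator (fun x => ((k : ℂ) ^ 2 + D x) * ((γ x : ℝ) : ℂ)⁻¹) x

namespace IsConductivity

variable {R M ε : ℝ} {γ : E n → ℝ}

lemma continuous_drift (h : IsConductivity R M ε γ) (hM : 1 < M) (j : Fin n) :
    Continuous (drift γ j) :=
  (h.continuous_pd j).div (continuous_const.mul h.contDiff.continuous)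
    fun x => (mul_pos two_pos (h.pos hM x)).ne'

lemma abs_drift_le (h : IsConductivity R M ε γ) (hM : 1 < M) (j : Fin n) (x : E n) :
    |drift γ j x| ≤ M ^ 2 := by
  have hp := h.pos hM x
  have h1 := h.abs_pd_le j x
  have h2 := h.inv_le hM x
  have h3 : drift γ j x = pd j γ x * ((γ x)⁻¹ / 2) := by
    rw [drift]; field_simp
  rw [h3, abs_mul, abs_of_pos (a := (γ x)⁻¹ / 2) (by positivity)]
  calc |pd j γ x| * ((γ x)⁻¹ / 2) ≤ M * (2 * M / 2) := by gcongr
    _ = M ^ 2 := by ring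

lemma drift_eq_zero (h : IsConductivity R M ε γ) (j : Fin n) {x : E n} (hx : R < ‖x‖) :
    drift γ j x = 0 := by
  rw [drift, h.pd_eq_zero j hx, zero_div]

lemma abs_sub_le (h : IsConductivity R M ε γ) (x y : E n) : |γ x - γ y| ≤ M * dist x y := by
  have := convex_univ.norm_image_sub_le_of_norm_fderiv_le (𝕜 := ℝ) (f := γ) (C := M)
    (fun z _ => (h.hasFDerivAt z).differentiableAt) (fun z _ => h.norm_grad_le z)
    (Set.mem_univ y) (Set.mem_univ x)
  rwa [← dist_eq_norm x y] at this

/-- The quotient rule for differences, with `1/γ ≤ 2M`. Restricting to distances at most one lets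
the Lipschitz bound on `γ` be read as an `ε`-Hölder bound with the same constant. -/
lemma dist_drift_le (h : IsConductivity R M ε γ) (hM : 1 < M) (hε : ε ≤ 1) (j : Fin n)
    {x y : E n} (hxy : dist x y ≤ 1) :
    dist (drift γ j x) (drift γ j y) ≤ (M ^ 2 + 2 * M ^ 4) * dist x y ^ ε := by
  have hx := h.pos hM x
  have hy := h.pos hM y
  have hix := h.inv_le hM x
  have hiy := h.inv_le hM y
  have h1 : |pd j γ x - pd j γ y| ≤ M * dist x y ^ ε := by
    refine le_trans ?_ (h.holder x y)
    have := (fderiv ℝ γ x - fderiv ℝ γ y).le_opNorm (e j)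
    rwa [norm_e, mul_one] at this
  have h2 : |γ y - γ x| ≤ M * dist x y ^ ε := by
    refine (h.abs_sub_le y x).trans ?_
    rw [dist_comm]
    gcongr
    exact Real.self_le_rpow_of_le_one dist_nonneg hxy hε
  have h3 := h.abs_pd_le j y
  have hpow : 0 ≤ dist x y ^ ε := Real.rpow_nonneg dist_nonneg _
  have key : drift γ j x - drift γ j y = (pd j γ x - pd j γ y) * ((γ x)⁻¹ / 2) +
      pd j γ y * ((γ y - γ x) * ((γ x)⁻¹ * (γ y)⁻¹ / 2)) := by
    rw [drift, drift]; field_simp; ring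
  rw [Real.dist_eq, key]
  refine (abs_add_le _ _).trans ?_
  rw [abs_mul, abs_mul, abs_mul, abs_of_pos (a := (γ x)⁻¹ / 2) (by positivity),
    abs_of_pos (a := (γ x)⁻¹ * (γ y)⁻¹ / 2) (by positivity)]
  calc |pd j γ x - pd j γ y| * ((γ x)⁻¹ / 2) +
        |pd j γ y| * (|γ y - γ x| * ((γ x)⁻¹ * (γ y)⁻¹ / 2))
      ≤ (M * dist x y ^ ε) * (2 * M / 2) +
        M * ((M * dist x y ^ ε) * ((2 * M) * (2 * M) / 2)) := by gcongr
    _ = (M ^ 2 + 2 * M ^ 4) * dist x y ^ ε := by ring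

lemma bddCoeff_drift (h : IsConductivity R M ε γ) (hM : 1 < M) (j : Fin n) :
    BddCoeff R (M ^ 2) (fun x => (drift γ j x : ℂ)) where
  aesm := (Complex.continuous_ofReal.comp (h.continuous_drift hM j)).aestronglyMeasurable
  bound := Filter.Eventually.of_forall fun x => by
    rw [Complex.norm_real]; exact h.abs_drift_le hM j x
  supp x hx := by rw [h.drift_eq_zero j hx, Complex.ofReal_zero]

lemma bddCoeff_sq (h : IsConductivity R M ε γ) (hM : 1 < M) (j : Fin n) :
    BddCoeff R (M ^ 4) (fun x => ((-(pd j γ x) ^ 2 / (4 * γ x ^ 2) : ℝ) : ℂ)) where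
  aesm := by
    refine (Complex.continuous_ofReal.comp ?_).aestronglyMeasurable
    exact ((h.continuous_pd j).pow 2).neg.div (continuous_const.mul (h.contDiff.continuous.pow 2))
      fun x => by have := h.pos hM x; positivity
  bound := Filter.Eventually.of_forall fun x => by
    have hp := h.pos hM x
    have h1 : -(pd j γ x) ^ 2 / (4 * γ x ^ 2) = -(drift γ j x) ^ 2 := by
      rw [drift]; field_simp; ring
    rw [Complex.norm_real, h1, norm_neg, norm_pow, Real.norm_eq_abs, show M ^ 4 = (M ^ 2) ^ 2 by
      ring]
    gcongr
    exact h.abs_drift_le hM j x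
  supp x hx := by rw [h.pd_eq_zero j hx]; simp

lemma bddCoeff_zeroth (h : IsConductivity R M ε γ) (hM : 1 < M) {Ω : Set (E n)} (hΩ : IsOpen Ω)
    (hΩR : closure Ω ⊆ Metric.ball 0 R) {D : E n → ℂ}
    (hD : AEStronglyMeasurable D (volume.restrict Ω))
    (hDM : eLpNorm D ∞ (volume.restrict Ω) ≤ ENNReal.ofReal M) (k : ℝ) :
    BddCoeff R ((k ^ 2 + M) * (2 * M))
      (Ω.indicator (fun x => ((k : ℂ) ^ 2 + D x) * ((γ x : ℝ) : ℂ)⁻¹)) where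
  aesm := by
    rw [aestronglyMeasurable_indicator_iff hΩ.measurableSet]
    refine (aestronglyMeasurable_const.add hD).mul ?_
    refine Continuous.aestronglyMeasurable ?_
    exact (Complex.continuous_ofReal.comp h.contDiff.continuous).inv₀
      fun x => Complex.ofReal_ne_zero.mpr (h.pos hM x).ne'
  bound := by
    have h1 : ∀ᵐ x ∂(volume.restrict Ω), ‖D x‖ ≤ M := by
      rw [eLpNorm_exponent_top] at hDM
      filter_upwards [ae_le_eLpNormEssSup (f := D) (μ := volume.restrict Ω)] with x hx
      have := hx.trans hDM
      rwa [← ofReal_norm, ENNReal.ofReal_le_ofReal_iff (by linarith)] at this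
    rw [ae_restrict_iff' hΩ.measurableSet] at h1
    filter_upwards [h1] with x hx
    by_cases hxΩ : x ∈ Ω
    · rw [Set.indicator_of_mem hxΩ, norm_mul, norm_inv, Complex.norm_real,
        Real.norm_of_nonneg (h.pos hM x).le]
      refine mul_le_mul ((norm_add_le _ _).trans (add_le_add ?_ (hx hxΩ))) (h.inv_le hM x)
        (inv_nonneg.mpr (h.pos hM x).le) (by positivity)
      rw [norm_pow, Complex.norm_real, Real.norm_eq_abs, sq_abs]
    · rw [Set.indicator_of_notMem hxΩ, norm_zero]
      positivity
  supp x hx := by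
    refine Set.indicator_of_notMem (fun hxΩ => ?_) _
    have := hΩR (subset_closure hxΩ)
    rw [mem_ball_zero_iff] at this
    linarith

lemma bddCoeff_potential (h : IsConductivity R M ε γ) (hM : 1 < M) {Ω : Set (E n)}
    (hΩ : IsOpen Ω) (hΩR : closure Ω ⊆ Metric.ball 0 R) {D : E n → ℂ}
    (hD : AEStronglyMeasurable D (volume.restrict Ω))
    (hDM : eLpNorm D ∞ (volume.restrict Ω) ≤ ENNReal.ofReal M) (k : ℝ) :
    BddCoeff R (n * M ^ 4 + (k ^ 2 + M) * (2 * M)) (potential Ω γ D k) :=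
  (BddCoeff.sum fun j => h.bddCoeff_sq hM j).add (h.bddCoeff_zeroth hM hΩ hΩR hD hDM k)

/-- Only first derivatives of `γ` enter: `γ^{-1/2} ∇γ^{1/2} = ∇γ/(2γ)` and `∇γ^{1/2}·∇γ^{-1/2} =
-|∇γ|²/(4γ²)`. All coefficients are bounded with compact support, so local integrability of `f` and
`F` suffices to split the integrals. -/
lemma qPairing_eq_form (h : IsConductivity R M ε γ) (hM : 1 < M) {Ω : Set (E n)}
    (hΩ : IsOpen Ω) (hΩR : closure Ω ⊆ Metric.ball 0 R) {D : E n → ℂ}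
    (hD : AEStronglyMeasurable D (volume.restrict Ω))
    (hDM : eLpNorm D ∞ (volume.restrict Ω) ≤ ENNReal.ofReal M) (k : ℝ) {f : E n → ℂ}
    {F : Fin n → E n → ℂ} (hf : LocallyIntegrable f) (hF : ∀ j, LocallyIntegrable (F j)) :
    qPairing Ω γ D k f F = form (potential Ω γ D k) (fun j x => (drift γ j x : ℂ)) f F := by
  have i1 := fun j => (h.bddCoeff_sq hM j).integrable_mul hf
  have i2 := fun j => (h.bddCoeff_drift hM j).integrable_mul (hF j)
  have i3 := (h.bddCoeff_zeroth hM hΩ hΩR hD hDM k).integrable_mul hf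
  have e1 : ∀ x, ∑ j, ((pd j (fun y => √(γ y)) x : ℝ) : ℂ) *
      (((pd j (fun y => (√(γ y))⁻¹) x : ℝ) : ℂ) * f x + (((√(γ x))⁻¹ : ℝ) : ℂ) * F j x) =
      (∑ j, ((-(pd j γ x) ^ 2 / (4 * γ x ^ 2) : ℝ) : ℂ)) * f x +
        ∑ j, (drift γ j x : ℂ) * F j x := by
    intro x
    rw [Finset.sum_mul, ← Finset.sum_add_distrib]
    refine Finset.sum_congr rfl fun j _ => ?_
    have hp := h.pos hM x
    have hs := Real.sqrt_pos.mpr hp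
    have hss := Real.mul_self_sqrt hp.le
    have c1 : pd j (fun y => √(γ y)) x * pd j (fun y => (√(γ y))⁻¹) x =
        -(pd j γ x) ^ 2 / (4 * γ x ^ 2) := by
      rw [h.pd_sqrt hM, h.pd_inv_sqrt hM, div_mul_div_comm, show 2 * √(γ x) * (2 * γ x * √(γ x)) =
        4 * γ x * (√(γ x) * √(γ x)) by ring, hss]
      ring
    have c2 : pd j (fun y => √(γ y)) x * (√(γ x))⁻¹ = drift γ j x := by
      rw [h.pd_sqrt hM, drift, ← div_eq_mul_inv, div_div, mul_assoc, hss]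
    rw [← c1, ← c2]
    push_cast
    ring
  have e2 : ∫ x in Ω, ((k : ℂ) ^ 2 + D x) * ((γ x : ℝ) : ℂ)⁻¹ * f x =
      ∫ x, Ω.indicator (fun x => ((k : ℂ) ^ 2 + D x) * ((γ x : ℝ) : ℂ)⁻¹) x * f x := by
    rw [← integral_indicator hΩ.measurableSet]
    refine integral_congr_ae (Filter.Eventually.of_forall fun x => ?_)
    simp only [Set.indicator_mul_left]
  have i1' : Integrable fun x =>
      (∑ j, ((-(pd j γ x) ^ 2 / (4 * γ x ^ 2) : ℝ) : ℂ)) * f x :=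
    (BddCoeff.sum fun j => h.bddCoeff_sq hM j).integrable_mul hf
  rw [qPairing, form, e2]
  simp only [e1]
  rw [integral_add i1' (integrable_finsetSum _ fun j _ => i2 j),
    integral_finsetSum _ fun j _ => i2 j]
  have e3 : ∫ x, potential Ω γ D k x * f x =
      (∫ x, (∑ j, ((-(pd j γ x) ^ 2 / (4 * γ x ^ 2) : ℝ) : ℂ)) * f x) +
        ∫ x, Ω.indicator (fun x => ((k : ℂ) ^ 2 + D x) * ((γ x : ℝ) : ℂ)⁻¹) x * f x := by
    rw [← integral_add i1' i3]
    refine integral_congr_ae (Filter.Eventually.of_forall fun x => ?_)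
    exact add_mul _ _ _
  rw [e3]
  ring

end IsConductivity

/-! ### Smallness of the perturbation -/

lemma BddCoeff.mono_radius {ρ ρ' N : ℝ} {a : E n → ℂ} (h : BddCoeff ρ N a) (hρ : ρ ≤ ρ') :
    BddCoeff ρ' N a :=
  ⟨h.aesm, h.bound, fun x hx => h.supp x (hρ.trans_lt hx)⟩

/-- The perturbation is small once `|ζ|` is large compared with `k²`. -/
theorem exists_norm_opT_le (n : ℕ) {R M ε : ℝ} (hM : 1 < M) (hε0 : 0 < ε)
    (hε1 : ε ≤ 1) : ∃ Cstar : ℝ, 10 ≤ Cstar ∧ ∀ {Ω : Set (E n)} {γ : E n → ℝ} {D : E n → ℂ} {k : ℝ}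
      {ζ : EuclideanSpace ℂ (Fin n)} (hζ : Admissible ζ), IsConductivity R M ε γ → IsOpen Ω →
      closure Ω ⊆ Metric.ball 0 R → AEStronglyMeasurable D (volume.restrict Ω) →
      eLpNorm D ∞ (volume.restrict Ω) ≤ ENNReal.ofReal M → 1 ≤ k → Cstar * k ^ 2 ≤ ‖ζ‖ →
      ‖opT hζ (potential Ω γ D k) (fun j x => (drift γ j x : ℂ))‖ ≤ 1 / 2 := by
  set κ := Real.exp (Real.pi * (R + 1) ^ 2) ^ 2 * symbConst n with hκ
  have hκ0 : 0 < κ := mul_pos (by positivity) (symbConst_pos n)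
  -- Chosen so that the nonsmooth remainder of the drift contributes `κ · 2nδ = n/(4(n+1)) ≤ 1/4`.
  -- The mollification scale `r ≤ 1` below then depends only on the data, and supports grow at most
  -- to radius `R + 1`.
  set δ := 1 / (8 * κ * (n + 1)) with hδ
  have hδ0 : 0 < δ := by positivity
  obtain ⟨r, hr0, hr1, hrδ⟩ : ∃ r : ℝ, 0 < r ∧ r ≤ 1 ∧ (M ^ 2 + 2 * M ^ 4) * r ^ ε ≤ δ := by
    refine ⟨min 1 ((δ / (M ^ 2 + 2 * M ^ 4)) ^ (1 / ε)), by positivity, min_le_left _ _, ?_⟩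
    rw [← le_div_iff₀' (by positivity)]
    calc (min 1 ((δ / (M ^ 2 + 2 * M ^ 4)) ^ (1 / ε))) ^ ε
        ≤ ((δ / (M ^ 2 + 2 * M ^ 4)) ^ (1 / ε)) ^ ε := by gcongr; exact min_le_right _ _
      _ = δ / (M ^ 2 + 2 * M ^ 4) := by
        rw [← Real.rpow_mul (by positivity), one_div_mul_cancel hε0.ne', Real.rpow_one]
  obtain ⟨B, hB0, hB⟩ := exists_mollifier n hr0
  set N₀ := n * M ^ 4 + (1 + M) * (2 * M) + n * (B * M ^ 2) with hN₀
  have hN₀0 : 0 ≤ N₀ := by positivity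
  -- The zeroth-order coefficient, including `div S`, is at most `N₀ k²`; the factor `4κN₀` makes
  -- its contribution at most `1/4`, and the summand `10` keeps the constant above the admissibility
  -- threshold.
  refine ⟨4 * κ * N₀ + 10, by nlinarith [mul_nonneg hκ0.le hN₀0], ?_⟩
  intro Ω γ D k ζ hζ hγ hΩ hΩR hD hDM hk hζk
  have hdrift : ∀ j x y, dist x y < r → dist (drift γ j x) (drift γ j y) ≤ δ := by
    intro j x y hxy
    refine (hγ.dist_drift_le hM hε1 j (hxy.le.trans hr1)).trans (le_trans ?_ hrδ)
    gcongr
  have hmoll := fun j => hB (drift γ j) R (M ^ 2) δ (hγ.continuous_drift hM j)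
    (hγ.abs_drift_le hM j) (fun x hx => hγ.drift_eq_zero j hx) (hdrift j)
  choose S hS1 hS2 hS3 hS4 using hmoll
  have h0 := (hγ.bddCoeff_potential hM hΩ hΩR hD hDM k).mono_radius
    (show R ≤ R + 1 by linarith)
  have hA := fun j => (hγ.bddCoeff_drift hM j).mono_radius (show R ≤ R + 1 by linarith)
  have hdiff : ∀ j, BddCoeff (R + 1) δ (fun x => (drift γ j x : ℂ) + -S j x) := fun j =>
    { aesm := (hA j).aesm.add (S j).continuous.neg.aestronglyMeasurable
      bound := Filter.Eventually.of_forall fun x => by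
        rw [← sub_eq_add_neg]; exact hS1 j x
      supp := fun x hx => by
        rw [(hA j).supp x hx, hS2 j x (by linarith), neg_zero, add_zero] }
  have hS : ∀ j, BddCoeff (R + 1) (M ^ 2 + δ) (S j) := fun j =>
    { aesm := (S j).continuous.aestronglyMeasurable
      bound := by
        filter_upwards [(hA j).bound] with x hx
        calc ‖S j x‖ = ‖(drift γ j x : ℂ) - ((drift γ j x : ℂ) - S j x)‖ := by
              rw [sub_sub_cancel]
          _ ≤ M ^ 2 + δ := (norm_sub_le _ _).trans (add_le_add hx (hS1 j x))
      supp := fun x hx => hS2 j x (by linarith) }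
  have hdS : ∀ j, BddCoeff (R + 1) (B * M ^ 2) (pd j (S j)) := fun j =>
    { aesm := (continuous_pd j (S j)).aestronglyMeasurable
      bound := Filter.Eventually.of_forall fun x => hS4 j j x
      supp := fun x hx => hS3 j j x (by linarith) }
  rw [opT_eq_of_smooth hζ h0 hA S hS hdS]
  refine (norm_opT_le hζ (h0.add (BddCoeff.sum hdS).neg) hdiff).trans ?_
  rw [← hκ]
  have hk2 : 1 ≤ k ^ 2 := one_le_pow₀ hk
  have hN : n * M ^ 4 + (k ^ 2 + M) * (2 * M) + n * (B * M ^ 2) ≤ N₀ * k ^ 2 := by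
    have a1 : n * M ^ 4 ≤ n * M ^ 4 * k ^ 2 := le_mul_of_one_le_right (by positivity) hk2
    have a2 : M * (2 * M) ≤ M * (2 * M) * k ^ 2 := le_mul_of_one_le_right (by positivity) hk2
    have a3 : n * (B * M ^ 2) ≤ n * (B * M ^ 2) * k ^ 2 :=
      le_mul_of_one_le_right (by positivity) hk2
    rw [hN₀]
    linarith
  have hζ0 : 0 < ‖ζ‖ := by linarith [hζ.large]
  have t1 : κ * ((n * M ^ 4 + (k ^ 2 + M) * (2 * M) + n * (B * M ^ 2)) / ‖ζ‖) ≤ 1 / 4 := by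
    rw [← mul_div_assoc, div_le_iff₀ hζ0]
    nlinarith [mul_le_mul_of_nonneg_left hN hκ0.le]
  have t2 : κ * (2 * n * δ) ≤ 1 / 4 := by
    have : κ * (2 * n * δ) = n / (4 * (n + 1)) := by
      rw [hδ]; field_simp; ring
    rw [this, div_le_div_iff₀ (by positivity) (by positivity)]
    linarith
  rw [mul_add]
  linarith

end Coefficients

/-! ### Multiplication by `e^{ζ·x}` -/

section Exponential

variable {n : ℕ} {ζ : EuclideanSpace ℂ (Fin n)}

variable (ζ) in
/-- `x ↦ ζ · x` as a continuous linear map. -/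
def cdotCLM : E n →L[ℝ] ℂ :=
  ∑ j, (ζ j) • (Complex.ofRealCLM ∘L (EuclideanSpace.proj j : E n →L[ℝ] ℝ))

lemma cdotCLM_apply (x : E n) : cdotCLM ζ x = cdot ζ x := by
  simp [cdotCLM, cdot, sum_apply]

lemma cdotCLM_e (j : Fin n) : cdotCLM ζ (e j) = ζ j := by
  rw [cdotCLM_apply, cdot, Finset.sum_eq_single j (fun i _ hi => by simp [e, hi]) (by simp)]
  simp [e]

lemma continuous_exp_cdot : Continuous fun x : E n => Complex.exp (cdot ζ x) := by
  simp only [← cdotCLM_apply]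
  exact Complex.continuous_exp.comp (cdotCLM ζ).continuous

/-- The exponential is not tempered, but it acts on compactly supported test functions; weak
identities for `e^{ζ·x} u` against `φ` become identities for `u` against `Φ`. -/
lemma exists_exp_mul (ζ : EuclideanSpace ℂ (Fin n)) {φ : 𝓢(E n, ℂ)} (hφ : HasCompactSupport φ) :
    ∃ Φ : 𝓢(E n, ℂ), HasCompactSupport Φ ∧ (∀ x, Φ x = Complex.exp (cdot ζ x) * φ x) ∧
      ∀ j x, Complex.exp (cdot ζ x) * pd j φ x = pd j Φ x - ζ j * Φ x := by
  have hs : ContDiff ℝ ((⊤ : ℕ∞) : WithTop ℕ∞) fun x => Complex.exp (cdotCLM ζ x) * φ x :=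
    (cdotCLM ζ).contDiff.cexp.mul (φ.smooth ⊤)
  have hc : HasCompactSupport fun x => Complex.exp (cdotCLM ζ x) * φ x := hφ.mul_left
  refine ⟨hc.toSchwartzMap hs, hc, fun x => ?_, fun j x => ?_⟩
  · rw [← cdotCLM_apply]; rfl
  · have h1 := ((cdotCLM ζ).hasFDerivAt (x := x)).cexp
    have h2 := (h1.mul (φ.hasFDerivAt x)).fderiv
    have h3 : pd j (hc.toSchwartzMap hs) x = _ := congrArg (· (e j)) h2
    have h4 : hc.toSchwartzMap hs x = Complex.exp (cdotCLM ζ x) * φ x := rfl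
    rw [h3, h4]
    simp only [add_apply, smul_apply, smul_eq_mul, cdotCLM_e]
    rw [cdotCLM_apply, pd]
    ring

lemma integral_pd_eq_zero {φ : 𝓢(E n, ℂ)} (j : Fin n) : ∫ x, pd j φ x = 0 := by
  have h := integral_smul_fderiv_eq_neg_fderiv_smul_of_integrable (𝕜 := ℝ)
    (μ := (volume : Measure (E n))) (f := fun _ => (1 : ℝ)) (g := φ) (v := e j)
    (by simp) (by simp only [one_smul]; exact (∂_{(e j : E n)} φ : 𝓢(E n, ℂ)).integrable)
    (by simpa using φ.integrable) (by fun_prop) (fun _ _ => φ.differentiableAt)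
  simpa [pd] using h

lemma integrable_mul_schwartz {u : E n → ℂ} (hu : LocallyIntegrable u) {φ : E n → ℂ}
    (hc : Continuous φ) (hφ : HasCompactSupport φ) : Integrable fun x => u x * φ x :=
  (hu.integrable_smul_left_of_hasCompactSupport hc hφ).congr
    (Filter.Eventually.of_forall fun x => by simp [mul_comm])

lemma HasWeakGradient.one_add {u : E n → ℂ} {w : Fin n → E n → ℂ} (h : HasWeakGradient u w) :
    HasWeakGradient (fun x => 1 + u x) w := by
  refine ⟨continuous_const.locallyIntegrable.add h.1, h.2.1, fun φ hφ j => ?_⟩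
  have hi := integrable_mul_schwartz h.1 (continuous_pd j φ) (hasCompactSupport_lineDerivOp hφ (e j))
  have hi' : Integrable (pd j φ) := (∂_{(e j : E n)} φ : 𝓢(E n, ℂ)).integrable
  simp only [add_mul, one_mul]
  rw [integral_add hi' hi, h.2.2 φ hφ j,
    integral_pd_eq_zero, zero_add]

/-- The weak gradient of `e^{ζ·x} u`. -/
lemma HasWeakGradient.exp_mul {u : E n → ℂ} {w : Fin n → E n → ℂ} (h : HasWeakGradient u w) :
    HasWeakGradient (fun x => Complex.exp (cdot ζ x) * u x)
      (fun j x => Complex.exp (cdot ζ x) * (ζ j * u x + w j x)) := by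
  refine ⟨h.1.continuous_mul continuous_exp_cdot, fun j =>
    ((h.1.continuous_mul continuous_const).add (h.2.1 j)).continuous_mul continuous_exp_cdot,
    fun φ hφ j => ?_⟩
  obtain ⟨Φ, hΦc, hΦ, hdΦ⟩ := exists_exp_mul ζ hφ
  have i1 := integrable_mul_schwartz h.1 (continuous_pd j Φ)
    (hasCompactSupport_lineDerivOp hΦc (e j))
  have i2 := integrable_mul_schwartz h.1 Φ.continuous hΦc
  have i3 := integrable_mul_schwartz (h.2.1 j) Φ.continuous hΦc
  have e1 : ∀ x, Complex.exp (cdot ζ x) * u x * pd j φ x =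
      u x * pd j Φ x - ζ j * (u x * Φ x) := fun x => by
    linear_combination u x * hdΦ j x
  have e2 : ∀ x, Complex.exp (cdot ζ x) * (ζ j * u x + w j x) * φ x =
      ζ j * (u x * Φ x) + w j x * Φ x := fun x => by
    rw [hΦ]; ring
  simp only [e1, e2]
  rw [integral_sub i1 (i2.const_mul _), integral_add (i2.const_mul _) i3, h.2.2 Φ hΦc j,
    integral_const_mul]
  ring

/-- Conjugating the Laplacian with `e^{ζ·x}` gives `Δ_ζ`, in weak form. -/
lemma neg_integral_grad_exp_mul {u : E n → ℂ} {w : Fin n → E n → ℂ} (h : HasWeakGradient u w)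
    (hζ : ∑ j, ζ j * ζ j = 0) {φ Φ : 𝓢(E n, ℂ)} (hΦc : HasCompactSupport Φ)
    (hdΦ : ∀ j x, Complex.exp (cdot ζ x) * pd j φ x = pd j Φ x - ζ j * Φ x) :
    -(∫ x, ∑ j, Complex.exp (cdot ζ x) * (ζ j * u x + w j x) * pd j φ x) =
      ∑ j, (2 * ζ j * (∫ x, w j x * Φ x) - ∫ x, w j x * pd j Φ x) := by
  have i1 := fun j => integrable_mul_schwartz h.1 (continuous_pd j Φ)
    (hasCompactSupport_lineDerivOp hΦc (e j))
  have i2 := integrable_mul_schwartz h.1 Φ.continuous hΦc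
  have i3 := fun j => integrable_mul_schwartz (h.2.1 j) Φ.continuous hΦc
  have i4 := fun j => integrable_mul_schwartz (h.2.1 j) (continuous_pd j Φ)
    (hasCompactSupport_lineDerivOp hΦc (e j))
  have e1 : ∀ j x, Complex.exp (cdot ζ x) * (ζ j * u x + w j x) * pd j φ x =
      ζ j * (u x * pd j Φ x) + w j x * pd j Φ x -
        (ζ j * ζ j * (u x * Φ x) + ζ j * (w j x * Φ x)) := fun j x => by
    linear_combination (ζ j * u x + w j x) * hdΦ j x
  have j1 := fun j => ((i1 j).const_mul (ζ j)).fun_add (i4 j)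
  have j2 := fun j => (i2.const_mul (ζ j * ζ j)).fun_add ((i3 j).const_mul (ζ j))
  have e2 : ∀ j, ∫ x, Complex.exp (cdot ζ x) * (ζ j * u x + w j x) * pd j φ x =
      -(2 * ζ j * (∫ x, w j x * Φ x) - ∫ x, w j x * pd j Φ x) -
        ζ j * ζ j * ∫ x, u x * Φ x := fun j => by
    simp only [e1]
    rw [integral_sub (j1 j) (j2 j), integral_add ((i1 j).const_mul (ζ j)) (i4 j),
      integral_add (i2.const_mul (ζ j * ζ j)) ((i3 j).const_mul (ζ j)), integral_const_mul,
      integral_const_mul, integral_const_mul, h.2.2 Φ hΦc j]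
    ring
  have i5 : ∀ j ∈ Finset.univ, Integrable fun x =>
      Complex.exp (cdot ζ x) * (ζ j * u x + w j x) * pd j φ x := fun j _ => by
    simp only [e1]; exact (j1 j).sub (j2 j)
  rw [integral_finsetSum _ i5]
  -- The zeroth-order terms add up to `(ζ·ζ) ∫ u Φ`, which vanishes by isotropy.
  simp only [e2, Finset.sum_sub_distrib, Finset.sum_neg_distrib, ← Finset.sum_mul, hζ]
  ring

lemma lapZeta_eq_of_isRepresentedBy {ψ : 𝓢'(E n, ℂ)} {u : E n → ℂ} {w : Fin n → E n → ℂ}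
    (hu : IsRepresentedBy ψ u) (h : HasWeakGradient u w) {Φ : 𝓢(E n, ℂ)}
    (hΦc : HasCompactSupport Φ) :
    lapZeta ζ ψ Φ = ∑ j, (2 * ζ j * (∫ x, w j x * Φ x) - ∫ x, w j x * pd j Φ x) := by
  have hb : ∀ i, EuclideanSpace.basisFun (Fin n) ℝ i = e i := fun i => by
    simp [e, EuclideanSpace.basisFun_apply]
  have h1 : ∀ χ : 𝓢(E n, ℂ), HasCompactSupport χ → ∀ j,
      ψ (∂_{(e j : E n)} χ) = -∫ x, w j x * χ x := fun χ hχ j => by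
    rw [hu.2 _ (hasCompactSupport_lineDerivOp hχ _)]
    exact h.2.2 χ hχ j
  rw [lapZeta_apply, SchwartzMap.laplacian_eq_sum (EuclideanSpace.basisFun (Fin n) ℝ)]
  simp only [hb, map_sub, map_smul, map_sum, h1 _ hΦc,
    h1 _ (hasCompactSupport_lineDerivOp hΦc _), smul_eq_mul]
  rw [Finset.mul_sum, ← Finset.sum_sub_distrib]
  refine Finset.sum_congr rfl fun j _ => ?_
  simp only [pd_eq_lineDerivOp]
  ring

lemma form_add {ρ N N' : ℝ} {a₀ : E n → ℂ} {A : Fin n → E n → ℂ} (h0 : BddCoeff ρ N a₀)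
    (hA : ∀ j, BddCoeff ρ N' (A j)) {f g : E n → ℂ} {F G : Fin n → E n → ℂ}
    (hf : LocallyIntegrable f) (hg : LocallyIntegrable g) (hF : ∀ j, LocallyIntegrable (F j))
    (hG : ∀ j, LocallyIntegrable (G j)) :
    form a₀ A (fun x => f x + g x) (fun j x => F j x + G j x) =
      form a₀ A f F + form a₀ A g G := by
  simp only [form, mul_add]
  rw [integral_add (h0.integrable_mul hf) (h0.integrable_mul hg)]
  simp only [fun j => integral_add ((hA j).integrable_mul (hF j)) ((hA j).integrable_mul (hG j)),
    Finset.sum_add_distrib]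
  ring

/-- If `ψ` solves the remainder equation, then `e^{ζ·x} (1 + ψ)` solves the original equation. -/
lemma SolvesFormEq.exp_mul_one_add {ρ N N' : ℝ} {a₀ : E n → ℂ} {A : Fin n → E n → ℂ}
    (h0 : BddCoeff ρ N a₀) (hA : ∀ j, BddCoeff ρ N' (A j)) (hζ : ∑ j, ζ j * ζ j = 0)
    {ψ : 𝓢'(E n, ℂ)} {u : E n → ℂ} {w : Fin n → E n → ℂ} (hu : IsRepresentedBy ψ u)
    (hw : HasWeakGradient u w) (hs : SolvesFormEq ζ a₀ A ψ u w) {φ : 𝓢(E n, ℂ)}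
    (hφ : HasCompactSupport φ) :
    -(∫ x, ∑ j, Complex.exp (cdot ζ x) * (ζ j * (1 + u x) + w j x) * pd j φ x) +
      form a₀ A (fun x => Complex.exp (cdot ζ x) * (1 + u x) * φ x)
        (fun j x => Complex.exp (cdot ζ x) * (ζ j * (1 + u x) + w j x) * φ x +
          Complex.exp (cdot ζ x) * (1 + u x) * pd j φ x) = 0 := by
  obtain ⟨Φ, hΦc, hΦ, hdΦ⟩ := exists_exp_mul ζ hφ
  rw [neg_integral_grad_exp_mul hw.one_add hζ hΦc hdΦ, ← lapZeta_eq_of_isRepresentedBy hu hw hΦc]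
  -- The form evaluated at `v φ = (1 + u) Φ` separates into the `m_Q ψ` part and the `Q` part of the
  -- remainder equation tested against `Φ`.
  have e1 : (fun x => Complex.exp (cdot ζ x) * (1 + u x) * φ x) =
      fun x => u x * Φ x + Φ x := by
    funext x; rw [hΦ]; ring
  have e2 : (fun (j : Fin n) x => Complex.exp (cdot ζ x) * (ζ j * (1 + u x) + w j x) * φ x +
      Complex.exp (cdot ζ x) * (1 + u x) * pd j φ x) =
      fun j x => (w j x * Φ x + u x * pd j Φ x) + pd j Φ x := by
    funext j x
    linear_combination (1 + u x) * hdΦ j x - (ζ j * (1 + u x) + w j x) * hΦ x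
  rw [e1, e2, form_add (F := fun j x => w j x * Φ x + u x * pd j Φ x) h0 hA (locallyIntegrable_mul_continuous hw.1 Φ.continuous)
    Φ.continuous.locallyIntegrable
    (fun j => (locallyIntegrable_mul_continuous (hw.2.1 j) Φ.continuous).add
      (locallyIntegrable_mul_continuous hw.1 (continuous_pd j Φ)))
    (fun j => (continuous_pd j Φ).locallyIntegrable), ← add_assoc, hs Φ hΦc, neg_add_cancel]

lemma MemL2loc.one_add {u : E n → ℂ} (hu : MemL2loc u) : MemL2loc fun x => 1 + u x := by
  intro K hK
  have hfin : IsFiniteMeasure (volume.restrict K) := isFiniteMeasure_restrict.mpr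
    hK.measure_lt_top.ne
  have h1 : MemLp (fun _ : E n => (1 : ℂ)) 2 (volume.restrict K) :=
    MemLp.of_bound aestronglyMeasurable_const 1 (Filter.Eventually.of_forall fun x => by simp)
  exact h1.add (hu K hK)

end Exponential

end CGO

end

/-! ### The main theorem -/

theorem theorem3p1 (n : ℕ) (hn : 3 ≤ n)
    (Ω : Set (CGO.E n)) (hΩ : IsOpen Ω) (hΩb : Bornology.IsBounded Ω)
    (R : ℝ) (hR : 0 < R) (hΩR : closure Ω ⊆ Metric.ball 0 R)
    (M : ℝ) (hM : 1 < M) (ε : ℝ≥0) (hε0 : 0 < ε) (hε1 : ε < 1) :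
    ∃ Cstar : ℝ, 0 < Cstar ∧ ∃ C : ℝ, 0 < C ∧
      ∀ (γ : CGO.E n → ℝ) (D : CGO.E n → ℂ) (k : ℝ) (ζ : EuclideanSpace ℂ (Fin n)),
        ContDiff ℝ 1 γ → CGO.c1HolderNorm ε γ ≤ ENNReal.ofReal M →
        (∀ x, 1 / (2 * M) < γ x) →
        tsupport (fun x => γ x - 1) ⊆ Metric.closedBall 0 R →
        AEStronglyMeasurable D (volume.restrict Ω) →
        eLpNorm D ∞ (volume.restrict Ω) ≤ ENNReal.ofReal M →
        1 ≤ k → ∑ j, ζ j * ζ j = 0 → Cstar * k ^ 2 ≤ ‖ζ‖ →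
        CGO.MemX ζ (-1 / 2) (CGO.Q Ω γ D k) ∧
        ∃ ψ : 𝓢'(CGO.E n, ℂ),
          CGO.MemX ζ (1 / 2) ψ ∧
          CGO.SolvesRemainderEq Ω γ D k ζ ψ ∧
          (∀ ψ' : 𝓢'(CGO.E n, ℂ), CGO.MemX ζ (1 / 2) ψ' →
            CGO.SolvesRemainderEq Ω γ D k ζ ψ' → ψ' = ψ) ∧
          CGO.xNorm ζ (1 / 2) ψ ≤
            ENNReal.ofReal C * CGO.xNorm ζ (-1 / 2) (CGO.Q Ω γ D k) ∧
          ∃ u : CGO.E n → ℂ, CGO.IsRepresentedBy ψ u ∧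
            CGO.SolvesHelmholtz Ω γ D k
              (fun x => Complex.exp (CGO.cdot ζ x) * (1 + u x)) := by
  obtain ⟨Cstar, hC10, hC⟩ := CGO.exists_norm_opT_le n (R := R) (ε := ε) hM (by exact_mod_cast hε0)
    (by exact_mod_cast hε1.le)
  refine ⟨Cstar, by linarith, 2, two_pos, ?_⟩
  intro γ D k ζ hγ hγn hγl hγs hD hDM hk hζ hζk
  have hcond := CGO.isConductivity_of_c1HolderNorm_le hM hγ hγn hγl hγs
  -- `C_* ≥ 10` and `k ≥ 1` give `|ζ| ≥ 10`.
  have hadm : CGO.Admissible ζ := ⟨hζ, by nlinarith [one_le_pow₀ (n := 2) hk]⟩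
  have h0 := hcond.bddCoeff_potential hM hΩ hΩR hD hDM k
  have hA := hcond.bddCoeff_drift hM
  have hqf := fun {f : CGO.E n → ℂ} {F : Fin n → CGO.E n → ℂ} =>
    hcond.qPairing_eq_form (f := f) (F := F) hM hΩ hΩR hD hDM k
  have hQ : CGO.Q Ω γ D k = fun φ : 𝓢(CGO.E n, ℂ) => CGO.form (CGO.potential Ω γ D k)
      (fun j x => (CGO.drift γ j x : ℂ)) φ (fun j => CGO.pd j φ) := funext fun φ =>
    hqf φ.continuous.locallyIntegrable fun j => (CGO.continuous_pd j φ).locallyIntegrable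
  have hmQ : ∀ {u : CGO.E n → ℂ} {w : Fin n → CGO.E n → ℂ}, CGO.HasWeakGradient u w →
      ∀ φ : 𝓢(CGO.E n, ℂ), CGO.mQ Ω γ D k u w φ = CGO.form (CGO.potential Ω γ D k)
        (fun j x => (CGO.drift γ j x : ℂ)) (fun x => u x * φ x)
        (fun j x => w j x * φ x + u x * CGO.pd j φ x) := fun h φ =>
    hqf (CGO.locallyIntegrable_mul_continuous h.1 φ.continuous) fun j =>
      (CGO.locallyIntegrable_mul_continuous (h.2.1 j) φ.continuous).add
        (CGO.locallyIntegrable_mul_continuous h.1 (CGO.continuous_pd j φ))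
  have hsolve : ∀ {ψ : 𝓢'(CGO.E n, ℂ)} {u : CGO.E n → ℂ} {w : Fin n → CGO.E n → ℂ},
      CGO.HasWeakGradient u w → (CGO.SolvesFormEq ζ (CGO.potential Ω γ D k)
        (fun j x => (CGO.drift γ j x : ℂ)) ψ u w ↔
      ∀ φ : 𝓢(CGO.E n, ℂ), HasCompactSupport φ →
        CGO.lapZeta ζ ψ φ + CGO.mQ Ω γ D k u w φ = -CGO.Q Ω γ D k φ) := fun h => by
    simp only [CGO.SolvesFormEq, hmQ h, hQ]
  obtain ⟨hQmem, ψ, u, w, hψ, hu, hw, hu2, hw2, hs, huniq, hnorm⟩ :=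
    CGO.exists_unique_solvesFormEq hadm h0 hA (hC hadm hcond hΩ hΩR hD hDM hk hζk)
  rw [← hQ] at hQmem hnorm
  have hv := hw.one_add.exp_mul (ζ := ζ)
  have hu2' := hu2.one_add
  refine ⟨hQmem, ψ, hψ, ⟨u, w, hu, hw, (hsolve hw).mp hs⟩, ?_, hnorm, u, hu, _, hv,
    CGO.memL2loc_continuous_mul hu2' CGO.continuous_exp_cdot, fun j => ?_, fun φ hφ => ?_⟩
  · rintro ψ' hψ' ⟨u', w', hu', hw', hs'⟩
    exact huniq ψ' u' w' hψ' hu' hw' ((hsolve hw').mpr hs')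
  · refine CGO.memL2loc_continuous_mul (fun K hK => ?_) CGO.continuous_exp_cdot
    have := CGO.memL2loc_continuous_mul hu2' (c := fun _ => ζ j) continuous_const K hK
    exact this.add (hw2 j K hK)
  · rw [hmQ hv]
    exact hs.exp_mul_one_add h0 hA hζ hu hw hφ
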